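/- **Definitions.** A \emph{chord diagram} of $n$ chords is a set of $n$ disjoint properly embedded arcs (chords) in a disc, up to homotopy relative to endpoints, with $2n$ fixed marked endpoints on the boundary circle, one of which is the base point. An \emph{arc of attachment} in a chord diagram is an embedded arc which meets the chords in exactly three points, namely its two endpoints and one interior point, at which it crosses the chord; a \emph{bypass system} is a finite set of disjoint arcs of attachment. A small disc neighbourhood of an arc of attachment meets the chords in three parallel strands; if the arc is drawn horizontally, the six ends of the strands on the boundary of the neighbourhood are numbered $0,1,2,3,4,5$ clockwise starting at the top left, and the strands are $\{0,5\},\{1,4\},\{2,3\}$. \emph{Upwards} bypass surgery replaces the strands by $\{0,1\},\{2,5\},\{3,4\}$, \emph{downwards} bypass surgery by $\{1,2\},\{0,3\},\{4,5\}$ (disjoint arcs in the neighbourhood). Surgery on a bypass system performs this at all its arcs; the result is a chord diagram if and only if it has no closed loop. $SFH_{comb}(T,n)$ is the $\mathbb Z_2$-vector space generated by the chord diagrams of $n$ chords subject to the relations $\Gamma+\Gamma'+\Gamma''=0$ whenever $\Gamma',\Gamma''$ are the chord diagrams obtained from $\Gamma$ by upwards and by downwards surgery along one arc of attachment. For a word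 $w$ of length $n$ on $\{-,+\}$, the \emph{basis chord diagram} $\Gamma_w$, with $n+1$ chords, is $B_{w(1)}B_{w(2)}\cdots B_{w(n)}\Gamma_\emptyset$, where $\Gamma_\emptyset$ is the diagram with one chord and $B_-$ (respectively $B_+$) adds an outermost chord whose endpoints are the new base point and the next marked point anticlockwise (respectively clockwise) of it, the next marked point in the same direction being the old base point. The classes $v_w$ of the $\Gamma_w$ form a basis of $SFH_{comb}(T,n+1)$; the \emph{basis decomposition} of a chord diagram $\Gamma$ with $n+1$ chords is the unique set $S$ of words with $\Gamma=\sum_{w\in S}v_w$. Write $w_1\preceq w_2$, and $\Gamma_{w_1}\preceq\Gamma_{w_2}$, if $w_1$ and $w_2$ have the same length and the same number of $-$ signs and, for every $i$, the $i$-th $-$ sign of $w_1$ occurs to the left of, or in the same position as, the $i$-th $-$ sign of $w_2$. **Proposition.** Let $\Gamma_1=\Gamma_{w_1}\preceq\Gamma_2=\Gamma_{w_2}$ be basis chord diagrams. There exist a bypass system $FBS$ on $\Gamma_1$ and a bypass system $BBS$ on $\Gamma_2$ such that: 1. upwards bypass surgery on $FBS$ gives $\Gamma_2$; 2. downwards bypass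 surgery on $BBS$ gives $\Gamma_1$; 3. downwards bypass surgery on $FBS$, and likewise upwards bypass surgery on $BBS$, gives a chord diagram (without closed loops) whose basis decomposition contains $w_1$ and $w_2$, and every $w$ in this decomposition satisfies $w_1\preceq w\preceq w_2$. -/

import Mathlib

/-! ### Chord diagrams -/

/-- A chord diagram with `n` chords: the `2 * n` marked points on the boundary circle are labelled
`0, 1, …, 2 * n - 1` clockwise, `0` being the base point. A set of disjoint chords up to homotopy
relative to endpoints is the same as a non-crossing perfect matching of the marked points;
`partner p` is the other endpoint of the chord at `p`. -/
@[ext]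
structure ChordDiagram (n : ℕ) where
  partner : Fin (2 * n) → Fin (2 * n)
  partner_partner : ∀ p, partner (partner p) = p
  partner_ne : ∀ p, partner p ≠ p
  noncrossing : ∀ p q, p < q → q < partner p → partner q < partner p

namespace ChordDiagram

/-- The unique chord diagram with one chord (the vacuum). -/
def vacuum : ChordDiagram 1 where
  partner p := p.rev
  partner_partner p := Fin.rev_rev p
  partner_ne p := by
    intro h
    have := congrArg Fin.val h
    simp only [Fin.val_rev] at this
    omega
  noncrossing p q h1 h2 := by
    simp only [Fin.lt_def, Fin.val_rev] at *
    omega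

/-- The creation map `B₊`: add an outermost chord joining the base point `0` to the next marked
point clockwise, `1`. The old base point becomes the point `2`. -/
def createPlus {n : ℕ} (Γ : ChordDiagram n) : ChordDiagram (n + 1) where
  partner p :=
    if h : p.val < 2 then ⟨1 - p.val, by omega⟩
    else ⟨(Γ.partner ⟨p.val - 2, by omega⟩).val + 2, by omega⟩
  partner_partner p := by
    by_cases h : p.val < 2
    · ext; simp [h]; omega
    · ext
      simp [h, Γ.partner_partner]
      omega
  partner_ne p := by
    intro hp
    have hv := congrArg Fin.val hp
    by_cases h : p.val < 2
    · simp [h] at hv; omega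
    · simp [h] at hv
      exact Γ.partner_ne ⟨p.val - 2, by omega⟩ (Fin.ext (by simp; omega))
  noncrossing p q h1 h2 := by
    by_cases hp : p.val < 2
    · simp only [hp, Fin.lt_def, dite_true] at h1 h2; omega
    · have hq : ¬ q.val < 2 := by rw [Fin.lt_def] at h1; omega
      simp only [hp, hq, Fin.lt_def, dite_false] at h1 h2 ⊢
      have := Γ.noncrossing ⟨p.val - 2, by omega⟩ ⟨q.val - 2, by omega⟩
        (by simp only [Fin.lt_def]; omega) (by simp only [Fin.lt_def]; omega)
      simp only [Fin.lt_def] at this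
      omega

/-- Relabelling of the old marked points under `createMinus`: the old base point `0` becomes
`2 * n`, the other points keep their labels. -/
def minusNew {n : ℕ} (q : Fin (2 * n)) : Fin (2 * (n + 1)) :=
  ⟨if q.val = 0 then 2 * n else q.val, by split_ifs <;> omega⟩

/-- The inverse of `minusNew`, defined on the points other than `0` and `2 * n + 1`. -/
def minusOld {n : ℕ} (p : Fin (2 * (n + 1))) (h : ¬ (p.val = 0 ∨ p.val = 2 * n + 1)) :
    Fin (2 * n) :=
  ⟨if p.val = 2 * n then 0 else p.val, by split_ifs <;> omega⟩

theorem minusNew_ne {n : ℕ} (q : Fin (2 * n)) :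
    ¬ ((minusNew q).val = 0 ∨ (minusNew q).val = 2 * n + 1) := by
  have := q.isLt
  simp only [minusNew]
  split_ifs <;> omega

theorem minusOld_minusNew {n : ℕ} (q : Fin (2 * n)) :
    minusOld (minusNew q) (minusNew_ne q) = q := by
  have := q.isLt
  ext
  simp only [minusNew, minusOld]
  split_ifs <;> omega

theorem minusNew_minusOld {n : ℕ} (p : Fin (2 * (n + 1)))
    (h : ¬ (p.val = 0 ∨ p.val = 2 * n + 1)) : minusNew (minusOld p h) = p := by
  ext
  simp only [minusNew, minusOld]
  split_ifs <;> omega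

/-- The creation map `B₋`: add an outermost chord joining the base point `0` to the next marked
point anticlockwise, `2 * n + 1`. The old base point becomes the next point anticlockwise, `2 * n`,
and the other old marked points, following it clockwise, keep their labels `1, …, 2 * n - 1`. -/
def createMinus {n : ℕ} (Γ : ChordDiagram n) : ChordDiagram (n + 1) where
  partner p :=
    if h : p.val = 0 ∨ p.val = 2 * n + 1 then p.rev
    else minusNew (Γ.partner (minusOld p h))
  partner_partner p := by
    by_cases h : p.val = 0 ∨ p.val = 2 * n + 1
    · have h' : p.rev.val = 0 ∨ p.rev.val = 2 * n + 1 := by rw [Fin.val_rev]; omega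
      rw [dif_pos h, dif_pos h', Fin.rev_rev]
    · rw [dif_neg h, dif_neg (minusNew_ne _), minusOld_minusNew, Γ.partner_partner,
        minusNew_minusOld]
  partner_ne p := by
    by_cases h : p.val = 0 ∨ p.val = 2 * n + 1
    · rw [dif_pos h]
      intro hp
      have hv := congrArg Fin.val hp
      rw [Fin.val_rev] at hv
      omega
    · rw [dif_neg h]
      intro hp
      apply Γ.partner_ne (minusOld p h)
      rw [← minusOld_minusNew (Γ.partner (minusOld p h))]
      congr
  noncrossing p q h1 h2 := by
    by_cases hp : p.val = 0 ∨ p.val = 2 * n + 1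
    · rw [dif_pos hp] at h2 ⊢
      by_cases hq : q.val = 0 ∨ q.val = 2 * n + 1
      · rw [Fin.lt_def] at h1 h2; rw [Fin.val_rev] at h2; omega
      · rw [dif_neg hq]
        have := minusNew_ne (Γ.partner (minusOld q hq))
        have := (minusNew (Γ.partner (minusOld q hq))).isLt
        rw [Fin.lt_def] at h1 h2 ⊢; rw [Fin.val_rev] at h2 ⊢; omega
    · rw [dif_neg hp] at h2 ⊢
      by_cases hq : q.val = 0 ∨ q.val = 2 * n + 1
      · have := minusNew_ne (Γ.partner (minusOld p hp))
        have := (minusNew (Γ.partner (minusOld p hp))).isLt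
        rw [Fin.lt_def] at h1 h2; omega
      · rw [dif_neg hq]
        obtain ⟨a, rfl⟩ : ∃ a, p = minusNew a := ⟨_, (minusNew_minusOld p hp).symm⟩
        obtain ⟨b, rfl⟩ : ∃ b, q = minusNew b := ⟨_, (minusNew_minusOld q hq).symm⟩
        have p1 : minusOld (minusNew a) hp = a := minusOld_minusNew a
        have p2 : minusOld (minusNew b) hq = b := minusOld_minusNew b
        rw [p1] at h2 ⊢
        rw [p2]
        have e1 := Γ.noncrossing a b
        have e2 := Γ.noncrossing (Γ.partner b) a
        have e3 := Γ.partner_ne a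
        have e4 : Γ.partner a = Γ.partner b → a = b := fun h => by
          rw [← Γ.partner_partner a, ← Γ.partner_partner b, h]
        have l1 := a.isLt
        have l2 := b.isLt
        have l3 := (Γ.partner a).isLt
        have l4 := (Γ.partner b).isLt
        rw [Γ.partner_partner] at e2
        simp only [Fin.lt_def, Fin.ext_iff, minusNew, ne_eq] at h1 h2 e1 e2 e3 e4 ⊢
        clear p1 p2 hp hq
        split_ifs at h1 h2 ⊢ <;> omega

end ChordDiagram

/-! ### Words and basis chord diagrams -/

/-- The symbols `-` and `+`. -/
inductive Sgn
  | minus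
  | plus
  deriving DecidableEq

/-- Words of length `n` on the symbols `-` and `+`. -/
abbrev Word (n : ℕ) : Type := Fin n → Sgn

/-- The set of positions of the `-` signs in a word. -/
def Word.minusSet {n : ℕ} (w : Word n) : Finset (Fin n) :=
  Finset.univ.filter fun i => w i = Sgn.minus

/-- The partial order `⪯`: the two words have the same number of `-` signs (and the same length,
so they lie in the same `W(n₋, n₊)`), and for every `i` the `i`-th `-` sign of `w₁` occurs to the
left of, or in the same position as, the `i`-th `-` sign of `w₂`. -/
def Word.Prec {n : ℕ} (w₁ w₂ : Word n) : Prop :=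
  ∃ h : w₂.minusSet.card = w₁.minusSet.card, ∀ i : Fin w₁.minusSet.card,
    w₁.minusSet.orderEmbOfFin rfl i ≤ w₂.minusSet.orderEmbOfFin h i

/-- The creation map `B₋` or `B₊` of a symbol. -/
def ChordDiagram.create {n : ℕ} : Sgn → ChordDiagram n → ChordDiagram (n + 1)
  | Sgn.minus, Γ => Γ.createMinus
  | Sgn.plus, Γ => Γ.createPlus

/-- The basis chord diagram `Γ_w`, obtained from the one-chord diagram by applying the string of
creation maps `B_{w 0} B_{w 1} ⋯ B_{w (n - 1)}`. -/
def basisDiagram : {n : ℕ} → Word n → ChordDiagram (n + 1)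
  | 0, _ => ChordDiagram.vacuum
  | _ + 1, w => ChordDiagram.create (w 0) (basisDiagram (Fin.tail w))

/-! ### Bypass systems -/

/-- Two boundary arcs of the disc lie in the same region of `Γ`; the arc running clockwise from
`p - 1` to `p` is labelled by `p`. They do iff no chord `{a, partner a}` separates them. -/
def ChordDiagram.SameRegion {n : ℕ} (Γ : ChordDiagram n) (p q : Fin (2 * n)) : Prop :=
  ∀ a, a < Γ.partner a →
    ((a < p ∧ p ≤ Γ.partner a) ↔ (a < q ∧ q ≤ Γ.partner a))

/-- A bypass system on `Γ` (up to isotopy): a family, indexed by `ι`, of pairwise disjoint arcs of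
attachment, each an embedded arc meeting the chords in exactly three points, its two endpoints and
one interior point, where it crosses the chord.

A small disc neighbourhood `U k` of the `k`-th arc meets the chords in three parallel strands. Draw
the arc horizontally and the strands vertically; the six ends of strands on the boundary of `U k`
are numbered clockwise by `Fin 6`, so that the strands have ends `{5, 0}`, `{4, 1}`, `{3, 2}` from
left to right, and `j.rev = 5 - j` is the other end of the strand of `j`:
```
     0   1   2
     |   |   |
     o---+---o
     |   |   |
     5   4   3
```
Each end `j` of `U k` is reached from a marked point `side k j`, following its chord until that
chord enters `U k` at this end; `pos k j` records how far from `side k j` the crossing lies, in a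
parametrisation of the chord by `ℚ`, the opposite direction having the opposite parametrisation.
Only the order of the positions along a chord matters.

The side of the chord on the right of an observer walking from `p` to `Γ.partner p` faces the
region that contains the boundary arc from `p - 1` to `p`. So the left half of the arc joins, in one
region, the right side of the chord through `5` (seen from `side k 5`) with that of the chord
through `1` (seen from `side k 1`); the right half likewise joins `4` and `2`. The boundary of a
region, traversed clockwise, meets its chord sides `(p, t)`, with `p` a marked point and `t` a
position on the chord at `p` seen from `p`, in the lexicographic order, up to a cyclic
permutation. -/
structure BypassSystem {n : ℕ} (Γ : ChordDiagram n) (ι : Type) where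
  /-- The marked point from which an end is reached. -/
  side : ι → Fin 6 → Fin (2 * n)
  /-- The position of the crossing on the chord, seen from `side`. -/
  pos : ι → Fin 6 → ℚ
  /-- The two ends of a strand are reached from the two endpoints of the same chord. -/
  side_rev : ∀ k j, side k j.rev = Γ.partner (side k j)
  /-- The two ends of a strand belong to the same point of the chord. -/
  pos_rev : ∀ k j, pos k j.rev = - pos k j
  /-- All the intersection points of the arcs with the chords are distinct. -/
  injective : ∀ k j k' j', side k j = side k' j' → pos k j = pos k' j' → k = k' ∧ j = j'
  /-- The left half of each arc lies in one region. -/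
  left_region : ∀ k, Γ.SameRegion (side k 5) (side k 1)
  /-- The right half of each arc lies in one region. -/
  right_region : ∀ k, Γ.SameRegion (side k 4) (side k 2)
  /-- No two halves of arcs cross: the endpoints of one do not separate those of the other.
  `(j, j')` and `(l, l')` range over the pairs of ends joined by the halves. -/
  disjoint : ∀ k k', ∀ h ∈ ({(5, 1), (4, 2)} : Set (Fin 6 × Fin 6)),
    ∀ h' ∈ ({(5, 1), (4, 2)} : Set (Fin 6 × Fin 6)),
      (toLex (side k' h'.1, pos k' h'.1) ∈
          Set.uIoo (toLex (side k h.1, pos k h.1)) (toLex (side k h.2, pos k h.2)) ↔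
        toLex (side k' h'.2, pos k' h'.2) ∈
          Set.uIoo (toLex (side k h.1, pos k h.1)) (toLex (side k h.2, pos k h.2)))

/-- The two directions of bypass surgery. -/
inductive Direction
  | up
  | down

/-- The chords inside the disc glued in by a bypass surgery, as a matching of the six ends: the
three original strands `{0, 5}, {1, 4}, {2, 3}` are rotated by `60°`, clockwise for upwards surgery,
to `{0, 1}, {2, 5}, {3, 4}`, and anticlockwise for downwards surgery, to
`{1, 2}, {0, 3}, {4, 5}`. -/
def Direction.glue : Direction → Fin 6 → Fin 6
  | Direction.up => ![1, 0, 5, 4, 3, 2]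
  | Direction.down => ![3, 2, 1, 0, 5, 4]

namespace BypassSystem

variable {n : ℕ} {Γ : ChordDiagram n} {ι : Type}

/-- The pieces of the curves obtained by surgery, in direction `d`, along all the arcs of a bypass
system: the pieces of the chords outside the neighbourhoods `U k`, and the new chords inside. They
join marked points `Sum.inl p` and ends `Sum.inr (k, j)`. -/
inductive Link (F : BypassSystem Γ ι) (d : Direction) :
    Fin (2 * n) ⊕ ι × Fin 6 → Fin (2 * n) ⊕ ι × Fin 6 → Prop
  /-- A chord that no arc meets. -/
  | chord (p : Fin (2 * n)) (h : ∀ k j, F.side k j ≠ p) :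
      Link F d (Sum.inl p) (Sum.inl (Γ.partner p))
  /-- The piece of a chord from its endpoint to the first crossing. -/
  | first (k : ι) (j : Fin 6)
      (h : ∀ k' j', F.side k' j' = F.side k j → F.pos k j ≤ F.pos k' j') :
      Link F d (Sum.inl (F.side k j)) (Sum.inr (k, j))
  /-- The piece of a chord between two consecutive crossings. -/
  | between (k : ι) (j : Fin 6) (k' : ι) (j' : Fin 6) (hside : F.side k j = F.side k' j')
      (hlt : F.pos k j < F.pos k' j')
      (h : ∀ l i, F.side l i = F.side k j → ¬ (F.pos k j < F.pos l i ∧ F.pos l i < F.pos k' j')) :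
      Link F d (Sum.inr (k, j.rev)) (Sum.inr (k', j'))
  /-- A new chord inside a neighbourhood. -/
  | glue (k : ι) (j : Fin 6) : Link F d (Sum.inr (k, j)) (Sum.inr (k, d.glue j))

/-- Surgery in direction `d` along all the arcs of `F` gives the chord diagram `Γ'`: the resulting
curves connect the marked points as the chords of `Γ'` do, and there is no closed loop, that is,
each component contains a marked point. -/
def Gives (F : BypassSystem Γ ι) (d : Direction) (Γ' : ChordDiagram n) : Prop :=
  (∀ p, Relation.EqvGen (F.Link d) (Sum.inl p) (Sum.inl (Γ'.partner p))) ∧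
    ∀ k j, ∃ p, Relation.EqvGen (F.Link d) (Sum.inr (k, j)) (Sum.inl p)

end BypassSystem

/-! ### Combinatorial `SFH` and basis decompositions -/

/-- `Γ, Γ', Γ''` form a bypass triple: `Γ' = Up_c Γ` and `Γ'' = Down_c Γ` for a single arc of
attachment `c` on `Γ`. -/
def BypassTriple {n : ℕ} (Γ Γ' Γ'' : ChordDiagram n) : Prop :=
  ∃ c : BypassSystem Γ Unit, c.Gives Direction.up Γ' ∧ c.Gives Direction.down Γ''

/-- The subspace of bypass relations. An arc one of whose surgeries creates a closed loop gives no
further relation: a diagram with a closed loop is zero, and the surgery in the other direction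
does not change the diagram. -/
noncomputable def bypassRelations (n : ℕ) : Submodule (ZMod 2) (ChordDiagram n →₀ ZMod 2) :=
  Submodule.span (ZMod 2)
    {x | ∃ Γ Γ' Γ'' : ChordDiagram n, BypassTriple Γ Γ' Γ'' ∧
      x = Finsupp.single Γ 1 + Finsupp.single Γ' 1 + Finsupp.single Γ'' 1}

/-- `SFH_comb(T, n)`: the `ℤ/2`-vector space generated by the chord diagrams with `n` chords subject
to the bypass relation. -/
abbrev SFHcomb (n : ℕ) : Type := (ChordDiagram n →₀ ZMod 2) ⧸ bypassRelations n

/-- The class of a chord diagram in `SFH_comb`. -/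
noncomputable def ChordDiagram.toSFH {n : ℕ} (Γ : ChordDiagram n) : SFHcomb n :=
  Submodule.Quotient.mk (Finsupp.single Γ 1)

/-- `S` is a basis decomposition of `Γ`: in `SFH_comb(T, n + 1)`, the chord diagram `Γ` is the sum
of the basis elements `v_w`, `w ∈ S`. -/
def IsBasisDecomposition {n : ℕ} (Γ : ChordDiagram (n + 1)) (S : Finset (Word n)) : Prop :=
  Γ.toSFH = ∑ w ∈ S, (basisDiagram w).toSFH

/-- `Γ` has a unique basis decomposition, in which `Γ_{w₁}` and `Γ_{w₂}` occur as the total minimum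
and the total maximum with respect to `⪯`. -/
def HasMinMax {n : ℕ} (Γ : ChordDiagram (n + 1)) (w₁ w₂ : Word n) : Prop :=
  ∃ S : Finset (Word n), IsBasisDecomposition Γ S ∧ (∀ S', IsBasisDecomposition Γ S' → S' = S) ∧
    w₁ ∈ S ∧ w₂ ∈ S ∧ ∀ w ∈ S, w₁.Prec w ∧ w.Prec w₂

/-! A word is encoded by its heights, the numbers of `-` signs in front of its `+` signs. In these
terms `⪯` is the reversed pointwise order `Word.Dom`. By `related_of_dom`, every comparable pair is
built from the pair of empty words by two kinds of steps. Either the same sign is inserted in both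
words, at the front or behind a sign of the same kind; or only the larger word changes, one of its
`+` signs jumping left to the preceding `+` sign (or to the front), or its first `-` sign jumping
right to the second one.

On basis diagrams, inserting a sign inserts an outermost chord, at a place that does not depend on
the rest of the word, and removing a sign joins the chords at two adjacent marked points. A move
removes a sign and inserts it again; it is surgery along an arc close to the boundary that crosses
the chords at three consecutive marked points (`CollarFrames`). An insertion carries a bypass system
along. A move `f` adds one boundary arc to it: surgery in one direction now gives `Γ_b` in place of
`Γ_{b'}`, where `b = f b'`, and by the bypass relation surgery in the other direction gives `D` with
`D = D' + f(D')`, where `D'` is the previous result and `f` is extended linearly. The moves are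
chosen so that the minimum `a` of `D'` is not of the form `f u`, while `b` comes only from `b'`. So
neither `a` nor `b` cancels in `D`, and since `f` is increasing and monotone, all words of `D` lie
between `a` and `b`. The same facts show that the new arc meets three different chords of `D'`, so
that no loop arises (`CollarFrames.exists_surgeryTo`).

Computations in `SFHcomb` use a pairing. For a matching `h` of marked points of opposite parity,
crossing or not, `connVal h Γ` is `1` exactly when the union of `Γ` and `h` is connected. By
`three_term` this respects the bypass relations; `exists_dual` constructs matchings dual to the
basis diagrams, and `toSFH_mem_span` proves spanning. Hence the basis decomposition of `Γ` is the
set of words whose dual matching has a connected union with `Γ`. Insertion and capping off are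
adjoint for the pairing (`conn_cap`), so both act linearly on decompositions.

Reflecting the disc exchanges the two signs and the two directions of surgery, so `BBS` is obtained
from the same induction, applied to the words with exchanged signs (`Direction.view`). -/

/-! ### Words -/

namespace Word

/-- Prepend a symbol to a word. -/
abbrev cons {n : ℕ} (s : Sgn) (u : Word n) : Word (n + 1) := Fin.cons s u

theorem cons_head_tail {n : ℕ} (w : Word (n + 1)) : cons (w 0) (Fin.tail w) = w :=
  Fin.cons_self_tail w

/-- Induction on words, one symbol at a time. -/
theorem consInduction {motive : ∀ {n : ℕ}, Word n → Prop}
    (nil : ∀ w : Word 0, motive w)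
    (plus : ∀ {n : ℕ} (u : Word n), motive u → motive (cons Sgn.plus u))
    (minus : ∀ {n : ℕ} (u : Word n), motive u → motive (cons Sgn.minus u)) :
    ∀ {n : ℕ} (w : Word n), motive w := by
  intro n
  induction n with
  | zero => exact nil
  | succ n ih =>
    intro w
    rw [← cons_head_tail w]
    cases w 0
    · exact minus _ (ih _)
    · exact plus _ (ih _)

/-- The number of `-` signs that precede the `j`-th `+` sign (counted from `0`); the total number
of `-` signs if there is no such `+` sign. -/
def height : {n : ℕ} → Word n → ℕ → ℕ
  | 0, _, _ => 0
  | _ + 1, w, j => match w 0, j with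
    | Sgn.plus, 0 => 0
    | Sgn.plus, j + 1 => height (Fin.tail w) j
    | Sgn.minus, j => height (Fin.tail w) j + 1

/-- The number of `-` signs. -/
def numMinus : {n : ℕ} → Word n → ℕ
  | 0, _ => 0
  | _ + 1, w => match w 0 with
    | Sgn.plus => numMinus (Fin.tail w)
    | Sgn.minus => numMinus (Fin.tail w) + 1

/-- The number of `+` signs. -/
def numPlus : {n : ℕ} → Word n → ℕ
  | 0, _ => 0
  | _ + 1, w => match w 0 with
    | Sgn.plus => numPlus (Fin.tail w) + 1
    | Sgn.minus => numPlus (Fin.tail w)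

/-- The number of `-` signs among the first `k` symbols. -/
def minusCount : {n : ℕ} → Word n → ℕ → ℕ
  | 0, _, _ => 0
  | _ + 1, _, 0 => 0
  | _ + 1, w, k + 1 => match w 0 with
    | Sgn.plus => minusCount (Fin.tail w) k
    | Sgn.minus => minusCount (Fin.tail w) k + 1

/-- Insert a `+` sign right after the `j`-th one (counted from `1`), at the front if `j = 0`. -/
def insertPlus : {n : ℕ} → ℕ → Word n → Word (n + 1)
  | _, 0, w => cons Sgn.plus w
  | 0, _ + 1, w => cons Sgn.plus w
  | _ + 1, j + 1, w => match w 0 with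
    | Sgn.plus => cons Sgn.plus (insertPlus j (Fin.tail w))
    | Sgn.minus => cons Sgn.minus (insertPlus (j + 1) (Fin.tail w))

/-- Remove the `j`-th `+` sign (counted from `0`). -/
def removePlus : {n : ℕ} → ℕ → Word (n + 1) → Word n
  | 0, _, w => Fin.tail w
  | _ + 1, j, w => match w 0, j with
    | Sgn.plus, 0 => Fin.tail w
    | Sgn.plus, j + 1 => cons Sgn.plus (removePlus j (Fin.tail w))
    | Sgn.minus, j => cons Sgn.minus (removePlus j (Fin.tail w))

/-- The opposite symbol. -/
def _root_.Sgn.swap : Sgn → Sgn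
  | Sgn.minus => Sgn.plus
  | Sgn.plus => Sgn.minus

/-- Exchange `-` and `+`. -/
def swap {n : ℕ} (w : Word n) : Word n := fun i => (w i).swap

/-- Insert a `-` sign right after the `j`-th one (counted from `1`), at the front if `j = 0`. -/
def insertMinus {n : ℕ} (j : ℕ) (w : Word n) : Word (n + 1) := (w.swap.insertPlus j).swap

/-- Remove the `j`-th `-` sign (counted from `0`). -/
def removeMinus {n : ℕ} (j : ℕ) (w : Word (n + 1)) : Word n := (w.swap.removePlus j).swap

section simps

variable {n : ℕ} (u : Word n) (w : Word (n + 1)) (s : Sgn) (j : ℕ)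

@[simp] theorem tail_cons : Fin.tail (cons s u) = u := rfl

@[simp] theorem height_nil (w : Word 0) : w.height j = 0 := rfl
@[simp] theorem height_plus_zero : (cons Sgn.plus u).height 0 = 0 := by simp [height]
@[simp] theorem height_plus_succ : (cons Sgn.plus u).height (j + 1) = u.height j := by
  simp [height]
@[simp] theorem height_minus : (cons Sgn.minus u).height j = u.height j + 1 := by simp [height]

@[simp] theorem numMinus_nil (w : Word 0) : w.numMinus = 0 := rfl
@[simp] theorem numMinus_plus : (cons Sgn.plus u).numMinus = u.numMinus := by simp [numMinus]
@[simp] theorem numMinus_minus : (cons Sgn.minus u).numMinus = u.numMinus + 1 := by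
  simp [numMinus]
@[simp] theorem numPlus_nil (w : Word 0) : w.numPlus = 0 := rfl
@[simp] theorem numPlus_plus : (cons Sgn.plus u).numPlus = u.numPlus + 1 := by simp [numPlus]
@[simp] theorem numPlus_minus : (cons Sgn.minus u).numPlus = u.numPlus := by
  simp [numPlus]

@[simp] theorem minusCount_zero : u.minusCount 0 = 0 := by cases n <;> rfl
@[simp] theorem minusCount_nil (w : Word 0) : w.minusCount j = 0 := rfl
@[simp] theorem minusCount_plus : (cons Sgn.plus u).minusCount (j + 1) = u.minusCount j := by
  simp [minusCount]
@[simp] theorem minusCount_minus :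
    (cons Sgn.minus u).minusCount (j + 1) = u.minusCount j + 1 := by
  simp [minusCount]

@[simp] theorem insertPlus_zero : u.insertPlus 0 = cons Sgn.plus u := by
  cases n <;> simp [insertPlus]
@[simp] theorem insertPlus_nil (w : Word 0) : w.insertPlus j = cons Sgn.plus w := by
  cases j <;> simp [insertPlus]
@[simp] theorem insertPlus_plus :
    (cons Sgn.plus u).insertPlus (j + 1) = cons Sgn.plus (u.insertPlus j) := by
  simp [insertPlus]
@[simp] theorem insertPlus_minus :
    (cons Sgn.minus u).insertPlus (j + 1) = cons Sgn.minus (u.insertPlus (j + 1)) := by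
  simp [insertPlus]

@[simp] theorem removePlus_plus_zero : (cons Sgn.plus u).removePlus 0 = u := by
  cases n <;> simp [removePlus]
@[simp] theorem removePlus_plus_succ :
    (cons Sgn.plus w).removePlus (j + 1) = cons Sgn.plus (w.removePlus j) := by
  simp [removePlus]
@[simp] theorem removePlus_minus :
    (cons Sgn.minus w).removePlus j = cons Sgn.minus (w.removePlus j) := by
  simp [removePlus]

@[simp] theorem swap_swap : u.swap.swap = u := by
  funext i
  simp only [swap]
  cases u i <;> rfl

theorem swap_cons : (cons s u).swap = cons s.swap u.swap := by
  funext i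
  refine Fin.cases ?_ (fun i => ?_) i <;> simp [swap]

@[simp] theorem swap_plus : (cons Sgn.plus u).swap = cons Sgn.minus u.swap := swap_cons ..
@[simp] theorem swap_minus : (cons Sgn.minus u).swap = cons Sgn.plus u.swap := swap_cons ..

@[simp] theorem numPlus_swap : u.swap.numPlus = u.numMinus := by
  induction u using consInduction <;> simp [*]
@[simp] theorem numMinus_swap : u.swap.numMinus = u.numPlus := by
  induction u using consInduction <;> simp [*]

@[simp] theorem insertMinus_zero : u.insertMinus 0 = cons Sgn.minus u := by simp [insertMinus]
@[simp] theorem insertMinus_minus :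
    (cons Sgn.minus u).insertMinus (j + 1) = cons Sgn.minus (u.insertMinus j) := by
  simp [insertMinus]
@[simp] theorem insertMinus_plus :
    (cons Sgn.plus u).insertMinus (j + 1) = cons Sgn.plus (u.insertMinus (j + 1)) := by
  simp [insertMinus]
@[simp] theorem removeMinus_minus_zero : (cons Sgn.minus u).removeMinus 0 = u := by
  simp [removeMinus]
@[simp] theorem removeMinus_minus_succ :
    (cons Sgn.minus w).removeMinus (j + 1) = cons Sgn.minus (w.removeMinus j) := by
  simp [removeMinus]
@[simp] theorem removeMinus_plus :
    (cons Sgn.plus w).removeMinus j = cons Sgn.plus (w.removeMinus j) := by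
  simp [removeMinus]

end simps

theorem numMinus_add_numPlus {n : ℕ} (w : Word n) : w.numMinus + w.numPlus = n := by
  induction w using consInduction with
  | nil w => rfl
  | plus u ih => simp; omega
  | minus u ih => simp; omega

theorem height_le_numMinus {n : ℕ} (w : Word n) (j : ℕ) : w.height j ≤ w.numMinus := by
  induction w using consInduction generalizing j with
  | nil w => simp
  | plus u ih => cases j <;> simp [ih]
  | minus u ih => simp [ih]

theorem height_of_numPlus_le {n : ℕ} (w : Word n) (j : ℕ) (h : w.numPlus ≤ j) :
    w.height j = w.numMinus := by
  induction w using consInduction generalizing j with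
  | nil w => simp
  | plus u ih =>
    cases j with
    | zero => simp at h
    | succ j => simp at h ⊢; exact ih j h
  | minus u ih => simp at h ⊢; exact ih j h

theorem height_mono {n : ℕ} (w : Word n) : Monotone w.height := by
  refine monotone_nat_of_le_succ fun j => ?_
  induction w using consInduction generalizing j with
  | nil w => simp
  | plus u ih => cases j <;> simp [ih]
  | minus u ih => simp [ih]

theorem ext_height {n : ℕ} {w w' : Word n} (h : ∀ j, w.height j = w'.height j) : w = w' := by
  induction n with
  | zero => exact Subsingleton.elim _ _
  | succ n ih =>
    rw [← cons_head_tail w, ← cons_head_tail w'] at h ⊢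
    cases hs : w 0 <;> cases hs' : w' 0 <;> rw [hs, hs'] at h
    · rw [ih (w := Fin.tail w) (w' := Fin.tail w') fun j => by simpa using h j]
    · simpa using h 0
    · simpa using h 0
    · rw [ih (w := Fin.tail w) (w' := Fin.tail w') fun j => by simpa using h (j + 1)]

/-- The new sign gets index `j + 1` and stands right behind the sign of index `j`, so it has the
same height; this is why `i = j + 1` already belongs to the shifted case. -/
theorem height_insertPlus_succ {n : ℕ} (w : Word n) (j i : ℕ) :
    (w.insertPlus (j + 1)).height i = if i ≤ j then w.height i else w.height (i - 1) := by
  induction w using consInduction generalizing j i with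
  | nil w => cases i <;> simp
  | plus u ih =>
    rw [insertPlus_plus]
    cases i with
    | zero => simp
    | succ i =>
      rw [height_plus_succ]
      cases j with
      | zero => cases i <;> simp
      | succ j =>
        rw [ih]
        cases i <;> simp
  | minus u ih =>
    simp only [insertPlus_minus, height_minus, ih]
    split_ifs <;> rfl

theorem height_removePlus {n : ℕ} (w : Word (n + 1)) (j i : ℕ) (hj : j < w.numPlus) :
    (w.removePlus j).height i = if i < j then w.height i else w.height (i + 1) := by
  induction n generalizing j i with
  | zero =>
    rw [← cons_head_tail w] at hj ⊢
    cases hs : w 0 <;> rw [hs] at hj <;> simp at hj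
    subst hj
    simp
  | succ n ih =>
    rw [← cons_head_tail w] at hj ⊢
    cases hs : w 0 <;> rw [hs] at hj <;> simp at hj
    · simp only [removePlus_minus, height_minus, ih _ _ _ hj]
      split_ifs <;> rfl
    · cases j with
      | zero => simp
      | succ j =>
        cases i with
        | zero => simp
        | succ i =>
          rw [removePlus_plus_succ, height_plus_succ, ih _ _ _ (by omega)]
          simp

theorem numMinus_insertPlus {n : ℕ} (w : Word n) (j : ℕ) :
    (w.insertPlus j).numMinus = w.numMinus := by
  induction w using consInduction generalizing j with
  | nil w => simp
  | plus u ih => cases j <;> simp [ih]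
  | minus u ih => cases j <;> simp [ih]

theorem numPlus_insertPlus {n : ℕ} (w : Word n) (j : ℕ) :
    (w.insertPlus j).numPlus = w.numPlus + 1 := by
  have := numMinus_insertPlus w j
  have := numMinus_add_numPlus w
  have := numMinus_add_numPlus (w.insertPlus j)
  omega

/-- The number of `-` signs is the height at any index beyond the last `+` sign, so it can be read
off from the formula for heights at a large index. -/
theorem numMinus_removePlus {n : ℕ} (w : Word (n + 1)) (j : ℕ) (hj : j < w.numPlus) :
    (w.removePlus j).numMinus = w.numMinus := by
  have h := height_removePlus w j (w.numPlus + j) hj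
  have := numMinus_add_numPlus w
  have h1 := numMinus_add_numPlus (w.removePlus j)
  have h2 := height_of_numPlus_le w (w.numPlus + j + 1) (by omega)
  have h3 := height_removePlus w j (n + w.numPlus + j) hj
  rw [if_neg (by omega), height_of_numPlus_le w _ (by omega),
    height_of_numPlus_le _ _ (by omega)] at h3
  exact h3

theorem numPlus_removePlus {n : ℕ} (w : Word (n + 1)) (j : ℕ) (hj : j < w.numPlus) :
    (w.removePlus j).numPlus + 1 = w.numPlus := by
  have := numMinus_removePlus w j hj
  have := numMinus_add_numPlus w
  have := numMinus_add_numPlus (w.removePlus j)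
  omega

theorem numMinus_insertMinus {n : ℕ} (w : Word n) (j : ℕ) :
    (w.insertMinus j).numMinus = w.numMinus + 1 := by
  simp [insertMinus, numPlus_insertPlus]

theorem numMinus_removeMinus {n : ℕ} (w : Word (n + 1)) (j : ℕ) (hj : j < w.numMinus) :
    (w.removeMinus j).numMinus + 1 = w.numMinus := by
  have := numPlus_removePlus w.swap j (by simpa using hj)
  simpa [removeMinus] using this

/-- The `+` signs of height `0` are those in front of the first `-` sign; all later ones get one
more `-` sign in front of them. -/
theorem height_insertMinus_one {n : ℕ} (w : Word n) (hw : 0 < w.numMinus) (i : ℕ) :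
    (w.insertMinus 1).height i = if w.height i = 0 then 0 else w.height i + 1 := by
  induction w using consInduction generalizing i with
  | nil w => simp at hw
  | plus u ih => cases i <;> simp at hw ⊢; exact ih hw _
  | minus u ih => simp

theorem height_removeMinus_zero {n : ℕ} (w : Word (n + 1)) (hw : 0 < w.numMinus) (i : ℕ) :
    (w.removeMinus 0).height i = w.height i - 1 := by
  induction n generalizing i with
  | zero =>
    rw [← cons_head_tail w] at hw ⊢
    cases hs : w 0 <;> rw [hs] at hw <;> simp at hw ⊢
  | succ n ih =>
    rw [← cons_head_tail w] at hw ⊢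
    cases hs : w 0 <;> rw [hs] at hw <;> simp at hw ⊢
    cases i with
    | zero => simp
    | succ i => simp [ih _ hw]

/-! ### The partial order -/

/-- The partial order on words in terms of the function `height`. -/
def Dom {n : ℕ} (w₁ w₂ : Word n) : Prop :=
  w₁.numMinus = w₂.numMinus ∧ ∀ j, w₂.height j ≤ w₁.height j

/-- At most `m` of the first `j + m + 1` symbols are `-` precisely when at least `j + 1` of them are
`+` (in a word that is long enough), that is, when the `+` sign of index `j` is among them. -/
theorem height_le_iff {n : ℕ} (w : Word n) (j m : ℕ) :
    w.height j ≤ m ↔ w.minusCount (j + m + 1) ≤ m := by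
  induction w using consInduction generalizing j m with
  | nil w => simp
  | plus u ih =>
    cases j with
    | zero =>
      simp only [height_plus_zero, zero_le, zero_add, minusCount_plus, true_iff]
      clear ih
      induction u using consInduction generalizing m with
      | nil w => simp
      | plus u ih => cases m with
        | zero => simp
        | succ m => simp; exact (ih m).trans (Nat.le_succ _)
      | minus u ih => cases m with
        | zero => simp
        | succ m => simp [ih m]
    | succ j =>
      rw [height_plus_succ, minusCount_plus, ih, show j + 1 + m = j + m + 1 by omega]
  | minus u ih =>
    rw [height_minus, minusCount_minus]
    cases m with
    | zero => simp
    | succ m => rw [Nat.succ_le_succ_iff, Nat.succ_le_succ_iff, ih]; rfl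

theorem minusCount_le {n : ℕ} (w : Word n) (k : ℕ) : w.minusCount k ≤ k := by
  induction w using consInduction generalizing k with
  | nil w => simp
  | plus u ih => cases k <;> simp; exact (ih _).trans (Nat.le_succ _)
  | minus u ih => cases k <;> simp [ih]

theorem minusCount_of_le {n : ℕ} (w : Word n) (k : ℕ) (h : n ≤ k) :
    w.minusCount k = w.numMinus := by
  induction w using consInduction generalizing k with
  | nil w => simp
  | plus u ih => cases k <;> simp at h ⊢; exact ih _ h
  | minus u ih => cases k <;> simp at h ⊢; exact ih _ h

/-- Counts of `-` signs in prefixes link heights, which suit the moves, with the positions of `-`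
signs that define `Prec`. -/
theorem height_le_height_iff {n : ℕ} (w₁ w₂ : Word n) :
    (∀ j, w₂.height j ≤ w₁.height j) ↔ ∀ k, w₂.minusCount k ≤ w₁.minusCount k := by
  constructor
  · intro h k
    -- If the prefix of `w₁` consists of `-` signs only, the bound is trivial; otherwise `k` has the
    -- form required by `height_le_iff`.
    by_cases hk : w₁.minusCount k = k
    · rw [hk]; exact minusCount_le _ _
    · have h1 := minusCount_le w₁ k
      obtain ⟨j, hj⟩ : ∃ j, k = j + w₁.minusCount k + 1 := ⟨k - w₁.minusCount k - 1, by omega⟩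
      have h2 : w₁.height j ≤ w₁.minusCount k := by rw [height_le_iff, ← hj]
      have h3 := (height_le_iff _ _ _).1 ((h j).trans h2)
      rwa [← hj] at h3
  · intro h j
    rw [height_le_iff]
    exact (h _).trans ((height_le_iff _ _ _).1 le_rfl)

theorem minusCount_swap {n : ℕ} (w : Word n) (k : ℕ) (hk : k ≤ n) :
    w.swap.minusCount k + w.minusCount k = k := by
  induction w using consInduction generalizing k with
  | nil w => simp; omega
  | plus u ih => cases k with
    | zero => simp
    | succ k => have := ih k (by omega); simp; omega
  | minus u ih => cases k with
    | zero => simp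
    | succ k => have := ih k (by omega); simp; omega

/-- Exchanging signs replaces each prefix count by its complement in the length of the prefix, which
reverses inequalities. -/
theorem dom_swap {n : ℕ} {w₁ w₂ : Word n} (h : Dom w₁ w₂) : Dom w₂.swap w₁.swap := by
  obtain ⟨h1, h2⟩ := h
  have e1 := numMinus_add_numPlus w₁
  have e2 := numMinus_add_numPlus w₂
  refine ⟨by rw [numMinus_swap, numMinus_swap]; omega, ?_⟩
  rw [height_le_height_iff] at h2 ⊢
  intro k
  rcases le_total k n with hk | hk
  · have := h2 k
    have := minusCount_swap w₁ k hk
    have := minusCount_swap w₂ k hk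
    omega
  · rw [minusCount_of_le _ _ hk, minusCount_of_le _ _ hk, numMinus_swap, numMinus_swap]
    omega

theorem Dom.numPlus_eq {n : ℕ} {w₁ w₂ : Word n} (h : Dom w₁ w₂) : w₁.numPlus = w₂.numPlus := by
  have := h.1
  have := numMinus_add_numPlus w₁
  have := numMinus_add_numPlus w₂
  omega

theorem Dom.refl {n : ℕ} (w : Word n) : Dom w w := ⟨rfl, fun _ => le_rfl⟩

theorem Dom.trans {n : ℕ} {w₁ w₂ w₃ : Word n} (h : Dom w₁ w₂) (h' : Dom w₂ w₃) : Dom w₁ w₃ :=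
  ⟨h.1.trans h'.1, fun j => (h'.2 j).trans (h.2 j)⟩

theorem Dom.antisymm {n : ℕ} {w₁ w₂ : Word n} (h : Dom w₁ w₂) (h' : Dom w₂ w₁) : w₁ = w₂ :=
  ext_height fun j => le_antisymm (h'.2 j) (h.2 j)

theorem minusSet_card_filter {n : ℕ} (w : Word n) (k : ℕ) :
    (w.minusSet.filter fun i => i.val < k).card = w.minusCount k := by
  induction w using consInduction generalizing k with
  | nil w => rw [minusCount_nil, Finset.card_eq_zero]; exact Finset.eq_empty_of_isEmpty _
  | @plus n u ih =>
    cases k with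
    | zero => simp
    | succ k =>
      rw [minusCount_plus, ← ih, ← Finset.card_map (Fin.succEmb n)]
      refine congrArg Finset.card (Finset.ext fun i => ?_)
      refine Fin.cases ?_ (fun i => ?_) i <;> simp [minusSet, Fin.succ_ne_zero]
  | @minus n u ih =>
    cases k with
    | zero => simp
    | succ k =>
      have h0 : (0 : Fin (n + 1)) ∉
          (u.minusSet.filter fun i => i.val < k).map (Fin.succEmb n) := by
        simp [Fin.succ_ne_zero]
      rw [minusCount_minus, ← ih, ← Finset.card_map (Fin.succEmb n),
        ← Finset.card_insert_of_notMem h0]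
      refine congrArg Finset.card (Finset.ext fun i => ?_)
      refine Fin.cases ?_ (fun i => ?_) i <;> simp [minusSet, Fin.succ_ne_zero]

theorem minusSet_card {n : ℕ} (w : Word n) : w.minusSet.card = w.numMinus := by
  rw [← minusCount_of_le w n le_rfl, ← minusSet_card_filter]
  congr 1
  ext i
  simp

end Word

/-- The order embedding carries initial segments of `Fin m` to initial segments of `s`. This turns
comparisons of the `i`-th elements of two sets into comparisons of counts. -/
theorem Finset.orderEmbOfFin_lt_iff {n m : ℕ} (s : Finset (Fin n)) (h : s.card = m) (i : Fin m)
    (k : ℕ) :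
    (s.orderEmbOfFin h i).val < k ↔ i.val < (s.filter fun a => a.val < k).card := by
  constructor
  · intro hk
    have : (Finset.univ.filter (fun j : Fin m => j ≤ i)).map (s.orderEmbOfFin h).toEmbedding ⊆
        s.filter fun a => a.val < k := by
      intro a ha
      simp only [Finset.mem_map, Finset.mem_filter, Finset.mem_univ, true_and] at ha
      obtain ⟨j, hj, rfl⟩ := ha
      refine Finset.mem_filter.2 ⟨Finset.orderEmbOfFin_mem _ _ _, lt_of_le_of_lt ?_ hk⟩
      exact (s.orderEmbOfFin h).monotone hj
    have := Finset.card_le_card this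
    rw [Finset.card_map] at this
    have e : (Finset.univ.filter (fun j : Fin m => j ≤ i)).card = i.val + 1 := by
      rw [← Fin.card_Iic i]
      congr 1
      ext; simp
    omega
  · intro hi
    by_contra hk
    have : s.filter (fun a => a.val < k) ⊆
        (Finset.univ.filter (fun j : Fin m => j < i)).map (s.orderEmbOfFin h).toEmbedding := by
      intro a ha
      rw [Finset.mem_filter] at ha
      obtain ⟨j, rfl⟩ : a ∈ Set.range (s.orderEmbOfFin h) := by
        rw [Finset.range_orderEmbOfFin]; exact ha.1
      simp only [Finset.mem_map, Finset.mem_filter, Finset.mem_univ, true_and]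
      refine ⟨j, ?_, rfl⟩
      by_contra hj
      have := (s.orderEmbOfFin h).monotone (not_lt.1 hj)
      rw [Fin.le_def] at this
      omega
    have := Finset.card_le_card this
    rw [Finset.card_map] at this
    have e : (Finset.univ.filter (fun j : Fin m => j < i)).card = i.val := by
      rw [← Fin.card_Iio i]
      congr 1
      ext; simp
    omega

namespace Word

theorem prec_iff_dom {n : ℕ} (w₁ w₂ : Word n) : w₁.Prec w₂ ↔ Dom w₁ w₂ := by
  unfold Prec Dom
  rw [height_le_height_iff, ← minusSet_card, ← minusSet_card]
  constructor
  · rintro ⟨h, hi⟩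
    refine ⟨h.symm, fun k => ?_⟩
    rw [← minusSet_card_filter, ← minusSet_card_filter]
    by_contra hk
    rw [not_le] at hk
    have hle : (w₂.minusSet.filter fun i => i.val < k).card ≤ w₁.minusSet.card := by
      rw [← h]; exact Finset.card_filter_le _ _
    -- The first `-` sign of `w₁` at position `k` or later; the corresponding `-` sign of `w₂` would
    -- be before `k`.
    obtain ⟨i, hval⟩ : ∃ i : Fin w₁.minusSet.card,
        i.val = (w₁.minusSet.filter fun i => i.val < k).card := ⟨⟨_, lt_of_lt_of_le hk hle⟩, rfl⟩
    rw [← hval] at hk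
    have h1 := (Finset.orderEmbOfFin_lt_iff w₂.minusSet h i k).2 hk
    have h2 := (Finset.orderEmbOfFin_lt_iff w₁.minusSet rfl i k).1
      (lt_of_le_of_lt (Fin.le_def.1 (hi i)) h1)
    exact absurd h2 (by rw [hval]; exact lt_irrefl _)
  · rintro ⟨h, hk⟩
    refine ⟨h.symm, fun i => ?_⟩
    rw [Fin.le_def, ← Nat.lt_succ_iff, Finset.orderEmbOfFin_lt_iff, minusSet_card_filter]
    refine lt_of_lt_of_le ?_ (hk _)
    rw [← minusSet_card_filter, ← Finset.orderEmbOfFin_lt_iff _ h.symm]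
    exact Nat.lt_succ_self _

end Word

/-! ### Moves of signs and the generation of comparable pairs -/

namespace Word

theorem dom_cons_iff {n : ℕ} (s : Sgn) (u₁ u₂ : Word n) :
    Dom (cons s u₁) (cons s u₂) ↔ Dom u₁ u₂ := by
  unfold Dom
  cases s
  · simp
  · simp only [numMinus_plus]
    refine and_congr_right fun _ => ⟨fun h j => by simpa using h (j + 1), fun h j => ?_⟩
    cases j <;> simp [h]

theorem Dom.insertPlus {n : ℕ} {u₁ u₂ : Word n} (h : Dom u₁ u₂) (j : ℕ) :
    Dom (u₁.insertPlus j) (u₂.insertPlus j) := by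
  refine ⟨by rw [numMinus_insertPlus, numMinus_insertPlus, h.1], fun i => ?_⟩
  cases j with
  | zero => cases i <;> simp [h.2]
  | succ j =>
    rw [height_insertPlus_succ, height_insertPlus_succ]
    split_ifs <;> exact h.2 _

theorem Dom.removePlus {n : ℕ} {w₁ w₂ : Word (n + 1)} (h : Dom w₁ w₂) {j : ℕ}
    (hj : j < w₁.numPlus) : Dom (w₁.removePlus j) (w₂.removePlus j) := by
  have hj' : j < w₂.numPlus := h.numPlus_eq ▸ hj
  refine ⟨by rw [numMinus_removePlus _ _ hj, numMinus_removePlus _ _ hj', h.1], fun i => ?_⟩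
  rw [height_removePlus _ _ _ hj, height_removePlus _ _ _ hj']
  split_ifs <;> exact h.2 _

/-- The `+` sign jumps left over `-` signs, so its own height decreases and no other height changes.
-/
theorem dom_removePlus_insertPlus {n : ℕ} (w : Word (n + 1)) {j : ℕ} (hj : j < w.numPlus) :
    Dom w ((w.removePlus j).insertPlus j) := by
  refine ⟨by rw [numMinus_insertPlus, numMinus_removePlus _ _ hj], fun i => ?_⟩
  cases j with
  | zero =>
    cases i with
    | zero => simp
    | succ i => rw [insertPlus_zero, height_plus_succ, height_removePlus _ _ _ hj]; simp
  | succ j =>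
    rw [height_insertPlus_succ, height_removePlus _ _ _ hj, height_removePlus _ _ _ hj]
    split_ifs
    · exact le_rfl
    · omega
    · exact w.height_mono (by omega)
    · exact w.height_mono (by omega)

theorem Dom.swap_left {n : ℕ} {w₁ w₂ : Word n} (h : Dom w₁.swap w₂) : Dom w₂.swap w₁ := by
  simpa using dom_swap h

theorem Dom.insertMinus {n : ℕ} {u₁ u₂ : Word n} (h : Dom u₁ u₂) (j : ℕ) :
    Dom (u₁.insertMinus j) (u₂.insertMinus j) :=
  dom_swap ((dom_swap h).insertPlus j)

theorem Dom.removeMinus {n : ℕ} {w₁ w₂ : Word (n + 1)} (h : Dom w₁ w₂) {j : ℕ}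
    (hj : j < w₁.numMinus) : Dom (w₁.removeMinus j) (w₂.removeMinus j) :=
  dom_swap ((dom_swap h).removePlus (by rw [numPlus_swap, ← h.1]; exact hj))

/-- The first `-` sign jumps right over the `+` signs of height `1`; these drop to height `0`. -/
theorem dom_removeMinus_insertMinus {n : ℕ} (w : Word (n + 1)) (hw : 1 < w.numMinus) :
    Dom w ((w.removeMinus 0).insertMinus 1) := by
  have h := numMinus_removeMinus w 0 (by omega)
  refine ⟨by rw [numMinus_insertMinus, h], fun i => ?_⟩
  rw [height_insertMinus_one _ (by omega), height_removeMinus_zero _ (by omega)]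
  split_ifs <;> omega

/-- The comparable pairs of words, generated by moves that have a simple effect on basis chord
diagrams. -/
inductive Related : ∀ {n : ℕ}, Word n → Word n → Prop
  | nil (w₁ w₂ : Word 0) : Related w₁ w₂
  | cons {n : ℕ} (s : Sgn) {u₁ u₂ : Word n} (h : Related u₁ u₂) :
      Related (cons s u₁) (cons s u₂)
  | insertPlus {n : ℕ} (j : ℕ) {u₁ u₂ : Word n} (h : Related u₁ u₂) (hd : Dom u₁ u₂)
      (hj : 1 ≤ j) (hju : j ≤ u₁.numPlus) : Related (u₁.insertPlus j) (u₂.insertPlus j)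
  | insertMinus {n : ℕ} {u₁ u₂ : Word n} (h : Related u₁ u₂) (hd : Dom u₁ u₂)
      (hu : 1 ≤ u₁.numMinus) : Related (u₁.insertMinus 1) (u₂.insertMinus 1)
  | movePlus {n : ℕ} (j : ℕ) {w₁ w₂' w₂ : Word (n + 1)} (h : Related w₁ w₂') (hd : Dom w₁ w₂')
      (hj : j < w₁.numPlus) (hw : (w₂'.removePlus j).insertPlus j = w₂) (hne : w₂ ≠ w₂')
      (hfix : ∀ u : Word (n + 1), j < u.numPlus → (u.removePlus j).insertPlus j ≠ w₁)
      (huniq : ∀ u, Dom w₁ u → Dom u w₂' → (u.removePlus j).insertPlus j = w₂ → u = w₂') :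
      Related w₁ w₂
  | moveMinus {n : ℕ} {w₁ w₂' w₂ : Word (n + 1)} (h : Related w₁ w₂') (hd : Dom w₁ w₂')
      (hj : 1 < w₁.numMinus) (hw : (w₂'.removeMinus 0).insertMinus 1 = w₂) (hne : w₂ ≠ w₂')
      (hfix : ∀ u : Word (n + 1), 1 < u.numMinus → (u.removeMinus 0).insertMinus 1 ≠ w₁)
      (huniq : ∀ u, Dom w₁ u → Dom u w₂' → (u.removeMinus 0).insertMinus 1 = w₂ → u = w₂') :
      Related w₁ w₂

theorem height_move_plus {n : ℕ} (w : Word (n + 1)) {j : ℕ} (hj : j < w.numPlus) (i : ℕ) :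
    ((w.removePlus j).insertPlus j).height i =
      if i = j then (if j = 0 then 0 else w.height (j - 1)) else w.height i := by
  cases j with
  | zero =>
    cases i with
    | zero => simp
    | succ i => rw [insertPlus_zero, height_plus_succ, height_removePlus _ _ _ hj]; simp
  | succ j =>
    rw [height_insertPlus_succ, height_removePlus _ _ _ hj, height_removePlus _ _ _ hj]
    rcases lt_trichotomy i (j + 1) with h | h | h
    · rw [if_pos (by omega), if_pos h, if_neg (by omega)]
    · subst h; simp
    · rw [if_neg (by omega), if_neg (by omega), if_neg (by omega), Nat.sub_add_cancel (by omega)]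

theorem height_move_minus {n : ℕ} (w : Word (n + 1)) (hw : 1 < w.numMinus) (i : ℕ) :
    ((w.removeMinus 0).insertMinus 1).height i = if w.height i = 1 then 0 else w.height i := by
  have := numMinus_removeMinus w 0 (by omega)
  rw [height_insertMinus_one _ (by omega), height_removeMinus_zero _ (by omega)]
  split_ifs <;> omega

/-- The word whose `j`-th `+` sign is moved next to the following one. -/
theorem exists_move_plus {n : ℕ} (w : Word (n + 1)) {j : ℕ} (hj : j < w.numPlus) :
    ∃ w' : Word (n + 1), w'.numMinus = w.numMinus ∧
      ∀ i, w'.height i = if i = j then w.height (j + 1) else w.height i := by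
  refine ⟨(w.removePlus j).insertPlus (j + 1),
    by rw [numMinus_insertPlus, numMinus_removePlus _ _ hj], fun i => ?_⟩
  rw [height_insertPlus_succ, height_removePlus _ _ _ hj, height_removePlus _ _ _ hj]
  rcases lt_trichotomy i j with h | h | h
  · rw [if_pos (by omega), if_pos h, if_neg (by omega)]
  · subst h; simp
  · rw [if_neg (by omega), if_neg (by omega), if_neg (by omega), Nat.sub_add_cancel (by omega)]

/-- Induction on the area between the two lattice paths, measured by the sum of height differences;
the shorter words are covered by `ih`. Indices beyond `n` do not contribute, since both heights
there equal the number of `-` signs. A move is undone on `w₂` when the result stays above `w₁`,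
which decreases the area; in the cases where the required properties of the move fail, both words
contain a common sign that can be removed. -/
theorem related_of_dom_aux (n : ℕ)
    (ih : ∀ w₁ w₂ : Word n, Dom w₁ w₂ → Related w₁ w₂) :
    ∀ (m : ℕ) (w₁ w₂ : Word (n + 1)), Dom w₁ w₂ →
      ∑ j ∈ Finset.range (n + 1), (w₁.height j - w₂.height j) = m → Related w₁ w₂ := by
  intro m
  induction m using Nat.strong_induction_on with
  | _ m ihm =>
  intro w₁ w₂ hd hm
  have hdec : ∀ w₂' : Word (n + 1), Dom w₁ w₂' → Dom w₂' w₂ → w₂ ≠ w₂' → Related w₁ w₂' := by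
    intro w₂' h1 h2 h3
    refine ihm _ ?_ w₁ w₂' h1 rfl
    rw [← hm]
    refine Finset.sum_lt_sum (fun i _ => Nat.sub_le_sub_left (h2.2 i) _) ?_
    by_contra hcon
    push Not at hcon
    refine h3 (ext_height fun j => ?_)
    rcases lt_or_ge j (n + 1) with hj | hj
    · have := hcon j (Finset.mem_range.2 hj)
      have := h2.2 j
      have := h1.2 j
      omega
    · have := numMinus_add_numPlus w₂
      have := numMinus_add_numPlus w₂'
      rw [height_of_numPlus_le _ _ (by omega), height_of_numPlus_le _ _ (by omega), h2.1]
  have e1 := numMinus_add_numPlus w₁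
  have e2 := numMinus_add_numPlus w₂
  have hP := hd.numPlus_eq
  -- equal first symbols
  by_cases h0 : w₁ 0 = w₂ 0
  · rw [← cons_head_tail w₁, ← cons_head_tail w₂, h0] at hd ⊢
    exact Related.cons _ (ih _ _ ((dom_cons_iff _ _ _).1 hd))
  have h1 : w₁ 0 = Sgn.minus ∧ w₂ 0 = Sgn.plus := by
    cases ha : w₁ 0 <;> cases hb : w₂ 0
    · exact absurd (ha.trans hb.symm) h0
    · exact ⟨rfl, rfl⟩
    · have := hd.2 0
      rw [← cons_head_tail w₁, ← cons_head_tail w₂, ha, hb] at this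
      simp at this
    · exact absurd (ha.trans hb.symm) h0
  obtain ⟨h1, h2⟩ := h1
  have hpos₁ : ∀ j, 1 ≤ w₁.height j := by
    intro j
    rw [← cons_head_tail w₁, h1]; simp
  have hzero₂ : w₂.height 0 = 0 := by rw [← cons_head_tail w₂, h2]; simp
  have hM : 1 ≤ w₁.numMinus := (hpos₁ 0).trans (height_le_numMinus _ _)
  have hex : ∃ c, 1 ≤ w₂.height c :=
    ⟨w₂.numPlus, by rw [height_of_numPlus_le _ _ le_rfl, ← hd.1]; exact hM⟩
  -- The larger word begins with `c + 1` signs `+`, followed by a run of `w₂.height (c + 1)` signs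
  -- `-`.
  obtain ⟨c, hc1, hc2⟩ : ∃ c, 1 ≤ w₂.height (c + 1) ∧ ∀ i ≤ c, w₂.height i = 0 := by
    classical
    have hf := Nat.find_spec hex
    cases hcc : Nat.find hex with
    | zero => rw [hcc, hzero₂] at hf; omega
    | succ c =>
      rw [hcc] at hf
      refine ⟨c, hf, fun i hi => ?_⟩
      have := Nat.find_min hex (m := i) (by omega)
      omega
  have hcP : c < w₂.numPlus := by
    by_contra hcon
    have := hc2 c le_rfl
    rw [height_of_numPlus_le _ _ (by omega)] at this
    have := hd.1
    omega
  rcases Nat.lt_or_ge 1 (w₂.height (c + 1)) with hl | hl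
  · -- the first run of minus signs of the larger word has length at least two
    have hne1 : ∀ j, w₂.height j ≠ 1 := by
      intro j
      rcases Nat.lt_or_ge c j with h | h
      · have : w₂.height (c + 1) ≤ w₂.height j := w₂.height_mono h
        omega
      · rw [hc2 j h]; omega
    have hM2 : 1 < w₁.numMinus := by
      have := height_le_numMinus w₂ (c + 1)
      have := hd.1
      omega
    -- No height equal to `1` means that the first two `-` signs are adjacent. This holds for `w₂`;
    -- if it also holds for `w₁`, a `-` sign is removed from both.
    by_cases hr : ∃ j, w₁.height j = 1
    · obtain ⟨j₀, hj₀⟩ := hr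
      have hMr := numMinus_removeMinus w₂ 0 (by rw [← hd.1]; omega)
      -- The predecessor of `w₂` has the first `-` sign at the front, so that height `0` becomes
      -- `1`. It is still above `w₁`, whose heights are all positive.
      have hw' : ∀ i, ((w₂.removeMinus 0).insertMinus 0).height i =
          if w₂.height i = 0 then 1 else w₂.height i := by
        intro i
        rw [insertMinus_zero, height_minus, height_removeMinus_zero _ (by rw [← hd.1]; omega)]
        split_ifs <;> omega
      have hm' : ((w₂.removeMinus 0).insertMinus 0).numMinus = w₂.numMinus := by
        rw [numMinus_insertMinus]; omega
      generalize (w₂.removeMinus 0).insertMinus 0 = w₂' at hw' hm'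
      have hd' : Dom w₁ w₂' := by
        refine ⟨hd.1.trans hm'.symm, fun i => ?_⟩
        rw [hw']
        split_ifs
        · exact hpos₁ i
        · exact hd.2 i
      have hd'' : Dom w₂' w₂ := by
        refine ⟨hm', fun i => ?_⟩
        rw [hw']
        split_ifs <;> omega
      have hne : w₂ ≠ w₂' := by
        intro h
        have := hw' 0
        rw [← h, hzero₂] at this
        simp at this
      refine Related.moveMinus (hdec _ hd' hd'' hne) hd' hM2 ?_ hne ?_ ?_
      · refine ext_height fun i => ?_
        rw [height_move_minus _ (by rw [hm', ← hd.1]; omega), hw']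
        have := hne1 i
        split_ifs <;> omega
      -- A word produced by the move has no height equal to `1`, whereas `w₁` has one.
      · intro u hu h
        rw [← h, height_move_minus _ hu] at hj₀
        split_ifs at hj₀
        exact absurd hj₀ ‹_›
      · intro u hu1 hu2 hu3
        refine ext_height fun i => ?_
        have h1 := height_move_minus u (by rw [← hu1.1]; omega) i
        rw [hu3] at h1
        have h2 := hu2.2 i
        rw [hw'] at h2 ⊢
        have := hne1 i
        split_ifs at h1 h2 ⊢ <;> omega
    · push Not at hr
      have key : ∀ w : Word (n + 1), 1 < w.numMinus → (∀ j, w.height j ≠ 1) →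
          (w.removeMinus 0).insertMinus 1 = w := by
        intro w hw hj
        refine ext_height fun i => ?_
        rw [height_move_minus _ hw, if_neg (hj i)]
      rw [← key w₁ hM2 hr, ← key w₂ (by rw [← hd.1]; exact hM2) hne1]
      have hd' := hd.removeMinus (j := 0) (by omega)
      refine Related.insertMinus (ih _ _ hd') hd' ?_
      have := numMinus_removeMinus w₁ 0 (by omega)
      omega
  · -- that run has length one
    have hl1 : w₂.height (c + 1) = 1 := by omega
    -- Here the `+` signs of index `c - 1` and `c` are adjacent in both words, and one can be
    -- removed from each.
    by_cases hr : 1 ≤ c ∧ w₁.height (c - 1) = w₁.height c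
    · have key : ∀ w : Word (n + 1), c < w.numPlus → w.height (c - 1) = w.height c →
          (w.removePlus c).insertPlus c = w := by
        intro w hw hj
        refine ext_height fun i => ?_
        rw [height_move_plus _ hw]
        split_ifs
        · omega
        · rw [hj, ‹i = c›]
        · rfl
      rw [← key w₁ (by omega) hr.2, ← key w₂ hcP (by rw [hc2 _ (Nat.sub_le _ _), hc2 _ le_rfl])]
      have hd' := hd.removePlus (j := c) (by omega)
      refine Related.insertPlus c (ih _ _ hd') hd' hr.1 ?_
      have := numPlus_removePlus w₁ c (by omega)
      omega
    -- The predecessor of `w₂` has its `c`-th `+` sign behind the single `-` sign that follows it.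
    · obtain ⟨w₂', hm', hw'⟩ := exists_move_plus w₂ hcP
      rw [hl1] at hw'
      have hd' : Dom w₁ w₂' := by
        refine ⟨hd.1.trans hm'.symm, fun i => ?_⟩
        rw [hw']
        split_ifs
        · exact hpos₁ i
        · exact hd.2 i
      have hd'' : Dom w₂' w₂ := by
        refine ⟨hm', fun i => ?_⟩
        rw [hw']
        split_ifs with h
        · rw [h, hc2 _ le_rfl]; omega
        · exact le_rfl
      have hne : w₂ ≠ w₂' := by
        intro h
        have := hw' c
        rw [← h, hc2 _ le_rfl] at this
        simp at this
      refine Related.movePlus c (hdec _ hd' hd'' hne) hd' (by omega) ?_ hne ?_ ?_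
      · refine ext_height fun i => ?_
        rw [height_move_plus _ (by rw [← hd'.numPlus_eq]; omega), hw', hw']
        split_ifs with ha hb hb
        · rw [ha, hc2 _ le_rfl]
        · omega
        · rw [ha, hc2 _ le_rfl, hc2 _ (Nat.sub_le _ _)]
        · rfl
      -- After the move the `c`-th `+` sign is at the front or next to its predecessor; neither
      -- holds in `w₁`.
      · intro u hu h
        have ha := height_move_plus u hu c
        rw [if_pos rfl, h] at ha
        split_ifs at ha with hb
        · have := hpos₁ c
          omega
        · refine hr ⟨by omega, ?_⟩
          have := height_move_plus u hu (c - 1)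
          rw [if_neg (by omega), h] at this
          rw [ha, this]
      -- The move changes only the height at `c`. For `u` it is at least `1` because `u` is below
      -- `w₂'`, and at most the next height, which is `1`.
      · intro u hu1 hu2 hu3
        refine ext_height fun i => ?_
        have huP : c < u.numPlus := by rw [← hu1.numPlus_eq]; omega
        have h1 := height_move_plus u huP i
        rw [hu3] at h1
        rw [hw']
        split_ifs at h1 ⊢ with ha hb
        · have h2 := hu2.2 c
          rw [hw', if_pos rfl] at h2
          have h3 : u.height c ≤ u.height (c + 1) := u.height_mono (Nat.le_succ _)
          have h4 := height_move_plus u huP (c + 1)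
          rw [hu3, if_neg (by omega), hl1] at h4
          rw [ha]; omega
        · have h2 := hu2.2 c
          rw [hw', if_pos rfl] at h2
          have h3 : u.height c ≤ u.height (c + 1) := u.height_mono (Nat.le_succ _)
          have h4 := height_move_plus u huP (c + 1)
          rw [hu3, if_neg (by omega), hl1] at h4
          rw [ha]; omega
        · exact h1.symm

theorem related_of_dom {n : ℕ} (w₁ w₂ : Word n) (h : Dom w₁ w₂) : Related w₁ w₂ := by
  induction n with
  | zero => exact Related.nil _ _
  | succ n ih => exact related_of_dom_aux n ih _ w₁ w₂ h rfl

end Word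

/-! ### Insertion of an outermost chord and capping off two adjacent points -/

namespace ChordDiagram

variable {n : ℕ}

theorem partner_injective (Γ : ChordDiagram n) : Function.Injective Γ.partner :=
  Function.LeftInverse.injective Γ.partner_partner

/-- The partner of a marked point, as a function on natural numbers. -/
def val (Γ : ChordDiagram n) (x : ℕ) : ℕ := if h : x < 2 * n then (Γ.partner ⟨x, h⟩).val else x

theorem val_of_lt (Γ : ChordDiagram n) {x : ℕ} (h : x < 2 * n) :
    Γ.val x = (Γ.partner ⟨x, h⟩).val := dif_pos h

theorem val_fin (Γ : ChordDiagram n) (x : Fin (2 * n)) : Γ.val x.val = (Γ.partner x).val :=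
  Γ.val_of_lt x.isLt

theorem val_lt (Γ : ChordDiagram n) {x : ℕ} (h : x < 2 * n) : Γ.val x < 2 * n := by
  rw [Γ.val_of_lt h]; exact Fin.isLt _

theorem val_val (Γ : ChordDiagram n) (x : ℕ) : Γ.val (Γ.val x) = x := by
  by_cases h : x < 2 * n
  · rw [Γ.val_of_lt h, Γ.val_fin, Γ.partner_partner]
  · simp [val, h]

theorem val_inj (Γ : ChordDiagram n) {x y : ℕ} (h : Γ.val x = Γ.val y) : x = y := by
  rw [← Γ.val_val x, h, Γ.val_val]

theorem val_createPlus (Γ : ChordDiagram n) {x : ℕ} (h : x < 2 * (n + 1)) :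
    Γ.createPlus.val x = if x < 2 then 1 - x else Γ.val (x - 2) + 2 := by
  rw [val_of_lt _ h]
  by_cases h2 : x < 2
  · rw [if_pos h2]
    exact congrArg Fin.val (dif_pos h2)
  · rw [if_neg h2, Γ.val_of_lt (by omega)]
    exact congrArg Fin.val (dif_neg h2)

theorem val_createMinus (Γ : ChordDiagram n) {x : ℕ} (h : x < 2 * (n + 1)) :
    Γ.createMinus.val x = if x = 0 then 2 * n + 1 else if x = 2 * n + 1 then 0 else
      if Γ.val (if x = 2 * n then 0 else x) = 0 then 2 * n
        else Γ.val (if x = 2 * n then 0 else x) := by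
  rw [val_of_lt _ h]
  by_cases h0 : x = 0
  · simp [createMinus, h0]
  by_cases h1 : x = 2 * n + 1
  · simp [createMinus, h1, Fin.val_rev]; omega
  rw [if_neg h0, if_neg h1, Γ.val_of_lt (by split_ifs <;> omega)]
  simp only [createMinus, h0, h1, or_self, dite_false, minusNew, minusOld]

/-- The relabelling of the marked points when two points `p`, `p + 1` are inserted. -/
def skip (p q : ℕ) : ℕ := if q < p then q else q + 2

theorem skip_minus {p s : ℕ} (hp : 1 ≤ p) (hp' : p ≤ 2 * n) :
    (if skip p s = 0 then 2 * (n + 1) else skip p s) = skip p (if s = 0 then 2 * n else s) := by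
  by_cases hs : s = 0
  · have e1 : skip p 0 = 0 := if_pos (by omega)
    have e2 : skip p (2 * n) = 2 * n + 2 := if_neg (by omega)
    simp only [hs, e1, e2, if_true]
    omega
  · have e : skip p s ≠ 0 := by unfold skip; split_ifs <;> omega
    simp only [hs, e, if_false]

/-- `Γ'` is obtained from `Γ` by inserting an outermost chord with endpoints `p`, `p + 1`. -/
def IsInsert (p : ℕ) (Γ : ChordDiagram n) (Γ' : ChordDiagram (n + 1)) : Prop :=
  p ≤ 2 * n ∧ Γ'.val p = p + 1 ∧ Γ'.val (p + 1) = p ∧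
    ∀ q < 2 * n, Γ'.val (skip p q) = skip p (Γ.val q)

/-- `Γ` is obtained from `Γ'` by joining the chords at the points `p`, `p + 1`, which are distinct,
to a single one. -/
def IsCap (p : ℕ) (Γ' : ChordDiagram (n + 1)) (Γ : ChordDiagram n) : Prop :=
  p ≤ 2 * n ∧ Γ'.val p ≠ p + 1 ∧
    (∀ q < 2 * n, Γ'.val (skip p q) ≠ p → Γ'.val (skip p q) ≠ p + 1 →
      Γ'.val (skip p q) = skip p (Γ.val q)) ∧
    ∀ q < 2 * n, ∀ q' < 2 * n, Γ'.val (skip p q) = p → Γ'.val (skip p q') = p + 1 → Γ.val q = q'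

theorem isInsert_createPlus (Γ : ChordDiagram n) : IsInsert 0 Γ Γ.createPlus := by
  refine ⟨by omega, ?_, ?_, fun q hq => ?_⟩
  · rw [val_createPlus _ (by omega)]; simp
  · rw [val_createPlus _ (by omega)]; simp
  · rw [skip, if_neg (by omega), val_createPlus _ (by omega), skip]; simp

theorem IsInsert.createPlus {p : ℕ} {Γ : ChordDiagram n} {Γ' : ChordDiagram (n + 1)}
    (h : IsInsert p Γ Γ') : IsInsert (p + 2) Γ.createPlus Γ'.createPlus := by
  obtain ⟨h0, h1, h2, h3⟩ := h
  refine ⟨by omega, ?_, ?_, fun q hq => ?_⟩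
  · rw [val_createPlus _ (by omega)]; simp [h1]
  · rw [val_createPlus _ (by omega), if_neg (by omega), show p + 2 + 1 - 2 = p + 1 by omega, h2]
  · rw [val_createPlus _ hq]
    by_cases hq2 : q < 2
    · rw [if_pos hq2, skip, if_pos (by omega), val_createPlus _ (by omega), if_pos hq2, skip,
        if_pos (by omega)]
    · rw [if_neg hq2]
      have := h3 (q - 2) (by omega)
      have e : skip (p + 2) q = skip p (q - 2) + 2 := by
        unfold skip; split_ifs <;> omega
      rw [e, val_createPlus _ (by unfold skip; split_ifs <;> omega), if_neg (by omega),
        Nat.add_sub_cancel, this]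
      unfold skip; split_ifs <;> omega

theorem IsInsert.createMinus {p : ℕ} {Γ : ChordDiagram n} {Γ' : ChordDiagram (n + 1)}
    (h : IsInsert p Γ Γ') (hp : 1 ≤ p) : IsInsert p Γ.createMinus Γ'.createMinus := by
  obtain ⟨h0, h1, h2, h3⟩ := h
  refine ⟨by omega, ?_, ?_, fun q hq => ?_⟩
  · rw [val_createMinus _ (by omega)]
    simp only [show p ≠ 0 by omega, show p ≠ 2 * (n + 1) + 1 by omega, if_false,
      show p ≠ 2 * (n + 1) by omega, h1]
    simp
  · rw [val_createMinus _ (by omega)]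
    simp only [show p + 1 ≠ 0 by omega, show p + 1 ≠ 2 * (n + 1) + 1 by omega, if_false,
      show p + 1 ≠ 2 * (n + 1) by omega, h2]
    simp [show p ≠ 0 by omega]
  · rw [val_createMinus _ hq, val_createMinus _ (by unfold skip; split_ifs <;> omega)]
    by_cases hq0 : q = 0
    · subst hq0
      simp only [skip, show 0 < p by omega, if_true, show ¬ 2 * n + 1 < p by omega, if_false]
      omega
    by_cases hq1 : q = 2 * n + 1
    · subst hq1
      have e1 : skip p (2 * n + 1) = 2 * (n + 1) + 1 := if_neg (by omega)
      have e2 : skip p 0 = 0 := if_pos (by omega)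
      simp only [e1, e2, if_true, Nat.succ_ne_zero, if_false]
    have e1 : skip p q ≠ 0 := by unfold skip; split_ifs <;> omega
    have e2 : skip p q ≠ 2 * (n + 1) + 1 := by unfold skip; split_ifs <;> omega
    have e3 : (if skip p q = 2 * (n + 1) then 0 else skip p q) =
        skip p (if q = 2 * n then 0 else q) := by
      unfold skip; split_ifs <;> omega
    rw [if_neg e1, if_neg e2, e3, if_neg hq0, if_neg hq1]
    have hlt : (if q = 2 * n then 0 else q) < 2 * n := by split_ifs <;> omega
    rw [h3 _ hlt]
    exact skip_minus hp h0

/-- Of two nested applications of `B₋`, the inner chord also joins neighbouring points, `2 * n + 1`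
and `2 * n + 2`. So the inner one may be regarded as the inserted chord, and the outer one as the
original. -/
theorem isInsert_createMinus (Γ : ChordDiagram n) (hn : 0 < n) :
    IsInsert (2 * n + 1) Γ.createMinus Γ.createMinus.createMinus := by
  have h0 : Γ.createMinus.val 0 = 2 * n + 1 := by rw [val_createMinus _ (by omega), if_pos rfl]
  have h1 : Γ.createMinus.val (2 * n + 1) = 0 := by
    rw [val_createMinus _ (by omega), if_neg (by omega), if_pos rfl]
  refine ⟨by omega, ?_, ?_, fun q hq => ?_⟩
  · rw [val_createMinus _ (by omega)]
    simp only [show 2 * n + 1 ≠ 0 by omega, show 2 * n + 1 ≠ 2 * (n + 1) + 1 by omega,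
      show 2 * n + 1 ≠ 2 * (n + 1) by omega, if_false, h1, if_true]
    omega
  · rw [val_createMinus _ (by omega)]
    simp only [show 2 * n + 1 + 1 = 2 * (n + 1) by omega, h0, if_true]
    simp
  · have hs : skip (2 * n + 1) q < 2 * (n + 1 + 1) := by unfold skip; split_ifs <;> omega
    rw [val_createMinus _ hs]
    by_cases hq0 : q = 0
    · subst hq0
      have e1 : skip (2 * n + 1) 0 = 0 := if_pos (by omega)
      have e2 : skip (2 * n + 1) (2 * n + 1) = 2 * (n + 1) + 1 := if_neg (by omega)
      simp only [h0, e1, e2, if_true]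
    by_cases hq1 : q = 2 * n + 1
    · subst hq1
      have e1 : skip (2 * n + 1) 0 = 0 := if_pos (by omega)
      have e2 : skip (2 * n + 1) (2 * n + 1) = 2 * (n + 1) + 1 := if_neg (by omega)
      simp only [h1, e1, e2, if_true, Nat.succ_ne_zero, if_false]
    have e : skip (2 * n + 1) q = q := if_pos (by omega)
    have e1 : ¬ q = 2 * (n + 1) + 1 := by omega
    have e2 : ¬ q = 2 * (n + 1) := by omega
    simp only [e, hq0, e1, e2, if_false]
    have h2 : Γ.createMinus.val q ≠ 0 := fun h => hq1 (Γ.createMinus.val_inj (by rw [h, h1]))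
    have h3 : Γ.createMinus.val q ≠ 2 * n + 1 := fun h =>
      hq0 (Γ.createMinus.val_inj (by rw [h, h0]))
    have h4 := Γ.createMinus.val_lt hq
    rw [if_neg h2, skip, if_pos (by omega)]

/-- Joining the end `1` of the new chord to the old base point `2` lengthens the old base chord up
to the new base point: capping off undoes the creation. -/
theorem isCap_createPlus (Γ : ChordDiagram n) (hn : 0 < n) : IsCap 1 Γ.createPlus Γ := by
  have h0 := Γ.val_lt (x := 0) (by omega)
  have hs : ∀ q < 2 * n, Γ.createPlus.val (skip 1 q) = if q = 0 then 1 else Γ.val q + 2 := by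
    intro q hq
    rw [val_createPlus _ (by unfold skip; split_ifs <;> omega)]
    unfold skip
    split_ifs with h1 h2 h3 h3 <;> first | omega | simp
  refine ⟨by omega, ?_, fun q hq h1 h2 => ?_, fun q hq q' hq' h1 h2 => ?_⟩
  · rw [val_createPlus _ (by omega)]; simp
  · rw [hs q hq] at h1 h2 ⊢
    unfold skip
    split_ifs at h1 h2 ⊢ <;> omega
  · rw [hs q hq] at h1
    rw [hs q' hq'] at h2
    split_ifs at h1 h2 <;> try omega
    subst q
    have : Γ.val q' = 0 := by omega
    rw [← this, Γ.val_val]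

/-- The new chord ends at `2 * n + 1`, next to the old base point `2 * n`, so joining these two
points gives back the old base chord. -/
theorem isCap_createMinus (Γ : ChordDiagram n) (hn : 0 < n) : IsCap (2 * n) Γ.createMinus Γ := by
  have hs : ∀ q < 2 * n, Γ.createMinus.val (skip (2 * n) q) = if q = 0 then 2 * n + 1 else
      if Γ.val q = 0 then 2 * n else Γ.val q := by
    intro q hq
    have e : skip (2 * n) q = q := if_pos hq
    rw [val_createMinus _ (by omega), e]
    simp [show q ≠ 2 * n + 1 by omega, show q ≠ 2 * n by omega]
  refine ⟨by omega, ?_, fun q hq h1 h2 => ?_, fun q hq q' hq' h1 h2 => ?_⟩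
  · have := Γ.val_lt (x := 0) (by omega)
    rw [val_createMinus _ (by omega)]
    simp [show n ≠ 0 by omega]
    split_ifs <;> omega
  · have := Γ.val_lt hq
    rw [hs q hq] at h1 h2 ⊢
    unfold skip
    split_ifs at h1 h2 ⊢ <;> omega
  · have := Γ.val_lt hq
    have := Γ.val_lt hq'
    rw [hs q hq] at h1
    rw [hs q' hq'] at h2
    split_ifs at h1 h2 <;> omega

theorem IsCap.createPlus {p : ℕ} {Γ : ChordDiagram n} {Γ' : ChordDiagram (n + 1)}
    (h : IsCap p Γ' Γ) : IsCap (p + 2) Γ'.createPlus Γ.createPlus := by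
  obtain ⟨h0, h1, h2, h3⟩ := h
  have hs : ∀ q < 2 * (n + 1), 2 ≤ q → Γ'.createPlus.val (skip (p + 2) q) =
      Γ'.val (skip p (q - 2)) + 2 := by
    intro q hq hq2
    have e : skip (p + 2) q = skip p (q - 2) + 2 := by
      unfold skip; split_ifs <;> omega
    rw [e, val_createPlus _ (by unfold skip; split_ifs <;> omega), if_neg (by omega),
      Nat.add_sub_cancel]
  have hs' : ∀ q < 2, Γ'.createPlus.val (skip (p + 2) q) = 1 - q := by
    intro q hq
    rw [skip, if_pos (by omega), val_createPlus _ (by omega), if_pos hq]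
  refine ⟨by omega, ?_, fun q hq g1 g2 => ?_, fun q hq q' hq' g1 g2 => ?_⟩
  · rw [val_createPlus _ (by omega)]; simp; omega
  · rw [val_createPlus _ hq]
    rcases Nat.lt_or_ge q 2 with hq2 | hq2
    · rw [hs' q hq2, if_pos hq2, skip, if_pos (by omega)]
    · rw [hs q hq hq2] at g1 g2 ⊢
      rw [if_neg (by omega), h2 (q - 2) (by omega) (by omega) (by omega)]
      unfold skip; split_ifs <;> omega
  · rcases Nat.lt_or_ge q 2 with hq2 | hq2
    · rw [hs' q hq2] at g1; omega
    rcases Nat.lt_or_ge q' 2 with hq2' | hq2'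
    · rw [hs' q' hq2'] at g2; omega
    rw [hs q hq hq2] at g1
    rw [hs q' hq' hq2'] at g2
    rw [val_createPlus _ hq, if_neg (by omega),
      h3 (q - 2) (by omega) (q' - 2) (by omega) (by omega) (by omega)]
    omega

theorem IsCap.createMinus {p : ℕ} {Γ : ChordDiagram n} {Γ' : ChordDiagram (n + 1)}
    (h : IsCap p Γ' Γ) (hp : 1 ≤ p) : IsCap p Γ'.createMinus Γ.createMinus := by
  obtain ⟨h0, h1, h2, h3⟩ := h
  have hz : ∀ q, 0 < q → q < 2 * n + 1 → Γ'.createMinus.val (skip p q) =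
      if Γ'.val (skip p (if q = 2 * n then 0 else q)) = 0 then 2 * (n + 1)
        else Γ'.val (skip p (if q = 2 * n then 0 else q)) := by
    intro q hq hq'
    have e1 : skip p q ≠ 0 := by unfold skip; split_ifs <;> omega
    have e2 : skip p q ≠ 2 * (n + 1) + 1 := by unfold skip; split_ifs <;> omega
    have e3 : (if skip p q = 2 * (n + 1) then 0 else skip p q) =
        skip p (if q = 2 * n then 0 else q) := by
      unfold skip; split_ifs <;> omega
    rw [val_createMinus _ (by unfold skip; split_ifs <;> omega), if_neg e1, if_neg e2, e3]
  have hz0 : Γ'.createMinus.val (skip p 0) = 2 * (n + 1) + 1 := by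
    rw [skip, if_pos (by omega), val_createMinus _ (by omega)]; simp
  have hz1 : Γ'.createMinus.val (skip p (2 * n + 1)) = 0 := by
    rw [skip, if_neg (by omega), val_createMinus _ (by omega)]
    simp; omega
  have hcase : ∀ q < 2 * (n + 1), q = 0 ∨ q = 2 * n + 1 ∨ 0 < q ∧ q < 2 * n + 1 := by omega
  refine ⟨by omega, ?_, fun q hq g1 g2 => ?_, fun q hq q' hq' g1 g2 => ?_⟩
  · rw [val_createMinus _ (by omega)]
    simp only [show p ≠ 0 by omega, show p ≠ 2 * (n + 1) + 1 by omega, if_false,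
      show p ≠ 2 * (n + 1) by omega]
    split_ifs <;> omega
  · rcases hcase q hq with rfl | rfl | ⟨q1, q2⟩
    · rw [hz0, val_createMinus _ (by omega), if_pos rfl, skip, if_neg (by omega)]
      omega
    · rw [hz1, val_createMinus _ (by omega), if_neg (by omega), if_pos rfl, skip,
        if_pos (by omega)]
    · rw [hz q q1 q2] at g1 g2 ⊢
      have q3 : ¬ q = 0 := by omega
      have q4 : ¬ q = 2 * n + 1 := by omega
      simp only [val_createMinus _ hq, q3, q4, if_false]
      have hr : (if q = 2 * n then 0 else q) < 2 * n := by split_ifs <;> omega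
      generalize (if q = 2 * n then 0 else q) = r at g1 g2 hr ⊢
      have h4 := Γ.val_lt hr
      have h5 := h2 r hr (by split_ifs at g1 <;> omega) (by split_ifs at g2 <;> omega)
      rw [h5]
      exact skip_minus hp h0
  · rcases hcase q hq with rfl | rfl | ⟨q1, q2⟩
    · omega
    · omega
    rcases hcase q' hq' with rfl | rfl | ⟨q1', q2'⟩
    · omega
    · omega
    rw [hz q q1 q2] at g1
    rw [hz q' q1' q2'] at g2
    have q3 : ¬ q = 0 := by omega
    have q4 : ¬ q = 2 * n + 1 := by omega
    simp only [val_createMinus _ hq, q3, q4, if_false]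
    have e1 : (if q = 2 * n then 0 else q) < 2 * n := by split_ifs <;> omega
    have e2 : (if q' = 2 * n then 0 else q') < 2 * n := by split_ifs <;> omega
    have g3 : Γ.val (if q = 2 * n then 0 else q) = if q' = 2 * n then 0 else q' := by
      refine h3 _ e1 _ e2 ?_ ?_
      · generalize (if q = 2 * n then 0 else q) = r at g1 ⊢
        split_ifs at g1 <;> omega
      · generalize (if q' = 2 * n then 0 else q') = r at g2 ⊢
        split_ifs at g2 <;> omega
    rw [g3]
    split_ifs <;> omega

end ChordDiagram

open ChordDiagram Word

/-! ### Inserting and removing signs in basis chord diagrams -/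

theorem basisDiagram_plus {n : ℕ} (u : Word n) :
    basisDiagram (Word.cons Sgn.plus u) = (basisDiagram u).createPlus := by
  simp [basisDiagram, create]

theorem basisDiagram_minus {n : ℕ} (u : Word n) :
    basisDiagram (Word.cons Sgn.minus u) = (basisDiagram u).createMinus := by
  simp [basisDiagram, create]

/-- A `+` sign at the front adds the chord `{0, 1}`. Each `+` sign put before it shifts this place
by two, each `-` sign leaves a place other than `0` unchanged; so the place depends on `j` only. -/
theorem isInsert_insertPlus {n : ℕ} (u : Word n) (j : ℕ) (hj : j ≤ u.numPlus) :
    IsInsert (2 * j) (basisDiagram u) (basisDiagram (u.insertPlus j)) := by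
  induction u using consInduction generalizing j with
  | nil w =>
    obtain rfl : j = 0 := by simpa using hj
    rw [insertPlus_zero, basisDiagram_plus]; exact isInsert_createPlus _
  | plus u ih =>
    cases j with
    | zero => rw [insertPlus_zero, basisDiagram_plus (cons _ _)]; exact isInsert_createPlus _
    | succ j =>
      rw [insertPlus_plus, basisDiagram_plus, basisDiagram_plus]
      exact (ih j (by simpa using hj)).createPlus
  | minus u ih =>
    cases j with
    | zero => rw [insertPlus_zero, basisDiagram_plus (cons _ _)]; exact isInsert_createPlus _
    | succ j =>
      rw [insertPlus_minus, basisDiagram_minus, basisDiagram_minus]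
      exact (ih (j + 1) (by simpa using hj)).createMinus (by omega)

/-- The place is counted from the other end of the circle. The induction starts with two adjacent
`-` signs, where `isInsert_createMinus` applies; `+` signs in front increase `n`, and `-` signs in
front increase both `n` and `j`. -/
theorem isInsert_insertMinus {n : ℕ} (u : Word n) (j : ℕ) (hj : j < u.numMinus) :
    IsInsert (2 * n + 1 - 2 * j) (basisDiagram u) (basisDiagram (u.insertMinus (j + 1))) := by
  induction u using consInduction generalizing j with
  | nil w => simp at hj
  | @plus n u ih =>
    rw [insertMinus_plus, basisDiagram_plus, basisDiagram_plus]
    have := (ih j (by simpa using hj)).createPlus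
    have e := numMinus_add_numPlus u
    simp at hj
    rwa [show 2 * n + 1 - 2 * j + 2 = 2 * (n + 1) + 1 - 2 * j by omega] at this
  | @minus n u ih =>
    rw [insertMinus_minus, basisDiagram_minus]
    cases j with
    | zero =>
      rw [insertMinus_zero, basisDiagram_minus, basisDiagram_minus]
      exact isInsert_createMinus _ (by omega)
    | succ j =>
      rw [basisDiagram_minus]
      have e := numMinus_add_numPlus u
      simp at hj
      have := (ih j hj).createMinus (by omega)
      rwa [show 2 * n + 1 - 2 * j = 2 * (n + 1) + 1 - 2 * (j + 1) by omega] at this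

theorem isCap_removePlus {n : ℕ} (w : Word (n + 1)) (j : ℕ) (hj : j < w.numPlus) :
    IsCap (2 * j + 1) (basisDiagram w) (basisDiagram (w.removePlus j)) := by
  induction n generalizing j with
  | zero =>
    rw [← cons_head_tail w] at hj ⊢
    cases hs : w 0 <;> rw [hs] at hj <;> simp at hj
    subst hj
    rw [removePlus_plus_zero, basisDiagram_plus]
    exact isCap_createPlus _ (by omega)
  | succ n ih =>
    rw [← cons_head_tail w] at hj ⊢
    cases hs : w 0 <;> rw [hs] at hj <;> simp at hj
    · rw [removePlus_minus, basisDiagram_minus, basisDiagram_minus]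
      exact (ih _ j hj).createMinus (by omega)
    · cases j with
      | zero =>
        rw [removePlus_plus_zero, basisDiagram_plus]
        exact isCap_createPlus _ (by omega)
      | succ j =>
        rw [removePlus_plus_succ, basisDiagram_plus, basisDiagram_plus]
        exact (ih _ j (by omega)).createPlus

theorem isCap_removeMinus {n : ℕ} (w : Word (n + 1)) (j : ℕ) (hj : j < w.numMinus) :
    IsCap (2 * (n + 1) - 2 * j) (basisDiagram w) (basisDiagram (w.removeMinus j)) := by
  have hle := numMinus_add_numPlus w
  induction n generalizing j with
  | zero =>
    rw [← cons_head_tail w] at hj ⊢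
    cases hs : w 0 <;> rw [hs] at hj <;> simp at hj
    subst hj
    rw [removeMinus_minus_zero, basisDiagram_minus]
    exact isCap_createMinus _ (by omega)
  | succ n ih =>
    have hle' := numMinus_add_numPlus (Fin.tail w)
    rw [← cons_head_tail w] at hj ⊢
    cases hs : w 0 <;> rw [hs] at hj <;> simp at hj
    · cases j with
      | zero =>
        rw [removeMinus_minus_zero, basisDiagram_minus]
        exact isCap_createMinus _ (by omega)
      | succ j =>
        rw [removeMinus_minus_succ, basisDiagram_minus, basisDiagram_minus]
        have := (ih _ j (by omega) hle').createMinus (by omega)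
        rwa [show 2 * (n + 1) - 2 * j = 2 * (n + 1 + 1) - 2 * (j + 1) by omega] at this
    · rw [removeMinus_plus, basisDiagram_plus, basisDiagram_plus]
      have := (ih _ j hj hle').createPlus
      rwa [show 2 * (n + 1) - 2 * j + 2 = 2 * (n + 1 + 1) - 2 * j by omega] at this

/-! ### Operations on bypass systems -/

/-- Betweenness becomes a parity condition. In this form non-separation of two pairs on a circle
does not depend on the point at which the circle is cut open. -/
theorem mem_uIoo_iff_of_ne {α : Type*} [LinearOrder α] {x u v : α} (hu : x ≠ u) (hv : x ≠ v) :
    x ∈ Set.uIoo u v ↔ ¬ (u < x ↔ v < x) := by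
  rcases lt_trichotomy u x with h1 | h1 | h1
  · rcases lt_trichotomy v x with h2 | h2 | h2
    · simp [Set.uIoo, h1, h2, h1.not_gt, h2.not_gt]
    · exact absurd h2.symm hv
    · simp [Set.uIoo, h1, h2, h2.not_gt]
  · exact absurd h1.symm hu
  · rcases lt_trichotomy v x with h2 | h2 | h2
    · simp [Set.uIoo, h1, h2, h1.not_gt]
    · exact absurd h2.symm hv
    · simp [Set.uIoo, h1, h2, h1.not_gt, h2.not_gt]

/-- With `↔` read as addition modulo two, the common summand `k` occurs twice. It cancels the
corrections in `Frame.lt_iff` that come from moving points from the beginning to the end of the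
linear order. -/
theorem iff_parity_cancel (a b l m k : Prop) :
    ((a ↔ (l ↔ k)) ↔ (b ↔ (m ↔ k))) ↔ ((a ↔ b) ↔ (l ↔ m)) := by
  by_cases a <;> by_cases b <;> by_cases l <;> by_cases m <;> by_cases k <;> simp [*]

theorem ChordDiagram.sameRegion_iff {n : ℕ} (Γ : ChordDiagram n) (p q : Fin (2 * n)) :
    Γ.SameRegion p q ↔ ∀ a, (a < p ↔ Γ.partner a < p) ↔ (a < q ↔ Γ.partner a < q) := by
  have key : ∀ a b p q : Fin (2 * n), a < b →
      (((a < p ∧ p ≤ b) ↔ (a < q ∧ q ≤ b)) ↔ ((a < p ↔ b < p) ↔ (a < q ↔ b < q))) := by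
    intro a b p q hab
    simp only [Fin.lt_def, Fin.le_def] at *
    omega
  constructor
  · intro h a
    rcases lt_trichotomy a (Γ.partner a) with ha | ha | ha
    · exact (key _ _ p q ha).1 (h a ha)
    · exact absurd ha.symm (Γ.partner_ne a)
    · have h1 := h (Γ.partner a) (by rwa [Γ.partner_partner])
      rw [Γ.partner_partner] at h1
      rw [iff_comm (a := a < p), iff_comm (a := a < q)]
      exact (key _ _ p q ha).1 h1
  · exact fun h a ha => (key _ _ p q ha).2 (h a)

namespace BypassSystem

variable {n : ℕ} {Γ : ChordDiagram n} {ι : Type}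

/-- The point on the boundary of a region at which the chord side of the end `j` is crossed. -/
def pt (side : ι → Fin 6 → Fin (2 * n)) (pos : ι → Fin 6 → ℚ) (x : ι × Fin 6) :
    Lex (Fin (2 * n) × ℚ) := toLex (side x.1 x.2, pos x.1 x.2)

/-- To check disjointness, it suffices to consider different halves. -/
theorem disjoint_of {side : ι → Fin 6 → Fin (2 * n)} {pos : ι → Fin 6 → ℚ}
    (hinj : ∀ k j k' j', side k j = side k' j' → pos k j = pos k' j' → k = k' ∧ j = j')
    (H : ∀ k k', ∀ h ∈ ({(5, 1), (4, 2)} : Set (Fin 6 × Fin 6)),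
      ∀ h' ∈ ({(5, 1), (4, 2)} : Set (Fin 6 × Fin 6)), (k, h) ≠ (k', h') →
      ((pt side pos (k, h.1) < pt side pos (k', h'.1) ↔
        pt side pos (k, h.2) < pt side pos (k', h'.1)) ↔
      (pt side pos (k, h.1) < pt side pos (k', h'.2) ↔
        pt side pos (k, h.2) < pt side pos (k', h'.2)))) :
    ∀ k k', ∀ h ∈ ({(5, 1), (4, 2)} : Set (Fin 6 × Fin 6)),
    ∀ h' ∈ ({(5, 1), (4, 2)} : Set (Fin 6 × Fin 6)),
      (toLex (side k' h'.1, pos k' h'.1) ∈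
          Set.uIoo (toLex (side k h.1, pos k h.1)) (toLex (side k h.2, pos k h.2)) ↔
        toLex (side k' h'.2, pos k' h'.2) ∈
          Set.uIoo (toLex (side k h.1, pos k h.1)) (toLex (side k h.2, pos k h.2))) := by
  intro k k' h hh h' hh'
  by_cases e : (k, h) = (k', h')
  · obtain ⟨rfl, rfl⟩ := Prod.mk.inj e
    simp [Set.uIoo, and_comm]
  · have hpt : ∀ j j', (k, j) ≠ (k', j') →
        (toLex (side k' j', pos k' j') : Lex (Fin (2 * n) × ℚ)) ≠ toLex (side k j, pos k j) := by
      intro j j' hne heq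
      obtain ⟨e1, e2⟩ := Prod.mk.inj (toLex.injective heq)
      obtain ⟨rfl, rfl⟩ := hinj _ _ _ _ e1 e2
      exact hne rfl
    have hne : ∀ i ∈ ({h.1, h.2} : Set (Fin 6)), ∀ i' ∈ ({h'.1, h'.2} : Set (Fin 6)),
        (k, i) ≠ (k', i') := by
      intro i hi i' hi' heq
      obtain ⟨rfl, rfl⟩ := Prod.mk.inj heq
      simp only [Set.mem_insert_iff, Set.mem_singleton_iff] at hh hh' hi hi'
      rcases hh with rfl | rfl <;> rcases hh' with rfl | rfl <;>
        simp_all <;> rcases hi with rfl | rfl <;> revert hi' <;> decide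
    rw [mem_uIoo_iff_of_ne (hpt _ _ (hne _ (by simp) _ (by simp)))
        (hpt _ _ (hne _ (by simp) _ (by simp))),
      mem_uIoo_iff_of_ne (hpt _ _ (hne _ (by simp) _ (by simp)))
        (hpt _ _ (hne _ (by simp) _ (by simp)))]
    exact not_congr (H k k' h hh h' hh' e)

theorem pt_separates (F : BypassSystem Γ ι) (k k' : ι) {h h' : Fin 6 × Fin 6}
    (hh : h ∈ ({(5, 1), (4, 2)} : Set (Fin 6 × Fin 6)))
    (hh' : h' ∈ ({(5, 1), (4, 2)} : Set (Fin 6 × Fin 6))) (hne : (k, h) ≠ (k', h')) :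
    ((pt F.side F.pos (k, h.1) < pt F.side F.pos (k', h'.1) ↔
        pt F.side F.pos (k, h.2) < pt F.side F.pos (k', h'.1)) ↔
      (pt F.side F.pos (k, h.1) < pt F.side F.pos (k', h'.2) ↔
        pt F.side F.pos (k, h.2) < pt F.side F.pos (k', h'.2))) := by
  have hpt : ∀ j j', (k, j) ≠ (k', j') →
      (toLex (F.side k' j', F.pos k' j') : Lex (Fin (2 * n) × ℚ)) ≠
        toLex (F.side k j, F.pos k j) := by
    intro j j' hne heq
    obtain ⟨e1, e2⟩ := Prod.mk.inj (toLex.injective heq)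
    obtain ⟨rfl, rfl⟩ := F.injective _ _ _ _ e1 e2
    exact hne rfl
  have hne : ∀ i ∈ ({h.1, h.2} : Set (Fin 6)), ∀ i' ∈ ({h'.1, h'.2} : Set (Fin 6)),
      (k, i) ≠ (k', i') := by
    intro i hi i' hi' heq
    obtain ⟨rfl, rfl⟩ := Prod.mk.inj heq
    simp only [Set.mem_insert_iff, Set.mem_singleton_iff] at hh hh' hi hi'
    rcases hh with rfl | rfl <;> rcases hh' with rfl | rfl <;>
      simp_all <;> rcases hi with rfl | rfl <;> revert hi' <;> decide
  have := F.disjoint k k' h hh h' hh'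
  rw [mem_uIoo_iff_of_ne (hpt _ _ (hne _ (by simp) _ (by simp)))
        (hpt _ _ (hne _ (by simp) _ (by simp))),
      mem_uIoo_iff_of_ne (hpt _ _ (hne _ (by simp) _ (by simp)))
        (hpt _ _ (hne _ (by simp) _ (by simp)))] at this
  exact not_iff_not.1 this

/-- The bypass system without arcs. -/
def empty (Γ : ChordDiagram n) : BypassSystem Γ Empty where
  side k := k.elim
  pos k := k.elim
  side_rev k := k.elim
  pos_rev k := k.elim
  injective k := k.elim
  left_region k := k.elim
  right_region k := k.elim
  disjoint k := k.elim

theorem empty_gives (Γ : ChordDiagram n) (d : Direction) : (empty Γ).Gives d Γ :=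
  ⟨fun p => Relation.EqvGen.rel _ _ (Link.chord p fun k => k.elim), fun k => k.elim⟩

/-- Change of the index set of a bypass system. -/
def reindex {ι' : Type} (F : BypassSystem Γ ι) (e : ι' ≃ ι) : BypassSystem Γ ι' where
  side k := F.side (e k)
  pos k := F.pos (e k)
  side_rev k := F.side_rev (e k)
  pos_rev k := F.pos_rev (e k)
  injective k j k' j' h1 h2 := by
    obtain ⟨h, h'⟩ := F.injective _ _ _ _ h1 h2
    exact ⟨e.injective h, h'⟩
  left_region k := F.left_region (e k)
  right_region k := F.right_region (e k)
  disjoint k k' := F.disjoint (e k) (e k')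

theorem eqvGen_map {α β : Type*} {r : α → α → Prop} {s : β → β → Prop} (f : α → β)
    (h : ∀ x y, r x y → Relation.EqvGen s (f x) (f y)) {x y : α} (hxy : Relation.EqvGen r x y) :
    Relation.EqvGen s (f x) (f y) := by
  induction hxy with
  | rel x y hr => exact h x y hr
  | refl x => exact Relation.EqvGen.refl _
  | symm x y _ ih => exact ih.symm
  | trans x y z _ _ ih1 ih2 => exact ih1.trans _ _ _ ih2

theorem Gives.reindex {ι' : Type} {F : BypassSystem Γ ι} {d : Direction} {A : ChordDiagram n}
    (h : F.Gives d A) (e : ι' ≃ ι) : (F.reindex e).Gives d A := by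
  obtain ⟨h1, h2⟩ := h
  have key : ∀ x y, F.Link d x y → Relation.EqvGen ((F.reindex e).Link d)
      (Sum.map id (Prod.map e.symm id) x) (Sum.map id (Prod.map e.symm id) y) := by
    intro x y hxy
    apply Relation.EqvGen.rel
    cases hxy with
    | chord p h => exact Link.chord p fun k j => h (e k) j
    | first k j h =>
      have := Link.first (F := F.reindex e) (d := d) (e.symm k) j
        (fun k' j' h' => by
          simp only [BypassSystem.reindex, Equiv.apply_symm_apply] at h' ⊢
          exact h _ _ h')
      simpa [BypassSystem.reindex] using this
    | between k j k' j' hs hlt h =>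
      have := Link.between (F := F.reindex e) (d := d) (e.symm k) j (e.symm k') j'
        (by simpa [BypassSystem.reindex] using hs) (by simpa [BypassSystem.reindex] using hlt)
        (fun l i h' => by
          simp only [BypassSystem.reindex, Equiv.apply_symm_apply] at h' ⊢
          exact h _ _ h')
      simpa using this
    | glue k j => exact Link.glue _ j
  refine ⟨fun p => eqvGen_map _ key (h1 p), fun k j => ?_⟩
  obtain ⟨p, hp⟩ := h2 (e k) j
  exact ⟨p, by simpa using eqvGen_map _ key hp⟩

end BypassSystem

/-- There is a bypass system on `Γ`, indexed by `ι`, from which upwards surgery gives `U` and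
downwards surgery gives `D`. -/
def Surgery {n : ℕ} (ι : Type) (Γ U D : ChordDiagram n) : Prop :=
  ∃ F : BypassSystem Γ ι, F.Gives Direction.up U ∧ F.Gives Direction.down D

theorem Surgery.empty {n : ℕ} (Γ : ChordDiagram n) : Surgery Empty Γ Γ Γ :=
  ⟨BypassSystem.empty Γ, BypassSystem.empty_gives Γ _, BypassSystem.empty_gives Γ _⟩

theorem Surgery.reindex {n : ℕ} {ι ι' : Type} {Γ U D : ChordDiagram n} (h : Surgery ι Γ U D)
    (e : ι' ≃ ι) : Surgery ι' Γ U D := by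
  obtain ⟨F, h1, h2⟩ := h
  exact ⟨F.reindex e, h1.reindex e, h2.reindex e⟩

/-! ### Insertion of an outermost chord -/

/-- A relabelling of marked points under the insertion of two points `a`, `b`, next to each other on
the circle. It preserves the cyclic order; the points `x` with `m x` are moved from the beginning
to the end of the linear order. -/
structure Frame (n : ℕ) where
  map : Fin (2 * n) → Fin (2 * (n + 1))
  a : Fin (2 * (n + 1))
  b : Fin (2 * (n + 1))
  inj : Function.Injective map
  map_ne_a : ∀ x, map x ≠ a
  map_ne_b : ∀ x, map x ≠ b
  a_ne_b : a ≠ b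
  cover : ∀ y, y = a ∨ y = b ∨ ∃ x, map x = y
  m : Fin (2 * n) → Prop
  lt_iff : ∀ x y, x ≠ y → (map x < map y ↔ (x < y ↔ (m x ↔ m y)))
  adj : ∀ x y, (a < map x ↔ b < map x) ↔ (a < map y ↔ b < map y)
  mod_two : ∀ x, (map x).val % 2 = x.val % 2
  ab_mod_two : a.val % 2 ≠ b.val % 2

namespace Frame

variable {n : ℕ}

/-- `Γ'` is obtained from `Γ` by inserting an outermost chord. -/
def Inserts (φ : Frame n) (Γ : ChordDiagram n) (Γ' : ChordDiagram (n + 1)) : Prop :=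
  Γ'.partner φ.a = φ.b ∧ ∀ q, Γ'.partner (φ.map q) = φ.map (Γ.partner q)

/-- Insertion of the points `p`, `p + 1`. -/
def skipAt (p : ℕ) (hp : p ≤ 2 * n) : Frame n where
  map q := ⟨skip p q, by have := q.isLt; unfold skip; split_ifs <;> omega⟩
  a := ⟨p, by omega⟩
  b := ⟨p + 1, by omega⟩
  inj x y h := by
    have := congrArg Fin.val h
    ext
    simp only [skip] at this
    split_ifs at this <;> omega
  map_ne_a x := by simp only [ne_eq, Fin.ext_iff, skip]; split_ifs <;> omega
  map_ne_b x := by simp only [ne_eq, Fin.ext_iff, skip]; split_ifs <;> omega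
  a_ne_b := by simp
  cover y := by
    have := y.isLt
    simp only [Fin.ext_iff]
    by_cases h1 : y.val < p
    · exact Or.inr (Or.inr ⟨⟨y, by omega⟩, by simp [skip, h1]⟩)
    · by_cases h2 : y.val ≤ p + 1
      · omega
      · exact Or.inr (Or.inr ⟨⟨y - 2, by omega⟩, by simp only [skip]; rw [if_neg] <;> omega⟩)
  m _ := False
  lt_iff x y h := by
    simp only [Fin.lt_def, skip, iff_self, iff_true]
    split_ifs <;> omega
  adj x y := by
    simp only [Fin.lt_def, skip]
    split_ifs <;> omega
  mod_two x := by simp only [skip]; split_ifs <;> omega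
  ab_mod_two := by simp only; omega

/-- The insertion of points given by `minusNew`. -/
def minus (n : ℕ) : Frame n where
  map := minusNew
  a := ⟨0, by omega⟩
  b := ⟨2 * n + 1, by omega⟩
  inj x y h := by
    have hv := congrArg Fin.val h
    have := x.isLt
    have := y.isLt
    ext
    simp only [minusNew] at hv
    split_ifs at hv <;> omega
  map_ne_a x h := minusNew_ne x (Or.inl (congrArg Fin.val h))
  map_ne_b x h := minusNew_ne x (Or.inr (congrArg Fin.val h))
  a_ne_b := by simp
  cover y := by
    by_cases h : y.val = 0 ∨ y.val = 2 * n + 1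
    · simp only [Fin.ext_iff]; omega
    · exact Or.inr (Or.inr ⟨_, minusNew_minusOld y h⟩)
  m x := x.val = 0
  lt_iff x y h := by
    have := x.isLt
    have := y.isLt
    simp only [ne_eq, Fin.ext_iff] at h
    simp only [Fin.lt_def, minusNew]
    split_ifs <;> omega
  adj x y := by
    have := x.isLt
    have := y.isLt
    simp only [Fin.lt_def, minusNew]
    split_ifs <;> omega
  mod_two x := by simp only [minusNew]; split_ifs <;> omega
  ab_mod_two := by simp only; omega

theorem skipAt_inserts {p : ℕ} {Γ : ChordDiagram n} {Γ' : ChordDiagram (n + 1)}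
    (h : IsInsert p Γ Γ') : (skipAt p h.1).Inserts Γ Γ' := by
  obtain ⟨h0, h1, h2, h3⟩ := h
  constructor
  · ext
    simp only [skipAt]
    rw [← Γ'.val_fin, h1]
  · intro q
    ext
    simp only [skipAt]
    rw [← Γ'.val_fin, ← Γ.val_fin, h3 _ q.isLt]

theorem minus_inserts (Γ : ChordDiagram n) : (minus n).Inserts Γ Γ.createMinus := by
  constructor
  · ext; simp [minus, createMinus]
  · intro q
    simp only [minus, createMinus]
    rw [dif_neg (minusNew_ne q), minusOld_minusNew]

variable (φ : Frame n) {Γ : ChordDiagram n} {Γ' : ChordDiagram (n + 1)}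

theorem sameRegion {φ : Frame n} (h : φ.Inserts Γ Γ') {p q : Fin (2 * n)}
    (hpq : Γ.SameRegion p q) :
    Γ'.SameRegion (φ.map p) (φ.map q) := by
  rw [ChordDiagram.sameRegion_iff] at hpq ⊢
  intro c
  have hb : Γ'.partner φ.b = φ.a := by rw [← h.1, Γ'.partner_partner]
  rcases φ.cover c with rfl | rfl | ⟨x, rfl⟩
  · rw [h.1]; exact φ.adj p q
  · rw [hb, iff_comm (a := φ.b < _), iff_comm (a := φ.b < _)]; exact φ.adj p q
  · rw [h.2]
    have hx := (Γ.partner_ne x)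
    -- The correction on the right does not depend on `s`. If `s` is an end of the chord, `lt_iff`
    -- is not available for the equal pair, but both comparisons in that pair are false.
    have key : ∀ s, ((φ.map x < φ.map s ↔ φ.map (Γ.partner x) < φ.map s) ↔
        ((x < s ↔ Γ.partner x < s) ↔ (φ.m x ↔ φ.m (Γ.partner x)))) := by
      intro s
      by_cases e1 : x = s
      · subst e1
        rw [φ.lt_iff _ _ hx]
        simp only [lt_irrefl]
        by_cases Γ.partner x < x <;> by_cases φ.m x <;> by_cases φ.m (Γ.partner x) <;> simp [*]
      · by_cases e2 : Γ.partner x = s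
        · subst e2
          rw [φ.lt_iff _ _ hx.symm]
          simp only [lt_irrefl]
          by_cases x < Γ.partner x <;> by_cases φ.m x <;> by_cases φ.m (Γ.partner x) <;> simp [*]
        · rw [φ.lt_iff _ _ e1, φ.lt_iff _ _ e2, iff_parity_cancel]
    rw [key, key, hpq x]

end Frame

namespace BypassSystem

variable {n : ℕ} {Γ : ChordDiagram n} {Γ' : ChordDiagram (n + 1)} {ι : Type} {φ : Frame n}

theorem injective_insert (F : BypassSystem Γ ι) (φ : Frame n) (k : ι) (j : Fin 6) (k' : ι)
    (j' : Fin 6) (h1 : φ.map (F.side k j) = φ.map (F.side k' j'))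
    (h2 : F.pos k j = F.pos k' j') : k = k' ∧ j = j' :=
  F.injective _ _ _ _ (φ.inj h1) h2

/-- A bypass system after the insertion of an outermost chord. -/
def insert (F : BypassSystem Γ ι) (h : φ.Inserts Γ Γ') : BypassSystem Γ' ι where
  side k j := φ.map (F.side k j)
  pos := F.pos
  side_rev k j := by rw [F.side_rev, h.2]
  pos_rev := F.pos_rev
  injective := F.injective_insert φ
  left_region k := Frame.sameRegion h (F.left_region k)
  right_region k := Frame.sameRegion h (F.right_region k)
  disjoint := by
    apply disjoint_of (side := fun k j => φ.map (F.side k j)) (F.injective_insert φ)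
    intro k k' h hh h' hh' hne
    have := F.pt_separates k k' hh hh' hne
    -- Positions matter only for points on the same side, which carry the same mark; for different
    -- sides the comparison changes as for marked points.
    have key : ∀ x y : ι × Fin 6, (pt (fun k j => φ.map (F.side k j)) F.pos x <
        pt (fun k j => φ.map (F.side k j)) F.pos y ↔
        (pt F.side F.pos x < pt F.side F.pos y ↔
          (φ.m (F.side x.1 x.2) ↔ φ.m (F.side y.1 y.2)))) := by
      intro x y
      unfold pt
      rw [Prod.Lex.toLex_lt_toLex, Prod.Lex.toLex_lt_toLex]
      by_cases e : F.side x.1 x.2 = F.side y.1 y.2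
      · simp [e]
      · have := φ.lt_iff _ _ e
        have e' : φ.map (F.side x.1 x.2) ≠ φ.map (F.side y.1 y.2) := fun h => e (φ.inj h)
        simp only [e, e', false_and, or_false, this]
    rw [key, key, key, key, iff_parity_cancel, iff_parity_cancel, this]

theorem Gives.insert {F : BypassSystem Γ ι} (h : φ.Inserts Γ Γ') {d : Direction}
    {A : ChordDiagram n} {A' : ChordDiagram (n + 1)} (hA : F.Gives d A) (h' : φ.Inserts A A') :
    (F.insert h).Gives d A' := by
  obtain ⟨h1, h2⟩ := hA
  have key : ∀ x y, F.Link d x y → Relation.EqvGen ((F.insert h).Link d)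
      (Sum.map φ.map id x) (Sum.map φ.map id y) := by
    intro x y hxy
    apply Relation.EqvGen.rel
    cases hxy with
    | chord p hp =>
      have := Link.chord (F := F.insert h) (d := d) (φ.map p) fun k j e => hp k j (φ.inj e)
      rwa [h.2] at this
    | first k j hf =>
      exact Link.first (F := F.insert h) (d := d) k j fun k' j' e => hf k' j' (φ.inj e)
    | between k j k' j' hs hlt hf =>
      exact Link.between (F := F.insert h) (d := d) k j k' j' (congrArg φ.map hs) hlt
        fun l i e => hf l i (φ.inj e)
    | glue k j => exact Link.glue k j
  have hab : Relation.EqvGen ((F.insert h).Link d) (Sum.inl φ.a) (Sum.inl φ.b) := by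
    have := Link.chord (F := F.insert h) (d := d) φ.a fun k j e => φ.map_ne_a _ e
    rw [h.1] at this
    exact .rel _ _ this
  refine ⟨fun p => ?_, fun k j => ?_⟩
  · rcases φ.cover p with rfl | rfl | ⟨x, rfl⟩
    · rw [h'.1]; exact hab
    · rw [← h'.1, A'.partner_partner, h'.1]; exact hab.symm
    · rw [h'.2]; exact eqvGen_map _ key (h1 x)
  · obtain ⟨p, hp⟩ := h2 k j
    exact ⟨_, eqvGen_map _ key hp⟩

end BypassSystem

theorem Surgery.insert {n : ℕ} {ι : Type} {Γ U D : ChordDiagram n} {Γ' U' D' : ChordDiagram (n + 1)}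
    (h : Surgery ι Γ U D) (φ : Frame n) (h1 : φ.Inserts Γ Γ') (h2 : φ.Inserts U U')
    (h3 : φ.Inserts D D') : Surgery ι Γ' U' D' := by
  obtain ⟨F, hU, hD⟩ := h
  exact ⟨F.insert h1, hU.insert h1 h2, hD.insert h1 h3⟩

/-! ### Arcs of attachment parallel to the boundary -/

namespace ChordDiagram

variable {n : ℕ}

/-- `q` is the next marked point after `p`, clockwise. -/
def Consec (p q : Fin (2 * n)) : Prop :=
  q.val = p.val + 1 ∨ p.val + 1 = 2 * n ∧ q.val = 0

theorem partner_eq_iff (Γ : ChordDiagram n) {p q : Fin (2 * n)} :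
    Γ.partner p = q ↔ Γ.partner q = p :=
  ⟨fun h => by rw [← h, Γ.partner_partner], fun h => by rw [← h, Γ.partner_partner]⟩

/-- The clockwise boundary of a region follows the boundary arc that ends at `Γ.partner p`, then the
chord to `p`, then the boundary arc from `p` to `q`. Hence a short arc along the boundary is an
admissible half of an arc of attachment. -/
theorem Consec.sameRegion {p q : Fin (2 * n)} (h : Consec p q) (Γ : ChordDiagram n) :
    Γ.SameRegion (Γ.partner p) q := by
  intro c hc
  have e1 := Γ.noncrossing c p
  have e2 := Γ.noncrossing c (Γ.partner p)
  have e3 := Γ.noncrossing (Γ.partner p) c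
  have e4 := Γ.noncrossing p c
  have e5 := Γ.partner_ne p
  have e6 : Γ.partner p = Γ.partner c → p = c := fun h => Γ.partner_injective h
  have e7 : Γ.partner p = c → Γ.partner c = p := fun h => Γ.partner_eq_iff.1 h
  have e8 : c = p → Γ.partner c = Γ.partner p := congrArg _
  have l1 := (Γ.partner p).isLt
  have l2 := (Γ.partner c).isLt
  have l3 := p.isLt
  rw [Γ.partner_partner] at e2 e3
  simp only [Consec, Fin.lt_def, Fin.le_def, Fin.ext_iff, ne_eq] at *
  omega

/-- The six ends of the chords at three marked points, the chords being disjoint and numbered like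
the strands in the neighbourhood of an arc of attachment. -/
def ends (A : ChordDiagram n) (P : Fin 3 → Fin (2 * n)) : Fin 6 → Fin (2 * n) :=
  ![P 0, P 1, P 2, A.partner (P 2), A.partner (P 1), A.partner (P 0)]

theorem ends_rev (A : ChordDiagram n) (P : Fin 3 → Fin (2 * n)) (j : Fin 6) :
    A.ends P j.rev = A.partner (A.ends P j) := by
  fin_cases j <;> simp [ends, Fin.rev, A.partner_partner]

theorem ends_castAdd (A : ChordDiagram n) (P : Fin 3 → Fin (2 * n)) (i : Fin 3) :
    A.ends P (Fin.castAdd 3 i) = P i := by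
  fin_cases i <;> rfl

theorem exists_castAdd (j : Fin 6) :
    ∃ i : Fin 3, j = Fin.castAdd 3 i ∨ j = (Fin.castAdd 3 i : Fin 6).rev := by
  revert j; decide

/-- `A'` is obtained from `A` by surgery along an arc of attachment across the chords at the
points `P i`, which are pairwise different. -/
def IsCollar (d : Direction) (P : Fin 3 → Fin (2 * n)) (A A' : ChordDiagram n) : Prop :=
  (∀ j, A'.partner (A.ends P j) = A.ends P (d.glue j)) ∧
    ∀ q, (∀ j, A.ends P j ≠ q) → A'.partner q = A.partner q

/-- The points `P i` are consecutive. -/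
def IsCollarArc (P : Fin 3 → Fin (2 * n)) : Prop :=
  Function.Injective P ∧ Consec (P 0) (P 1) ∧ Consec (P 1) (P 2)

end ChordDiagram

namespace BypassSystem

variable {n : ℕ} {Γ : ChordDiagram n} {ι : Type}

/-- The positions of the ends of an arc near the boundary. -/
def collarPos (L : ℚ) : Fin 6 → ℚ := ![-L, -L, -L, L, L, L]

theorem collarPos_rev (L : ℚ) (j : Fin 6) : collarPos L j.rev = - collarPos L j := by
  fin_cases j <;> simp [collarPos, Fin.rev]

theorem collarPos_castAdd (L : ℚ) (i : Fin 3) : collarPos L (Fin.castAdd 3 i) = -L := by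
  fin_cases i <;> rfl

theorem collarPos_castAdd_rev (L : ℚ) (i : Fin 3) :
    collarPos L (Fin.castAdd 3 i : Fin 6).rev = L := by
  rw [collarPos_rev, collarPos_castAdd, neg_neg]

theorem collar_halves {P : Fin 3 → Fin (2 * n)} (hP : IsCollarArc P)
    {h : Fin 6 × Fin 6}
    (hh : h ∈ ({(5, 1), (4, 2)} : Set (Fin 6 × Fin 6))) :
    ∃ i : Fin 3, ∃ i' : Fin 3, h = ((Fin.castAdd 3 i : Fin 6).rev, Fin.castAdd 3 i') ∧
      i.val + 1 = i'.val ∧ Consec (P i) (P i') := by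
  simp only [Set.mem_insert_iff, Set.mem_singleton_iff] at hh
  rcases hh with rfl | rfl
  · exact ⟨0, 1, rfl, rfl, hP.2.1⟩
  · exact ⟨1, 2, rfl, rfl, hP.2.2⟩

theorem half_sameRegion (F : BypassSystem Γ ι) (k : ι) {h : Fin 6 × Fin 6}
    (hh : h ∈ ({(5, 1), (4, 2)} : Set (Fin 6 × Fin 6))) :
    Γ.SameRegion (F.side k h.1) (F.side k h.2) := by
  simp only [Set.mem_insert_iff, Set.mem_singleton_iff] at hh
  rcases hh with rfl | rfl
  · exact F.left_region k
  · exact F.right_region k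

theorem collar_injective (F : BypassSystem Γ ι) {P : Fin 3 → Fin (2 * n)} (hP : IsCollarArc P)
    {L : ℚ} (hL : 0 < L) (hF : ∀ k j, |F.pos k j| < L) (k : Option ι) (j : Fin 6)
    (k' : Option ι) (j' : Fin 6)
    (h1 : k.elim (Γ.ends P) F.side j = k'.elim (Γ.ends P) F.side j')
    (h2 : k.elim (collarPos L) F.pos j = k'.elim (collarPos L) F.pos j') : k = k' ∧ j = j' := by
  have hpos : ∀ j, collarPos L j = L ∨ collarPos L j = -L := by
    intro j
    obtain ⟨i, rfl | rfl⟩ := exists_castAdd j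
    · exact Or.inr (collarPos_castAdd L i)
    · exact Or.inl (collarPos_castAdd_rev L i)
  have hne : ∀ k j j', collarPos L j ≠ F.pos k j' := by
    intro k j j' h
    have := abs_lt.1 (hF k j')
    rcases hpos j with h' | h' <;> linarith
  cases k with
  | none =>
    cases k' with
    | none =>
      refine ⟨rfl, ?_⟩
      simp only [Option.elim] at h1 h2
      obtain ⟨i, rfl | rfl⟩ := exists_castAdd j <;> obtain ⟨i', rfl | rfl⟩ := exists_castAdd j'
      · rw [ends_castAdd, ends_castAdd] at h1
        rw [hP.1 h1]
      · rw [collarPos_castAdd, collarPos_castAdd_rev] at h2; linarith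
      · rw [collarPos_castAdd, collarPos_castAdd_rev] at h2; linarith
      · rw [ends_rev, ends_rev, ends_castAdd, ends_castAdd] at h1
        rw [hP.1 (Γ.partner_injective h1)]
    | some k' => exact absurd h2 (hne _ _ _)
  | some k =>
    cases k' with
    | none => exact absurd h2.symm (hne _ _ _)
    | some k' =>
      obtain ⟨rfl, rfl⟩ := F.injective _ _ _ _ h1 h2
      exact ⟨rfl, rfl⟩

/-- Addition of an arc of attachment close to the boundary, near the points `P i`. -/
def collar (F : BypassSystem Γ ι) {P : Fin 3 → Fin (2 * n)} (hP : IsCollarArc P)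
    {L : ℚ} (hL : 0 < L) (hF : ∀ k j, |F.pos k j| < L) : BypassSystem Γ (Option ι) where
  side k := k.elim (Γ.ends P) F.side
  pos k := k.elim (collarPos L) F.pos
  side_rev k := by
    cases k with
    | none => exact Γ.ends_rev P
    | some k => exact F.side_rev k
  pos_rev k := by
    cases k with
    | none => exact collarPos_rev L
    | some k => exact F.pos_rev k
  injective := F.collar_injective hP hL hF
  left_region k := by
    cases k with
    | none => exact hP.2.1.sameRegion Γ
    | some k => exact F.left_region k
  right_region k := by
    cases k with
    | none => exact hP.2.2.sameRegion Γ
    | some k => exact F.right_region k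
  disjoint := by
    apply disjoint_of (F.collar_injective hP hL hF)
    intro k k' h hh h' hh' hne
    have hF1 : ∀ k j, -L < F.pos k j := fun k j => (abs_lt.1 (hF k j)).1
    have hF2 : ∀ k j, F.pos k j < L := fun k j => (abs_lt.1 (hF k j)).2
    have hL' : -L < L := by linarith
    -- The positions `±L` are extremal, so lexicographic comparisons with a collar end reduce to
    -- comparisons of marked points. What remains is that a chord does not separate the two ends of
    -- a half lying in one region.
    cases k with
    | none =>
      obtain ⟨i, i', rfl, hi, hc⟩ := collar_halves hP hh
      cases k' with
      | none =>
        obtain ⟨l, l', rfl, hl, hc'⟩ := collar_halves hP hh'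
        have h1 : P i' ≠ P l' := by
          intro e
          have e1 := hP.1 e
          have e2 : i = l := by ext; subst e1; omega
          subst e1 e2
          exact hne rfl
        have h2 := (Γ.sameRegion_iff _ _).1 (hc'.sameRegion Γ) (P i)
        have h3 := (Γ.partner (P l)).isLt
        have h4 := (P l').isLt
        simp only [pt, Option.elim, ends_rev, ends_castAdd, collarPos_castAdd,
          collarPos_castAdd_rev, Prod.Lex.toLex_lt_toLex, lt_irrefl, hL', hL'.not_gt, and_true,
          and_false, or_false]
        simp only [Consec, Fin.lt_def, Fin.ext_iff, ne_eq] at *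
        omega
      | some k' =>
        have h2 := (Γ.sameRegion_iff _ _).1 (F.half_sameRegion k' hh') (P i)
        have h3 := (F.side k' h'.1).isLt
        have h4 := (F.side k' h'.2).isLt
        simp only [pt, Option.elim, ends_rev, ends_castAdd, collarPos_castAdd,
          collarPos_castAdd_rev, Prod.Lex.toLex_lt_toLex, hF1, (hF2 _ _).not_gt, and_true,
          and_false, or_false]
        clear hF hF1 hF2 hne
        simp only [Consec, Fin.lt_def, Fin.ext_iff] at *
        omega
    | some k =>
      cases k' with
      | none =>
        obtain ⟨i, i', rfl, hi, hc⟩ := collar_halves hP hh'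
        have h2 := (Γ.sameRegion_iff _ _).1 (F.half_sameRegion k hh) (P i)
        have h3 := (F.side k h.1).isLt
        have h4 := (F.side k h.2).isLt
        simp only [pt, Option.elim, ends_rev, ends_castAdd, collarPos_castAdd,
          collarPos_castAdd_rev, Prod.Lex.toLex_lt_toLex, hF2, (hF1 _ _).not_gt, and_true,
          and_false, or_false]
        clear hF hF1 hF2 hne
        simp only [Consec, Fin.lt_def, Fin.ext_iff] at *
        omega
      | some k' =>
        exact F.pt_separates k k' hh hh' fun e => hne (by
          obtain ⟨rfl, rfl⟩ := Prod.mk.inj e; rfl)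

/-- Near the boundary the new arc is not affected by the other surgeries: it meets the chords of `A`
right at the points `P i`. So surgery along all arcs is surgery on `A` along the new arc, provided
that it meets three different chords of `A`. -/
theorem Gives.collar {F : BypassSystem Γ ι} {P : Fin 3 → Fin (2 * n)} (hP : IsCollarArc P)
    {L : ℚ} (hL : 0 < L) (hF : ∀ k j, |F.pos k j| < L) {d : Direction} {A A' : ChordDiagram n}
    (hA : F.Gives d A) (hgen : Function.Injective (A.ends P)) (hA' : IsCollar d P A A') :
    (F.collar hP hL hF).Gives d A' := by
  set G := F.collar hP hL hF with hG
  have hF1 : ∀ k j, -L < F.pos k j := fun k j => (abs_lt.1 (hF k j)).1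
  have hF2 : ∀ k j, F.pos k j < L := fun k j => (abs_lt.1 (hF k j)).2
  have hL' : -L < L := by linarith
  let c : Fin 3 → Fin 6 := Fin.castAdd 3
  have sc : ∀ i, G.side none (c i) = P i := Γ.ends_castAdd P
  have sr : ∀ i, G.side none (c i).rev = Γ.partner (P i) := fun i => by
    rw [G.side_rev, sc]
  have ss : ∀ k j, G.side (some k) j = F.side k j := fun _ _ => rfl
  have pc : ∀ i, G.pos none (c i) = -L := collarPos_castAdd L
  have pr : ∀ i, G.pos none (c i).rev = L := collarPos_castAdd_rev L
  have ps : ∀ k j, G.pos (some k) j = F.pos k j := fun _ _ => rfl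
  have pn : ∀ j, G.pos none j = -L ∨ G.pos none j = L := by
    intro j
    obtain ⟨i, rfl | rfl⟩ := exists_castAdd j
    · exact Or.inl (pc i)
    · exact Or.inr (pr i)
  have plow : ∀ k j, -L ≤ G.pos k j := by
    rintro (_ | k) j
    · rcases pn j with h | h <;> rw [h]; exact hL'.le
    · exact (hF1 k j).le
  -- crossings seen from a point that is not one of the `P i`
  have pout : ∀ q, (∀ i, P i ≠ q) → ∀ j, G.side none j = q → G.pos none j = L := by
    intro q hq j hj
    obtain ⟨i, rfl | rfl⟩ := exists_castAdd j
    · exact absurd ((sc i).symm.trans hj) (hq i)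
    · exact pr i
  -- A curve that started at `P i` now starts at the inner end of the collar strand there; all other
  -- marked points keep their role.
  let ψl : Fin (2 * n) → Fin (2 * n) ⊕ Option ι × Fin 6 :=
    Function.extend P (fun i => Sum.inr (none, (c i).rev)) Sum.inl
  have ψP : ∀ i, ψl (P i) = Sum.inr (none, (c i).rev) := fun i => hP.1.extend_apply _ _ i
  have ψo : ∀ q, (∀ i, P i ≠ q) → ψl q = Sum.inl q := fun q hq =>
    Function.extend_apply' _ _ _ fun ⟨i, hi⟩ => hq i hi
  -- A chord of `Γ` met by no old arc and by the new arc near one of its ends only.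
  have mixed : ∀ q i, P i = q → (∀ k j, F.side k j ≠ q) → (∀ i', P i' ≠ Γ.partner q) →
      Relation.EqvGen (G.Link d) (ψl q) (ψl (Γ.partner q)) := by
    rintro q i rfl hq hi'
    rw [ψP, ψo _ hi']
    have := Link.first (F := G) (d := d) none (c i).rev (by
      rw [sr, pr]
      rintro (_ | k) j hj
      · rw [pout _ hi' j hj]
      · exact absurd (by rw [← ss, G.side_rev, hj, Γ.partner_partner]) (hq k j.rev))
    rw [sr] at this
    exact (Relation.EqvGen.rel _ _ this).symm
  have key : ∀ x y, F.Link d x y → Relation.EqvGen (G.Link d)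
      (Sum.elim ψl (fun z => Sum.inr (some z.1, z.2)) x)
      (Sum.elim ψl (fun z => Sum.inr (some z.1, z.2)) y) := by
    intro x y hxy
    cases hxy with
    | chord q hq =>
      have hq' : ∀ k j, F.side k j ≠ Γ.partner q := fun k j e =>
        hq k j.rev (by rw [F.side_rev, e, Γ.partner_partner])
      show Relation.EqvGen (G.Link d) (ψl q) (ψl (Γ.partner q))
      by_cases h1 : ∃ i, P i = q
      · obtain ⟨i, hi⟩ := h1
        by_cases h2 : ∃ i', P i' = Γ.partner q
        · obtain ⟨i', hi'⟩ := h2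
          rw [← hi', ← hi, ψP, ψP]
          apply Relation.EqvGen.rel
          refine Link.between none (c i) none (c i').rev ?_ ?_ ?_
          · rw [sc, sr, hi', Γ.partner_partner, hi]
          · rw [pc, pr]; exact hL'
          · rw [sc, pc, pr]
            rintro (_ | l) j hj ⟨e1, e2⟩
            · rcases pn j with h | h
              · rw [h] at e1; exact lt_irrefl _ e1
              · rw [h] at e2; exact lt_irrefl _ e2
            · exact hq l j (hj.trans hi)
        · exact mixed q i hi hq fun i' hi' => h2 ⟨i', hi'⟩
      · have h1' : ∀ i, P i ≠ q := fun i hi => h1 ⟨i, hi⟩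
        by_cases h2 : ∃ i', P i' = Γ.partner q
        · obtain ⟨i', hi'⟩ := h2
          have := mixed (Γ.partner q) i' hi' hq' (by rw [Γ.partner_partner]; exact h1')
          rw [Γ.partner_partner] at this
          exact this.symm
        · have h2' : ∀ i, P i ≠ Γ.partner q := fun i hi => h2 ⟨i, hi⟩
          rw [ψo _ h1', ψo _ h2']
          refine Relation.EqvGen.rel _ _ (Link.chord q ?_)
          rintro (_ | k) j hj
          · obtain ⟨i, rfl | rfl⟩ := exists_castAdd j
            · exact h1' i ((sc i).symm.trans hj)
            · exact h2' i (Γ.partner_eq_iff.1 ((sr i).symm.trans hj)).symm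
          · exact hq k j hj
    | first k j hf =>
      show Relation.EqvGen (G.Link d) (ψl (F.side k j)) (Sum.inr (some k, j))
      by_cases h1 : ∃ i, P i = F.side k j
      · obtain ⟨i, hi⟩ := h1
        rw [← hi, ψP]
        apply Relation.EqvGen.rel
        refine Link.between none (c i) (some k) j ?_ ?_ ?_
        · rw [sc, hi, ss]
        · rw [pc, ps]; exact hF1 k j
        · rw [sc, pc, ps]
          rintro (_ | l) j' hj ⟨e1, e2⟩
          · rcases pn j' with h | h
            · rw [h] at e1; exact lt_irrefl _ e1
            · rw [h] at e2; exact lt_asymm e2 (hF2 k j)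
          · exact absurd e2 (hf l j' (hj.trans hi)).not_gt
      · have h1' : ∀ i, P i ≠ F.side k j := fun i hi => h1 ⟨i, hi⟩
        rw [ψo _ h1']
        refine Relation.EqvGen.rel _ _ (Link.first (F := G) (some k) j ?_)
        rintro (_ | k') j' hj
        · rw [pout _ h1' j' hj]; exact (hF2 k j).le
        · exact hf k' j' hj
    | between k j k' j' hs hlt hf =>
      refine Relation.EqvGen.rel _ _ (Link.between (F := G) (some k) j (some k') j' hs hlt ?_)
      rintro (_ | l) i hi ⟨e1, e2⟩
      · rcases pn i with h | h
        · rw [h] at e1; exact lt_asymm e1 (hF1 k j)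
        · rw [h] at e2; exact lt_asymm e2 (hF2 k' j')
      · exact hf l i hi ⟨e1, e2⟩
    | glue k j => exact Relation.EqvGen.rel _ _ (Link.glue (some k) j)
  have base : ∀ i, Relation.EqvGen (G.Link d) (Sum.inl (P i)) (Sum.inr (none, c i)) := by
    intro i
    have := Link.first (F := G) (d := d) none (c i) fun k j _ => by rw [pc]; exact plow k j
    rw [sc] at this
    exact Relation.EqvGen.rel _ _ this
  have ends_ne : ∀ i i', P i ≠ A.partner (P i') := by
    intro i i' e
    rw [← A.ends_castAdd P i, ← A.ends_castAdd P i', ← A.ends_rev] at e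
    have := hgen e
    have h1 : ∀ i i' : Fin 3, (Fin.castAdd 3 i : Fin 6) ≠ (Fin.castAdd 3 i' : Fin 6).rev := by
      decide
    exact h1 i i' this
  -- The outer ends lead directly to `P i`; the inner ends lead, along the curves obtained by the
  -- old surgeries, to the partner in `A`.
  have hend : ∀ j, Relation.EqvGen (G.Link d) (Sum.inr (none, j)) (Sum.inl (A.ends P j)) := by
    intro j
    obtain ⟨i, rfl | rfl⟩ := exists_castAdd j
    · rw [A.ends_castAdd]; exact (base i).symm
    · have := eqvGen_map _ key (hA.1 (P i))
      simp only [Sum.elim_inl] at this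
      rw [ψP, ψo _ fun i' => ends_ne i' i] at this
      rw [A.ends_rev, A.ends_castAdd]
      exact this
  have hout : ∀ q, (∀ j, A.ends P j ≠ q) → ∀ i, P i ≠ q := fun q hq i => by
    rw [← A.ends_castAdd P i]; exact hq _
  refine ⟨fun q => ?_, ?_⟩
  · by_cases hq : ∃ j, A.ends P j = q
    · obtain ⟨j, rfl⟩ := hq
      rw [hA'.1]
      exact (hend j).symm.trans _ _ _
        ((Relation.EqvGen.rel _ _ (Link.glue none j)).trans _ _ _ (hend _))
    · have hq' : ∀ j, A.ends P j ≠ q := fun j hj => hq ⟨j, hj⟩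
      have hq'' : ∀ j, A.ends P j ≠ A.partner q := fun j hj => hq' j.rev (by
        rw [A.ends_rev, hj, A.partner_partner])
      have := eqvGen_map _ key (hA.1 q)
      simp only [Sum.elim_inl] at this
      rw [ψo _ (hout _ hq'), ψo _ (hout _ hq'')] at this
      rw [hA'.2 q hq']
      exact this
  · rintro (_ | k) j
    · exact ⟨_, hend j⟩
    · obtain ⟨q, hq⟩ := hA.2 k j
      have := eqvGen_map _ key hq
      simp only [Sum.elim_inl, Sum.elim_inr] at this
      by_cases h : ∃ i, P i = q
      · obtain ⟨i, rfl⟩ := h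
        rw [ψP] at this
        exact ⟨_, this.trans _ _ _ (hend _)⟩
      · rw [ψo _ fun i hi => h ⟨i, hi⟩] at this
        exact ⟨_, this⟩

end BypassSystem

theorem Surgery.collar {n : ℕ} {ι : Type} [Finite ι] {Γ U D U' D' : ChordDiagram n}
    (h : Surgery ι Γ U D) {P : Fin 3 → Fin (2 * n)} (hP : ChordDiagram.IsCollarArc P)
    (hU : Function.Injective (U.ends P)) (hD : Function.Injective (D.ends P))
    (hU' : ChordDiagram.IsCollar Direction.up P U U')
    (hD' : ChordDiagram.IsCollar Direction.down P D D') : Surgery (Option ι) Γ U' D' := by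
  obtain ⟨F, h1, h2⟩ := h
  -- Finiteness of the system leaves room for an arc closer to the boundary than all others.
  obtain ⟨M, hM⟩ := (Set.finite_range fun x : ι × Fin 6 => |F.pos x.1 x.2|).bddAbove
  have hM' : ∀ k j, |F.pos k j| < max M 0 + 1 := fun k j => by
    have := hM ⟨(k, j), rfl⟩
    have := le_max_left M 0
    simp only at *
    linarith
  have hL : 0 < max M 0 + 1 := by
    have := le_max_right M 0
    linarith
  exact ⟨F.collar hP hL hM', h1.collar hP hL hM' hU hU', h2.collar hP hL hM' hD hD'⟩

/-! ### Connectedness of the union of two matchings -/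

/-- The graph with edges `{x, f x}` and `{x, h x}`, for involutions `f` and `h`, is connected. -/
def Conn {α : Type*} (f h : α → α) : Prop :=
  ∀ S : Set α, S.Nonempty → (∀ x ∈ S, f x ∈ S ∧ h x ∈ S) → S = Set.univ

theorem conn_comm {α : Type*} {f h : α → α} : Conn f h ↔ Conn h f := by
  simp only [Conn, and_comm]

theorem Conn.of_semiconj {α β : Type*} {f h : α → α} {f' h' : β → β} (e : α ≃ β)
    (hf : ∀ x, f' (e x) = e (f x)) (hh : ∀ x, h' (e x) = e (h x)) (H : Conn f h) : Conn f' h' := by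
  intro S ⟨y, hy⟩ hS
  have := H (e ⁻¹' S) ⟨e.symm y, by simpa using hy⟩ fun x hx => by
    have := hS _ hx
    rwa [hf, hh] at this
  ext z
  have h1 : e.symm z ∈ e ⁻¹' S := by rw [this]; trivial
  simpa using h1

theorem conn_congr {α β : Type*} {f h : α → α} {f' h' : β → β} (e : α ≃ β)
    (hf : ∀ x, f' (e x) = e (f x)) (hh : ∀ x, h' (e x) = e (h x)) : Conn f h ↔ Conn f' h' :=
  ⟨Conn.of_semiconj e hf hh, Conn.of_semiconj e.symm
    (fun x => by rw [Equiv.eq_symm_apply, ← hf, Equiv.apply_symm_apply])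
    (fun x => by rw [Equiv.eq_symm_apply, ← hh, Equiv.apply_symm_apply])⟩

/-- `f₀` is obtained from `f` by joining the ends `a` and `b` of its chords, the other points being
labelled by `φ`. -/
def CapRel {α β : Type*} (φ : β → α) (a b : α) (f : α → α) (f₀ : β → β) : Prop :=
  ∀ x, f (φ x) = φ (f₀ x) ∨ (f (φ x) = a ∧ f b = φ (f₀ x)) ∨ (f (φ x) = b ∧ f a = φ (f₀ x))

/-- Contracting the path `f a, a, b, f b` to a single edge changes neither connectedness nor the
rest of the graph, unless `f a = b`, when `{a, b}` is a component of its own. So inserting a chord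
into one matching is adjoint to capping off the other. -/
theorem conn_cap {α β : Type*} [Nonempty β] {φ : β → α} {a b : α} (hφ : Function.Injective φ)
    (ha : ∀ x, φ x ≠ a) (hb : ∀ x, φ x ≠ b) (hcov : ∀ y, y = a ∨ y = b ∨ ∃ x, φ x = y)
    {f h : α → α} {f₀ h₀ : β → β} (hf : Function.Involutive f) (hh : Function.Involutive h)
    (hfa : f a ≠ a) (hfb : f b ≠ b) (hab : h a = b) (hφh : ∀ x, h (φ x) = φ (h₀ x))
    (hcap : CapRel φ a b f f₀) :
    Conn f h ↔ f a ≠ b ∧ Conn f₀ h₀ := by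
  have hba : h b = a := by rw [← hab, hh]
  constructor
  · intro H
    have hne : f a ≠ b := by
      intro e
      have := H {a, b} ⟨a, by simp⟩ (by
        have e' : f b = a := by rw [← e, hf]
        rintro x (rfl | rfl)
        · simp [e, hab]
        · simp [e', hba])
      obtain ⟨x⟩ := ‹Nonempty β›
      have hx : φ x ∈ ({a, b} : Set α) := by rw [this]; trivial
      rcases hx with hx | hx
      · exact ha x hx
      · exact hb x hx
    refine ⟨hne, fun S₀ hS₀ hcl => ?_⟩
    obtain ⟨x, hx⟩ : ∃ x, φ x = f a := by
      rcases hcov (f a) with h | h | h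
      · exact absurd h hfa
      · exact absurd h hne
      · exact h
    obtain ⟨y, hy⟩ : ∃ y, φ y = f b := by
      rcases hcov (f b) with h | h | h
      · exact absurd (by rw [← h, hf]) hne
      · exact absurd h hfb
      · exact h
    have hxy : f₀ x = y := by
      apply hφ
      rcases hcap x with h | h | h
      · rw [hx, hf] at h; exact absurd h.symm (ha _)
      · rw [hy, h.2]
      · rw [hx, hf] at h; rw [hy, ← h.2, h.1]
    have hyx : f₀ y = x := by
      apply hφ
      rcases hcap y with h | h | h
      · rw [hy, hf] at h; exact absurd h.symm (hb _)
      · rw [hy, hf] at h; rw [hx, ← h.2, h.1]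
      · rw [hx, h.2]
    -- The points `a` and `b` are added to the closed set exactly when it contains the contracted
    -- edge through `x`.
    have := H {z | (∃ w ∈ S₀, φ w = z) ∨ (z = a ∨ z = b) ∧ x ∈ S₀}
      (by obtain ⟨w, hw⟩ := hS₀; exact ⟨φ w, Or.inl ⟨w, hw, rfl⟩⟩) (by
      rintro z (⟨w, hw, rfl⟩ | ⟨rfl | rfl, hxS⟩)
      · refine ⟨?_, Or.inl ⟨_, (hcl w hw).2, (hφh w).symm⟩⟩
        rcases hcap w with h | h | h
        · exact Or.inl ⟨_, (hcl w hw).1, h.symm⟩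
        · refine Or.inr ⟨Or.inl h.1, ?_⟩
          have : w = x := hφ (by rw [hx, ← h.1, hf])
          rwa [← this]
        · refine Or.inr ⟨Or.inr h.1, ?_⟩
          have : w = y := hφ (by rw [hy, ← h.1, hf])
          rw [← hyx, ← this]; exact (hcl w hw).1
      · exact ⟨Or.inl ⟨x, hxS, hx⟩, Or.inr ⟨Or.inr hab, hxS⟩⟩
      · exact ⟨Or.inl ⟨y, hxy ▸ (hcl x hxS).1, hy⟩, Or.inr ⟨Or.inl hba, hxS⟩⟩)
    ext w
    have hw : φ w ∈ (Set.univ : Set α) := trivial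
    rw [← this] at hw
    rcases hw with ⟨w', hw', e⟩ | ⟨e | e, -⟩
    · rw [← hφ e]; simpa using hw'
    · exact absurd e (ha w)
    · exact absurd e (hb w)
  · rintro ⟨hne, H⟩ S ⟨y, hy⟩ hcl
    have hrange : ∀ z, f z ≠ a → f z ≠ b → ∃ x, φ x = f z := fun z h1 h2 => by
      rcases hcov (f z) with h | h | h
      · exact absurd h h1
      · exact absurd h h2
      · exact h
    have hba' : f b ≠ a := fun e => hne (by rw [← e, hf])
    have h0 := H (φ ⁻¹' S) (by
      rcases hcov y with rfl | rfl | ⟨x, rfl⟩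
      · obtain ⟨x, hx⟩ := hrange _ hfa hne
        exact ⟨x, by rw [Set.mem_preimage, hx]; exact (hcl _ hy).1⟩
      · obtain ⟨x, hx⟩ := hrange _ hba' hfb
        exact ⟨x, by rw [Set.mem_preimage, hx]; exact (hcl _ hy).1⟩
      · exact ⟨x, hy⟩) (by
      intro x hx
      refine ⟨?_, by rw [Set.mem_preimage, ← hφh]; exact (hcl _ hx).2⟩
      have h1 := (hcl _ hx).1
      rw [Set.mem_preimage]
      rcases hcap x with h | h | h
      · rwa [← h]
      · rw [h.1] at h1
        have h2 := (hcl _ h1).2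
        rw [hab] at h2
        rw [← h.2]; exact (hcl _ h2).1
      · rw [h.1] at h1
        have h2 := (hcl _ h1).2
        rw [hba] at h2
        rw [← h.2]; exact (hcl _ h2).1)
    have hmem : ∀ x, φ x ∈ S := fun x => by
      have : x ∈ φ ⁻¹' S := by rw [h0]; trivial
      exact this
    have haS : a ∈ S := by
      obtain ⟨x, hx⟩ := hrange _ hfa hne
      have := (hcl _ (hmem x)).1
      rwa [hx, hf] at this
    ext z
    simp only [Set.mem_univ, iff_true]
    rcases hcov z with rfl | rfl | ⟨x, rfl⟩
    · exact haS
    · rw [← hab]; exact (hcl _ haS).2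
    · exact hmem x

/-! ### The three-term relation -/

/-- A Boolean criterion for connectedness on six points. -/
def conn6 (f h : Fin 6 → Fin 6) : Bool :=
  let g := fun x => h (f x)
  decide (∀ x, x = 0 ∨ x = f 0 ∨ x = g 0 ∨ x = f (g 0) ∨ x = g (g 0) ∨ x = f (g (g 0)))

open Classical in
/-- The value at a matching `f` of the functional given by a matching `h`. -/
noncomputable def connVal {α : Type*} (h f : α → α) : ZMod 2 := if Conn f h then 1 else 0

/-- The complement of a closed set is closed, as `f` and `h` are involutions; so one base point
suffices. -/
theorem conn_of_orbit {α : Type*} {f h : α → α} (hf : Function.Involutive f)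
    (hh : Function.Involutive h) (x : α)
    (H : ∀ S : Set α, x ∈ S → (∀ x ∈ S, f x ∈ S ∧ h x ∈ S) → S = Set.univ) : Conn f h := by
  intro S ⟨y, hy⟩ hS
  by_cases hx : x ∈ S
  · exact H S hx hS
  · have := H Sᶜ hx (by
      intro z hz
      exact ⟨fun h' => hz (by have := (hS _ h').1; rwa [hf] at this),
        fun h' => hz (by have := (hS _ h').2; rwa [hh] at this)⟩)
    have h1 : y ∈ Sᶜ := by rw [this]; trivial
    exact absurd hy h1

/-- The points in `conn6` arise by following the two matchings alternately from `0`. The alternative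
in `hc` is a proper closed set; for concrete matchings the whole hypothesis is decidable. -/
theorem conn_fin_six {f h : Fin 6 → Fin 6} (hf : Function.Involutive f)
    (hh : Function.Involutive h)
    (hc : conn6 f h = true ∨ ∃ S : Fin 6 → Bool, S 0 = true ∧
      (∀ x, S x = true → S (f x) = true ∧ S (h x) = true) ∧ ∃ x, S x = false) :
    Conn f h ↔ conn6 f h = true := by
  have h1 : conn6 f h = true → Conn f h := by
    intro hc
    apply conn_of_orbit hf hh 0
    intro S hS hcl
    have a1 := hcl _ hS
    have a2 := hcl _ (hcl _ a1.1).2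
    have a3 := hcl _ (hcl _ a2.1).2
    ext x
    simp only [Set.mem_univ, iff_true]
    rcases of_decide_eq_true hc x with rfl | rfl | rfl | rfl | rfl | rfl
    · exact hS
    · exact a1.1
    · exact (hcl _ a1.1).2
    · exact a2.1
    · exact (hcl _ a2.1).2
    · exact a3.1
  refine ⟨fun H => ?_, h1⟩
  rcases hc with hc | ⟨S, hS, hcl, x, hx⟩
  · exact hc
  · have := H {x | S x = true} ⟨0, hS⟩ hcl
    have h2 : x ∈ {x | S x = true} := by rw [this]; trivial
    rw [Set.mem_ofPred_eq, hx] at h2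
    exact absurd h2 (by decide)

/-- Only six matchings of six points join points of opposite parity, and for each of them an even
number of the three unions is connected. -/
theorem three_term_six (h : Fin 6 → Fin 6) (hh : Function.Involutive h)
    (hpar : ∀ j, (h j).val % 2 ≠ j.val % 2) :
    connVal h Fin.rev + connVal h Direction.up.glue + connVal h Direction.down.glue = 0 := by
  have hu : Function.Involutive Direction.up.glue := by unfold Function.Involutive; decide
  have hd : Function.Involutive Direction.down.glue := by unfold Function.Involutive; decide
  have hr : Function.Involutive (Fin.rev : Fin 6 → Fin 6) := Fin.rev_rev
  have hval : h = ![h 0, h 1, h 2, h 3, h 4, h 5] := by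
    funext j; fin_cases j <;> rfl
  have key : h ∈ ({![1, 0, 3, 2, 5, 4], ![1, 0, 5, 4, 3, 2], ![3, 2, 1, 0, 5, 4],
      ![3, 4, 5, 0, 1, 2], ![5, 2, 1, 4, 3, 0], ![5, 4, 3, 2, 1, 0]} :
      Set (Fin 6 → Fin 6)) := by
    have e0 : ∀ x y : Fin 6, h x = y → h y = x := fun x y e => by rw [← e, hh]
    have p0 : h 0 = 1 ∨ h 0 = 3 ∨ h 0 = 5 := by
      have := hpar 0; revert this; generalize h 0 = x; revert x; decide
    have p2 : h 2 = 1 ∨ h 2 = 3 ∨ h 2 = 5 := by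
      have := hpar 2; revert this; generalize h 2 = x; revert x; decide
    have p4 : h 4 = 1 ∨ h 4 = 3 ∨ h 4 = 5 := by
      have := hpar 4; revert this; generalize h 4 = x; revert x; decide
    rw [hval]
    rcases p0 with p0 | p0 | p0 <;> rcases p2 with p2 | p2 | p2 <;>
      rcases p4 with p4 | p4 | p4 <;>
      first
      | (exfalso; exact absurd (hh.injective (p0.trans p2.symm)) (by decide))
      | (exfalso; exact absurd (hh.injective (p0.trans p4.symm)) (by decide))
      | (exfalso; exact absurd (hh.injective (p2.trans p4.symm)) (by decide))
      | simp [p0, p2, p4, e0 _ _ p0, e0 _ _ p2, e0 _ _ p4]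
  have cv : ∀ f : Fin 6 → Fin 6, (Conn f h ↔ conn6 f h = true) →
      connVal h f = if conn6 f h = true then 1 else 0 := by
    intro f hf
    by_cases hc : conn6 f h = true
    · rw [if_pos hc, connVal, if_pos (hf.2 hc)]
    · rw [if_neg hc, connVal, if_neg fun H => hc (hf.1 H)]
  rcases key with rfl | rfl | rfl | rfl | rfl | rfl <;>
    rw [cv _ (conn_fin_six hr hh (by decide)), cv _ (conn_fin_six hu hh (by decide)),
      cv _ (conn_fin_six hd hh (by decide))] <;> decide

/-- Chords untouched by the surgery are removed one at a time while `h` is capped off at their ends,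
until only the six ends are left. The colouring survives capping off, since the two ends of a chord
have different colours; it restricts the final check to the six matchings of `three_term_six`. -/
theorem three_term {α : Type*} [Fintype α] (col : α → Prop) (s : Fin 6 → α)
    (hs : Function.Injective s) (hcs : ∀ i j, (col (s i) ↔ col (s j)) ↔ i.val % 2 = j.val % 2)
    {h f f' f'' : α → α} (hh : Function.Involutive h) (hf : Function.Involutive f)
    (hch : ∀ x, col (h x) ↔ ¬ col x) (hcf : ∀ x, col (f x) ↔ ¬ col x)
    (hf0 : ∀ j, f (s j) = s j.rev) (hf1 : ∀ j, f' (s j) = s (Direction.up.glue j))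
    (hf2 : ∀ j, f'' (s j) = s (Direction.down.glue j))
    (hf1' : ∀ x, (∀ j, s j ≠ x) → f' x = f x) (hf2' : ∀ x, (∀ j, s j ≠ x) → f'' x = f x) :
    connVal h f + connVal h f' + connVal h f'' = 0 := by
  obtain ⟨N, hN⟩ : ∃ N, Fintype.card α = N := ⟨_, rfl⟩
  induction N using Nat.strong_induction_on generalizing α with
  | _ N ih => ?_
  have hfs : ∀ x, (∀ j, s j ≠ x) → ∀ j, s j ≠ f x := fun x hx j e =>
    hx j.rev (by rw [← hf0, e, hf])
  have hgl : ∀ d : Direction, Function.Involutive d.glue := by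
    rintro (_ | _) <;> unfold Function.Involutive <;> decide
  have inv : ∀ (d : Direction) (g : α → α), (∀ j, g (s j) = s (d.glue j)) →
      (∀ x, (∀ j, s j ≠ x) → g x = f x) → Function.Involutive g := by
    intro d g hg1 hg2 x
    by_cases hx : ∃ j, s j = x
    · obtain ⟨j, rfl⟩ := hx
      rw [hg1, hg1, hgl]
    · have hx' : ∀ j, s j ≠ x := fun j e => hx ⟨j, e⟩
      rw [hg2 _ hx', hg2 _ (hfs x hx'), hf]
  have hf1i := inv _ f' hf1 hf1'
  have hf2i := inv _ f'' hf2 hf2'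
  by_cases hsurj : Function.Surjective s
  · have e : Fin 6 ≃ α := Equiv.ofBijective s ⟨hs, hsurj⟩
    choose k hk using fun j => hsurj (h (s j))
    have hki : Function.Involutive k := fun j => hs (by rw [hk, hk, hh])
    have := three_term_six k hki (by
      intro j
      have := hcs (k j) j
      rw [hk, hch] at this
      tauto)
    simp only [connVal] at this ⊢
    have c : ∀ (g : Fin 6 → Fin 6) (g' : α → α), (∀ j, g' (s j) = s (g j)) →
        (Conn g k ↔ Conn g' h) := fun g g' hg =>
      conn_congr (Equiv.ofBijective s ⟨hs, hsurj⟩) hg fun j => (hk j).symm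
    rwa [c _ f hf0, c _ f' hf1, c _ f'' hf2] at this
  · obtain ⟨a, ha⟩ : ∃ a, ∀ j, s j ≠ a := by
      simpa [Function.Surjective] using hsurj
    have hb := hfs a ha
    set b := f a with hbdef
    have hba : f b = a := hf a
    have hanb : a ≠ b := fun e => by
      have := hcf a; rw [← hbdef, ← e] at this; tauto
    -- If `h` contains the same chord, the three unions all have the component `{a, b}`, which
    -- misses the six ends, so all three values are zero.
    by_cases hhab : h a = b
    · have hno : ∀ g : α → α, g a = b → g b = a → ¬ Conn g h := by
        intro g h1 h2 H
        have := H {a, b} ⟨a, by simp⟩ (by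
          rintro x (rfl | rfl)
          · simp [h1, hhab]
          · have : h b = a := by rw [← hhab, hh]
            simp [h2, this])
        have h3 : s 0 ∈ ({a, b} : Set α) := by rw [this]; trivial
        rcases h3 with h3 | h3
        · exact ha _ h3
        · exact hb _ h3
      simp only [connVal]
      rw [if_neg (hno f rfl hba), if_neg (hno f' (hf1' a ha) ((hf1' b hb).trans hba)),
        if_neg (hno f'' (hf2' a ha) ((hf2' b hb).trans hba))]
      simp
    · classical
      let β := {x : α // x ≠ a ∧ x ≠ b}
      have hhba : h b ≠ a := fun e => hhab (by rw [← e, hh])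
      have hhaa : h a ≠ a := fun e => by have := hch a; rw [e] at this; tauto
      have hhbb : h b ≠ b := fun e => by have := hch b; rw [e] at this; tauto
      have clos : ∀ g : α → α, Function.Involutive g → g a = b → ∀ x : β, g x ≠ a ∧ g x ≠ b := by
        intro g hg hgab x
        have hgba : g b = a := by rw [← hgab, hg]
        exact ⟨fun e => x.2.2 ((hg x.1).symm.trans ((congrArg g e).trans hgab)),
          fun e => x.2.1 ((hg x.1).symm.trans ((congrArg g e).trans hgba))⟩
      let res : ∀ g : α → α, Function.Involutive g → g a = b → β → β :=
        fun g hg hgab x => ⟨g x, clos g hg hgab x⟩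
      let h₀ : β → β := fun x =>
        if h1 : h x = a then ⟨h b, hhba, hhbb⟩ else
          if h2 : h x = b then ⟨h a, hhaa, hhab⟩ else ⟨h x, h1, h2⟩
      have hcap : CapRel (Subtype.val : β → α) a b h h₀ := by
        intro x
        by_cases h1 : h x = a
        · exact Or.inr (Or.inl ⟨h1, by simp [h₀, h1]⟩)
        · by_cases h2 : h x = b
          · exact Or.inr (Or.inr ⟨h2, by simp [h₀, h2, hanb.symm]⟩)
          · exact Or.inl (by simp [h₀, h1, h2])
      have hh0i : Function.Involutive h₀ := by
        intro x
        apply Subtype.ext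
        by_cases h1 : h x = a
        · have e : h₀ x = ⟨h b, hhba, hhbb⟩ := by simp [h₀, h1]
          rw [e]
          simp only [h₀, hh b, hanb.symm, dite_false, dite_true]
          exact (congrArg h h1).symm.trans (hh x.1)
        · by_cases h2 : h x = b
          · have e : h₀ x = ⟨h a, hhaa, hhab⟩ := by simp [h₀, h2, hanb.symm]
            rw [e]
            simp only [h₀, hh a, dite_true]
            exact (congrArg h h2).symm.trans (hh x.1)
          · have e : h₀ x = ⟨h x, h1, h2⟩ := by simp [h₀, h1, h2]
            rw [e]
            simp only [h₀, hh x.1, x.2.1, x.2.2, dite_false]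
      have hcol0 : ∀ x : β, col (h₀ x) ↔ ¬ col x := by
        intro x
        have cb := hcf a
        rw [← hbdef] at cb
        have hx := hch x
        by_cases h1 : h x = a
        · have e : h₀ x = ⟨h b, hhba, hhbb⟩ := by simp [h₀, h1]
          rw [e]
          have := hch b
          rw [h1] at hx
          simp only
          tauto
        · by_cases h2 : h x = b
          · have e : h₀ x = ⟨h a, hhaa, hhab⟩ := by simp [h₀, h2, hanb.symm]
            rw [e]
            have := hch a
            rw [h2] at hx
            simp only
            tauto
          · have e : h₀ x = ⟨h x, h1, h2⟩ := by simp [h₀, h1, h2]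
            rw [e]
            exact hx
      let s₀ : Fin 6 → β := fun j => ⟨s j, ha j, hb j⟩
      have hne : Nonempty β := ⟨s₀ 0⟩
      have hconn : ∀ (g : α → α) (hg : Function.Involutive g) (hgab : g a = b),
          (Conn g h ↔ Conn (res g hg hgab) h₀) := by
        intro g hg hgab
        -- The roles are exchanged: `g` has the outermost chord `{a, b}`, and `h` is capped off.
        rw [conn_comm, conn_comm (f := res g hg hgab)]
        rw [conn_cap (φ := (Subtype.val : β → α)) Subtype.val_injective (fun x => x.2.1)
          (fun x => x.2.2) (fun y => by
            by_cases h1 : y = a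
            · exact Or.inl h1
            · by_cases h2 : y = b
              · exact Or.inr (Or.inl h2)
              · exact Or.inr (Or.inr ⟨⟨y, h1, h2⟩, rfl⟩)) hh hg hhaa hhbb hgab
          (h₀ := res g hg hgab) (fun x => rfl) hcap]
        exact and_iff_right hhab
      have hcard : Fintype.card β < N := by
        rw [← hN]
        exact Fintype.card_subtype_lt (x := a) (by simp)
      have := ih _ hcard (col := fun x : β => col x) s₀
        (fun i j e => hs (congrArg Subtype.val e)) hcs
        (h := h₀) (f := res f hf rfl) (f' := res f' hf1i (hf1' a ha))
        (f'' := res f'' hf2i (hf2' a ha)) hh0i (fun x => Subtype.ext (hf x.1)) hcol0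
        (fun x => hcf x) (fun j => Subtype.ext (hf0 j)) (fun j => Subtype.ext (hf1 j))
        (fun j => Subtype.ext (hf2 j))
        (fun x hx => Subtype.ext (hf1' _ fun j e => hx j (Subtype.ext e)))
        (fun x hx => Subtype.ext (hf2' _ fun j e => hx j (Subtype.ext e))) rfl
      simp only [connVal] at this ⊢
      rwa [hconn f hf rfl, hconn f' hf1i (hf1' a ha), hconn f'' hf2i (hf2' a ha)]

/-! ### Evaluation of bypass triples -/

theorem eqvGen_mem_iff {α : Type*} {r : α → α → Prop} (T : Set α)
    (hT : ∀ x y, r x y → (x ∈ T ↔ y ∈ T)) {x y : α} (h : Relation.EqvGen r x y) :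
    x ∈ T ↔ y ∈ T := by
  induction h with
  | rel x y hr => exact hT x y hr
  | refl x => rfl
  | symm x y _ ih => exact ih.symm
  | trans x y z _ _ ih1 ih2 => exact ih1.trans ih2

namespace ChordDiagram

variable {n : ℕ}

theorem even_card_of_partner_mem (Γ : ChordDiagram n) (s : Finset (Fin (2 * n)))
    (hs : ∀ a ∈ s, Γ.partner a ∈ s) : s.card % 2 = 0 := by
  have := Finset.sum_involution (s := s) (f := fun _ => (1 : ZMod 2))
    (fun a _ => Γ.partner a) (fun _ _ => by decide) (fun a _ _ => Γ.partner_ne a)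
    hs (fun a _ => Γ.partner_partner a)
  rw [Finset.sum_const, nsmul_eq_mul, mul_one, ZMod.natCast_eq_zero_iff] at this
  omega

/-- No chord separates the two boundary arcs, so the marked points between them are matched among
themselves and their number is even. -/
theorem SameRegion.mod_two {Γ : ChordDiagram n} {p q : Fin (2 * n)} (h : Γ.SameRegion p q) :
    p.val % 2 = q.val % 2 := by
  rw [sameRegion_iff] at h
  have main : ∀ p q : Fin (2 * n), p ≤ q →
      (∀ a, (a < p ↔ Γ.partner a < p) ↔ (a < q ↔ Γ.partner a < q)) → p.val % 2 = q.val % 2 := by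
    intro p q hpq h
    have := Γ.even_card_of_partner_mem (Finset.Ico p q) (by
      intro a ha
      have := h a
      simp only [Finset.mem_Ico, Fin.lt_def, Fin.le_def] at *
      omega)
    rw [Fin.card_Ico] at this
    rw [Fin.le_def] at hpq
    omega
  rcases le_total p q with hpq | hpq
  · exact main p q hpq h
  · exact (main q p hpq fun a => (h a).symm).symm

theorem exists_consec (p : Fin (2 * n)) : ∃ q, Consec p q := by
  by_cases h : p.val + 1 = 2 * n
  · exact ⟨⟨0, by omega⟩, Or.inr ⟨h, rfl⟩⟩
  · exact ⟨⟨p.val + 1, by omega⟩, Or.inl rfl⟩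

theorem Consec.mod_two {p q : Fin (2 * n)} (h : Consec p q) : p.val % 2 ≠ q.val % 2 := by
  rcases h with h | h <;> omega

theorem partner_mod_two (Γ : ChordDiagram n) (p : Fin (2 * n)) :
    (Γ.partner p).val % 2 ≠ p.val % 2 := by
  obtain ⟨q, hq⟩ := exists_consec p
  have h1 := (hq.sameRegion Γ).mod_two
  have h2 := hq.mod_two
  omega

end ChordDiagram

namespace BypassSystem

variable {n : ℕ} {Γ Γ' Γ'' : ChordDiagram n}

/-- Strands change the parity of the marked point, halves of the arc preserve it; together they
connect all six ends. -/
theorem side_mod_two {ι : Type} (F : BypassSystem Γ ι) (k : ι) (i j : Fin 6) :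
    (F.side k i).val % 2 = (F.side k j).val % 2 ↔ i.val % 2 = j.val % 2 := by
  have h1 := (F.left_region k).mod_two
  have h2 := (F.right_region k).mod_two
  have r : ∀ j, (F.side k j.rev).val % 2 ≠ (F.side k j).val % 2 := fun j => by
    rw [F.side_rev]; exact Γ.partner_mod_two _
  have r0 : (F.side k 5).val % 2 ≠ (F.side k 0).val % 2 := r 0
  have r1 : (F.side k 4).val % 2 ≠ (F.side k 1).val % 2 := r 1
  have r2 : (F.side k 3).val % 2 ≠ (F.side k 2).val % 2 := r 2
  have hi : ∀ i : Fin 6, (F.side k i).val % 2 = ((F.side k 0).val + i.val) % 2 := by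
    intro i
    fin_cases i <;> simp only [Fin.zero_eta, Fin.mk_one, Fin.reduceFinMk] <;>
      omega
  rw [hi i, hi j]
  omega

/-- The direction in which surgery joins two ends of opposite parity belonging to different
strands. -/
theorem exists_glue_eq : ∀ i j : Fin 6, i ≠ j → i.val % 2 = j.val % 2 →
    Direction.up.glue i.rev = j ∨ Direction.down.glue i.rev = j := by
  decide

theorem glue_glue (d : Direction) (j : Fin 6) : d.glue (d.glue j) = j := by
  cases d <;> revert j <;> decide

/-- Surgery along a single arc two of whose ends are adjacent on a chord creates a loop, in one of
the directions. -/
theorem not_gives_of_adjacent (c : BypassSystem Γ Unit) (d : Direction) {i j : Fin 6}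
    (hd : d.glue i.rev = j) (hs : c.side () i = c.side () j) (hlt : c.pos () i < c.pos () j)
    (hmin : ∀ l, c.side () l = c.side () i → c.pos () i < c.pos () l → c.pos () j ≤ c.pos () l)
    {A : ChordDiagram n} : ¬ c.Gives d A := by
  rintro ⟨-, h2⟩
  obtain ⟨p, hp⟩ := h2 () j
  have hd' : d.glue j = i.rev := by rw [← hd, glue_glue]
  have inj : ∀ l l', c.side () l = c.side () l' → c.pos () l = c.pos () l' → l = l' :=
    fun l l' h1 h2 => (c.injective _ _ _ _ h1 h2).2
  have hsr : c.side () i.rev = c.side () j.rev := by rw [c.side_rev, c.side_rev, hs]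
  -- The piece of chord between the two adjacent crossings and the new chord glued to it form a
  -- closed loop, whose only ends are these two.
  have hT := eqvGen_mem_iff ({Sum.inr ((), j), Sum.inr ((), i.rev)} :
      Set (Fin (2 * n) ⊕ Unit × Fin 6)) (by
    intro x y hxy
    cases hxy with
    | chord q hq => simp
    | first k l hf =>
      cases k
      have h1 : l ≠ j := by
        rintro rfl
        exact absurd (hf () i hs) hlt.not_ge
      have h2 : l ≠ i.rev := by
        rintro rfl
        have := hf () j.rev hsr.symm
        rw [c.pos_rev, c.pos_rev] at this
        linarith
      simp [h1, h2]
    | between k l k' l' hs' hlt' hf =>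
      cases k; cases k'
      have key : l = i ↔ l' = j := by
        constructor
        · rintro rfl
          have h1 := hmin l' hs'.symm hlt'
          rcases h1.eq_or_lt with h1 | h1
          · exact (inj _ _ (hs.symm.trans hs') h1).symm
          · exact absurd ⟨hlt, h1⟩ (hf () j hs.symm)
        · rintro rfl
          rcases lt_trichotomy (c.pos () l) (c.pos () i) with h1 | h1 | h1
          · exact absurd ⟨h1, hlt⟩ (hf () i (hs.trans hs'.symm))
          · exact inj _ _ (hs'.trans hs.symm) h1
          · exact absurd (hmin l (hs'.trans hs.symm) h1) hlt'.not_ge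
      have key2 : l.rev = j ↔ l' = i.rev := by
        constructor
        · rintro rfl
          have h0 : c.side () l' = c.side () i.rev := by
            rw [← hs', hsr, Fin.rev_rev]
          have h1 : c.pos () l < - c.pos () i := by
            have := c.pos_rev () l
            linarith
          rcases lt_trichotomy (c.pos () l') (c.pos () i.rev) with h2 | h2 | h2
          · have h3 := hmin l'.rev (by rw [c.side_rev, h0, ← c.side_rev, Fin.rev_rev])
              (by rw [c.pos_rev] at h2 ⊢; linarith)
            rw [c.pos_rev, c.pos_rev] at h3
            linarith
          · exact inj _ _ h0 h2
          · exact absurd ⟨by rw [c.pos_rev]; exact h1, h2⟩ (hf () i.rev (h0.symm.trans hs'.symm))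
        · rintro rfl
          have h0 : c.side () l.rev = c.side () i := by
            rw [c.side_rev, hs', ← c.side_rev, Fin.rev_rev]
          rw [c.pos_rev] at hlt' hf
          have h1 := hmin l.rev h0 (by rw [c.pos_rev]; linarith)
          rcases h1.eq_or_lt with h1 | h1
          · exact inj _ _ (h0.trans hs) h1.symm
          · rw [c.pos_rev] at h1
            exact absurd ⟨by rw [c.pos_rev]; linarith, by rw [c.pos_rev]; linarith⟩
              (hf () j.rev (by rw [← hsr, hs']))
      have key3 : l.rev = i.rev ↔ l = i := Fin.rev_inj
      simp only [Set.mem_insert_iff, Set.mem_singleton_iff, Sum.inr.injEq, Prod.mk.injEq, true_and]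
      tauto
    | glue k l =>
      have e1 : d.glue l = j ↔ l = i.rev := by
        constructor
        · intro h; rw [← glue_glue d l, h, hd']
        · rintro rfl; exact hd
      have e2 : d.glue l = i.rev ↔ l = j := by
        constructor
        · intro h; rw [← glue_glue d l, h, hd]
        · rintro rfl; exact hd'
      simp only [Set.mem_insert_iff, Set.mem_singleton_iff, Sum.inr.injEq, Prod.mk.injEq, true_and,
        e1, e2]
      tauto) hp
  simp at hT

/-- If the arc met one chord side twice, two adjacent crossings there would have ends of equal
parity, and one of the two surgeries would close up the piece between them. So in a bypass triple
the arc meets three different chords. -/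
theorem side_injective {c : BypassSystem Γ Unit} (hu : c.Gives Direction.up Γ')
    (hd : c.Gives Direction.down Γ'') : Function.Injective (c.side ()) := by
  have main : ∀ i j, c.side () i = c.side () j → ¬ c.pos () i < c.pos () j := by
    intro i j hs hlt
    -- The next crossing after that of `i` on the same chord.
    obtain ⟨j', hj', hmin⟩ := Finset.exists_min_image
      (Finset.univ.filter fun l => c.side () l = c.side () i ∧ c.pos () i < c.pos () l)
      (c.pos ()) ⟨j, by simp [hs, hlt]⟩
    simp only [Finset.mem_filter, Finset.mem_univ, true_and] at hj' hmin
    have hne : i ≠ j' := by rintro rfl; exact lt_irrefl _ hj'.2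
    have hpar : i.val % 2 = j'.val % 2 := (c.side_mod_two () _ _).1 (by rw [hj'.1])
    rcases exists_glue_eq i j' hne hpar with h | h
    · exact c.not_gives_of_adjacent _ h hj'.1.symm hj'.2 (fun l h1 h2 => hmin l ⟨h1, h2⟩) hu
    · exact c.not_gives_of_adjacent _ h hj'.1.symm hj'.2 (fun l h1 h2 => hmin l ⟨h1, h2⟩) hd
  intro i j hs
  exact (c.injective _ _ _ _ hs (le_antisymm (not_lt.1 (main j i hs.symm))
    (not_lt.1 (main i j hs)))).2

/-- As each chord is met at most once, the component through an end runs from its marked point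
through the new chord to another marked point; these four vertices form a set closed under links. -/
theorem Gives.partner_side {c : BypassSystem Γ Unit} (hc : Function.Injective (c.side ()))
    {d : Direction} {A : ChordDiagram n} (h : c.Gives d A) (j : Fin 6) :
    A.partner (c.side () j) = c.side () (d.glue j) := by
  have := (eqvGen_mem_iff ({Sum.inl (c.side () j), Sum.inr ((), j), Sum.inr ((), d.glue j),
      Sum.inl (c.side () (d.glue j))} : Set (Fin (2 * n) ⊕ Unit × Fin 6)) (by
    intro x y hxy
    cases hxy with
    | chord q hq =>
      have h1 : ∀ l, q ≠ c.side () l := fun l e => hq () l e.symm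
      have h2 : ∀ l, Γ.partner q ≠ c.side () l := fun l e =>
        hq () l.rev (by rw [c.side_rev, ← e, Γ.partner_partner])
      simp [h1, h2]
    | first k l hf =>
      simp only [Set.mem_insert_iff, Set.mem_singleton_iff, Sum.inr.injEq, Sum.inl.injEq,
        Prod.mk.injEq, true_and, hc.eq_iff, reduceCtorEq, false_or, or_false]
    | between k l k' l' hs' hlt' hf =>
      have := hc hs'
      subst this
      exact absurd hlt' (lt_irrefl _)
    | glue k l =>
      have e1 : d.glue l = j ↔ l = d.glue j := by
        constructor
        · intro h; rw [← h, glue_glue]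
        · rintro rfl; rw [glue_glue]
      have e2 : d.glue l = d.glue j ↔ l = j := by
        constructor
        · intro h; rw [← glue_glue d l, h, glue_glue]
        · rintro rfl; rfl
      simp only [Set.mem_insert_iff, Set.mem_singleton_iff, Sum.inr.injEq, Prod.mk.injEq, true_and,
        reduceCtorEq, false_or, or_false, e1, e2]
      tauto) (h.1 (c.side () j))).1 (by simp)
  simpa [A.partner_ne] using this

theorem Gives.partner_of_ne {c : BypassSystem Γ Unit} {d : Direction} {A : ChordDiagram n}
    (h : c.Gives d A) {q : Fin (2 * n)} (hq : ∀ j, c.side () j ≠ q) :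
    A.partner q = Γ.partner q := by
  have h1 : ∀ j, c.side () j ≠ Γ.partner q := fun j e =>
    hq j.rev (by rw [c.side_rev, e, Γ.partner_partner])
  have := (eqvGen_mem_iff ({Sum.inl q, Sum.inl (Γ.partner q)} :
      Set (Fin (2 * n) ⊕ Unit × Fin 6)) (by
    intro x y hxy
    cases hxy with
    | chord p hp =>
      simp only [Set.mem_insert_iff, Set.mem_singleton_iff, Sum.inl.injEq,
        Γ.partner_injective.eq_iff, Γ.partner_eq_iff (p := p) (q := q)]
      rw [eq_comm (a := Γ.partner q)]
      tauto
    | first k l hf => simp [hq l, h1 l]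
    | between k l k' l' hs' hlt' hf => simp
    | glue k l => simp) (h.1 q)).1 (by simp)
  simpa [A.partner_ne] using this

end BypassSystem

/-- A matching of the marked points, not necessarily non-crossing, joining points of different
parity. -/
def IsMatching {n : ℕ} (h : Fin (2 * n) → Fin (2 * n)) : Prop :=
  Function.Involutive h ∧ ∀ x, (h x).val % 2 ≠ x.val % 2

theorem connVal_bypassTriple {n : ℕ} {h : Fin (2 * n) → Fin (2 * n)} (hh : IsMatching h)
    {Γ Γ' Γ'' : ChordDiagram n} (H : BypassTriple Γ Γ' Γ'') :
    connVal h Γ.partner + connVal h Γ'.partner + connVal h Γ''.partner = 0 := by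
  obtain ⟨c, hu, hd⟩ := H
  have hc := BypassSystem.side_injective hu hd
  refine three_term (fun x => x.val % 2 = 0) (c.side ()) hc ?_ hh.1 Γ.partner_partner ?_ ?_ ?_
    (hu.partner_side hc) (hd.partner_side hc) (fun x hx => hu.partner_of_ne hx)
    (fun x hx => hd.partner_of_ne hx)
  · intro i j
    rw [← c.side_mod_two () i j]
    omega
  · intro x
    have := hh.2 x
    omega
  · intro x
    have := Γ.partner_mod_two x
    omega
  · intro j; rw [c.side_rev]

/-- The functional on `SFHcomb` given by a matching. -/
noncomputable def evalSFH {n : ℕ} {h : Fin (2 * n) → Fin (2 * n)} (hh : IsMatching h) :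
    SFHcomb n →ₗ[ZMod 2] ZMod 2 :=
  (bypassRelations n).liftQ
    (Finsupp.linearCombination (ZMod 2) fun Γ : ChordDiagram n => connVal h Γ.partner) (by
      rw [bypassRelations, Submodule.span_le]
      rintro x ⟨Γ, Γ', Γ'', H, rfl⟩
      simp only [SetLike.mem_coe, LinearMap.mem_ker, map_add, Finsupp.linearCombination_single,
        one_smul]
      exact connVal_bypassTriple hh H)

theorem evalSFH_toSFH {n : ℕ} {h : Fin (2 * n) → Fin (2 * n)} (hh : IsMatching h)
    (Γ : ChordDiagram n) : evalSFH hh Γ.toSFH = connVal h Γ.partner := by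
  rw [evalSFH, ChordDiagram.toSFH]
  erw [Submodule.liftQ_apply]
  simp

/-! ### Existence of the result of surgery near the boundary -/

namespace ChordDiagram

variable {n : ℕ}

/-- The non-crossing condition as a parity condition, which treats both ends of each chord alike and
survives rotations of the circle. -/
theorem sep (A : ChordDiagram n) {x y : Fin (2 * n)} (h1 : y ≠ x) (h2 : y ≠ A.partner x) :
    (x < y ↔ A.partner x < y) ↔ (x < A.partner y ↔ A.partner x < A.partner y) := by
  have e1 := A.noncrossing x y
  have e2 := A.noncrossing x (A.partner y)
  have e3 := A.noncrossing (A.partner x) y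
  have e4 := A.noncrossing (A.partner x) (A.partner y)
  have e5 : A.partner y ≠ x := fun h => h2 (by rw [← h, A.partner_partner])
  have e6 : A.partner y ≠ A.partner x := fun h => h1 (A.partner_injective h)
  have e7 := A.noncrossing y x
  have e8 := A.noncrossing y (A.partner x)
  have e9 := A.noncrossing (A.partner y) x
  have e10 := A.noncrossing (A.partner y) (A.partner x)
  simp only [A.partner_partner] at e2 e3 e4 e8 e9 e10
  simp only [Fin.lt_def, Fin.ext_iff, ne_eq] at *
  omega

theorem sep_swap {m : ℕ} {x x' y y' : Fin m} (h1 : y ≠ x) (h2 : y ≠ x') (h3 : y' ≠ x)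
    (h4 : y' ≠ x') (h : (x < y ↔ x' < y) ↔ (x < y' ↔ x' < y')) :
    (y < x ↔ y' < x) ↔ (y < x' ↔ y' < x') := by
  simp only [Fin.lt_def, Fin.ext_iff, ne_eq] at *
  omega

theorem glue_ne (d : Direction) (j : Fin 6) : d.glue j ≠ j := by
  cases d <;> revert j <;> decide

open Classical in
/-- The matching of the marked points obtained by surgery near the boundary. -/
noncomputable def collarFun (d : Direction) (P : Fin 3 → Fin (2 * n)) (A : ChordDiagram n)
    (y : Fin (2 * n)) : Fin (2 * n) :=
  if h : ∃ j, A.ends P j = y then A.ends P (d.glue h.choose) else A.partner y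

theorem collarFun_ends {d : Direction} {P : Fin 3 → Fin (2 * n)} {A : ChordDiagram n}
    (hA : Function.Injective (A.ends P)) (j : Fin 6) :
    collarFun d P A (A.ends P j) = A.ends P (d.glue j) := by
  have h : ∃ i, A.ends P i = A.ends P j := ⟨j, rfl⟩
  rw [collarFun, dif_pos h, hA h.choose_spec]

theorem collarFun_of_ne {d : Direction} {P : Fin 3 → Fin (2 * n)} {A : ChordDiagram n}
    {y : Fin (2 * n)} (h : ∀ j, A.ends P j ≠ y) : collarFun d P A y = A.partner y := by
  rw [collarFun, dif_neg]
  rintro ⟨j, hj⟩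
  exact h j hj

theorem ends_ne_partner {P : Fin 3 → Fin (2 * n)} {A : ChordDiagram n} {y : Fin (2 * n)}
    (h : ∀ j, A.ends P j ≠ y) (j : Fin 6) : A.ends P j ≠ A.partner y := fun e =>
  h j.rev (by rw [A.ends_rev, e, A.partner_partner])

/-- One representative of each of the three pairs of new chords, for each direction. The old chords
do not cross and their first ends are consecutive, which determines the cyclic order of all six
ends. -/
theorem collar_sep_base {m : ℕ} {S : Fin 6 → Fin (2 * m)} (hS : Function.Injective S)
    (c1 : Consec (S 0) (S 1)) (c2 : Consec (S 1) (S 2))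
    (s1 : (S 0 < S 1 ↔ S 5 < S 1) ↔ (S 0 < S 4 ↔ S 5 < S 4))
    (s2 : (S 0 < S 2 ↔ S 5 < S 2) ↔ (S 0 < S 3 ↔ S 5 < S 3))
    (s3 : (S 1 < S 2 ↔ S 4 < S 2) ↔ (S 1 < S 3 ↔ S 4 < S 3)) :
    (((S 0 < S 2 ↔ S 1 < S 2) ↔ (S 0 < S 5 ↔ S 1 < S 5)) ∧
    ((S 0 < S 3 ↔ S 1 < S 3) ↔ (S 0 < S 4 ↔ S 1 < S 4)) ∧
    ((S 2 < S 3 ↔ S 5 < S 3) ↔ (S 2 < S 4 ↔ S 5 < S 4))) ∧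
    ((S 1 < S 0 ↔ S 2 < S 0) ↔ (S 1 < S 3 ↔ S 2 < S 3)) ∧
    ((S 1 < S 4 ↔ S 2 < S 4) ↔ (S 1 < S 5 ↔ S 2 < S 5)) ∧
    ((S 0 < S 4 ↔ S 3 < S 4) ↔ (S 0 < S 5 ↔ S 3 < S 5)) := by
  have hne : ∀ i j, i ≠ j → S i ≠ S j := fun i j h => hS.ne h
  have d02 := hne 0 2 (by decide)
  have d03 := hne 0 3 (by decide)
  have d04 := hne 0 4 (by decide)
  have d05 := hne 0 5 (by decide)
  have d13 := hne 1 3 (by decide)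
  have d14 := hne 1 4 (by decide)
  have d15 := hne 1 5 (by decide)
  have d23 := hne 2 3 (by decide)
  have d24 := hne 2 4 (by decide)
  have d25 := hne 2 5 (by decide)
  have d34 := hne 3 4 (by decide)
  have d35 := hne 3 5 (by decide)
  have d45 := hne 4 5 (by decide)
  clear hne hS
  have l0 := (S 0).isLt
  have l1 := (S 1).isLt
  have l2 := (S 2).isLt
  have l3 := (S 3).isLt
  have l4 := (S 4).isLt
  have l5 := (S 5).isLt
  simp only [Consec, Fin.lt_def, Fin.ext_iff, ne_eq] at *
  generalize (S 0).val = a0 at *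
  generalize (S 1).val = a1 at *
  generalize (S 2).val = a2 at *
  generalize (S 3).val = a3 at *
  generalize (S 4).val = a4 at *
  generalize (S 5).val = a5 at *
  rcases c1 with c1 | c1 <;> rcases c2 with c2 | c2 <;>
    refine ⟨⟨?_, ?_, ?_⟩, ?_, ?_, ?_⟩ <;> omega

theorem collar_sep_ends {d : Direction} {P : Fin 3 → Fin (2 * n)} (hP : IsCollarArc P)
    {A : ChordDiagram n} (hA : Function.Injective (A.ends P)) (i j : Fin 6) (hij : j ≠ i)
    (hij' : j ≠ d.glue i) :
    (A.ends P i < A.ends P j ↔ A.ends P (d.glue i) < A.ends P j) ↔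
      (A.ends P i < A.ends P (d.glue j) ↔ A.ends P (d.glue i) < A.ends P (d.glue j)) := by
  have hs : ∀ i j : Fin 6, j ≠ i → j ≠ i.rev →
      ((A.ends P i < A.ends P j ↔ A.ends P i.rev < A.ends P j) ↔
        (A.ends P i < A.ends P j.rev ↔ A.ends P i.rev < A.ends P j.rev)) := by
    intro i j h1 h2
    rw [A.ends_rev, A.ends_rev]
    exact A.sep (hA.ne h1) (by rw [← A.ends_rev]; exact hA.ne h2)
  have key := collar_sep_base hA hP.2.1 hP.2.2 (hs 0 1 (by decide) (by decide))
    (hs 0 2 (by decide) (by decide)) (hs 1 2 (by decide) (by decide))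
  generalize A.ends P = S at hA key ⊢
  -- `T` says that the new chords at `i` and `j` do not cross. It depends on the chords only and is
  -- symmetric, so three pairs suffice in each direction.
  have hT : ∃ T : Fin 6 → Fin 6 → Prop, ∀ i j, T i j ↔ ((S i < S j ↔ S (d.glue i) < S j) ↔
      (S i < S (d.glue j) ↔ S (d.glue i) < S (d.glue j))) := ⟨_, fun _ _ => Iff.rfl⟩
  obtain ⟨T, hT⟩ := hT
  have hl : ∀ i j, T i j → T (d.glue i) j := by
    intro i j h
    rw [hT] at h ⊢
    rw [BypassSystem.glue_glue, iff_comm (a := S (d.glue i) < S j),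
      iff_comm (a := S (d.glue i) < S (d.glue j))]
    exact h
  have hr : ∀ i j, T i j → T i (d.glue j) := by
    intro i j h
    rw [hT] at h ⊢
    rw [BypassSystem.glue_glue]
    exact h.symm
  have hsw : ∀ i j, j ≠ i → j ≠ d.glue i → T i j → T j i := by
    intro i j h1 h2 h
    rw [hT] at h ⊢
    exact sep_swap (hA.ne h1) (hA.ne h2)
      (hA.ne fun e => h2 (by rw [← e, BypassSystem.glue_glue]))
      (hA.ne fun e => h1 (by rw [← BypassSystem.glue_glue d j, e, BypassSystem.glue_glue])) h
  have hfull : ∀ i j i' j', (i' = i ∨ i' = d.glue i) → (j' = j ∨ j' = d.glue j) → T i j →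
      T i' j' := by
    rintro i j i' j' (rfl | rfl) (rfl | rfl) h
    · exact h
    · exact hr _ _ h
    · exact hl _ _ h
    · exact hl _ _ (hr _ _ h)
  have hcov : ∀ d : Direction, ∀ i j : Fin 6, j ≠ i → j ≠ d.glue i →
      ∃ x ∈ (Direction.rec [(0, 2), (0, 3), (2, 3)] [(1, 0), (1, 4), (0, 4)] d :
        List (Fin 6 × Fin 6)),
        ((i = x.1 ∨ i = d.glue x.1) ∧ (j = x.2 ∨ j = d.glue x.2)) ∨
        ((j = x.1 ∨ j = d.glue x.1) ∧ (i = x.2 ∨ i = d.glue x.2)) := by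
    rintro (_ | _) <;> decide
  obtain ⟨x, hx, hx'⟩ := hcov d i j hij hij'
  have hTx : T x.1 x.2 := by
    rw [hT]
    cases d <;> simp only [List.mem_cons, List.not_mem_nil, or_false] at hx <;>
      rcases hx with rfl | rfl | rfl
    · exact key.1.1
    · exact key.1.2.1
    · exact key.1.2.2
    · exact key.2.1
    · exact key.2.2.1
    · exact key.2.2.2
  rw [← hT]
  rcases hx' with ⟨h1, h2⟩ | ⟨h1, h2⟩
  · exact hfull _ _ _ _ h1 h2 hTx
  · refine hsw _ _ hij.symm (fun e => hij' ?_) (hfull _ _ _ _ h1 h2 hTx)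
    rw [e, BypassSystem.glue_glue]

theorem exists_isCollar (d : Direction) {P : Fin 3 → Fin (2 * n)} (hP : IsCollarArc P)
    {A : ChordDiagram n} (hA : Function.Injective (A.ends P)) :
    ∃ A', IsCollar d P A A' := by
  have hcov : ∀ y, (∃ j, A.ends P j = y) ∨ ∀ j, A.ends P j ≠ y := fun y => by
    by_cases h : ∃ j, A.ends P j = y
    · exact Or.inl h
    · exact Or.inr fun j hj => h ⟨j, hj⟩
  have hinv : ∀ y, collarFun d P A (collarFun d P A y) = y := by
    intro y
    rcases hcov y with ⟨j, rfl⟩ | h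
    · rw [collarFun_ends hA, collarFun_ends hA, BypassSystem.glue_glue]
    · rw [collarFun_of_ne h, collarFun_of_ne (ends_ne_partner h), A.partner_partner]
  have hfix : ∀ y, collarFun d P A y ≠ y := by
    intro y
    rcases hcov y with ⟨j, rfl⟩ | h
    · rw [collarFun_ends hA]; exact hA.ne (glue_ne d j)
    · rw [collarFun_of_ne h]; exact A.partner_ne y
  -- a chord that is not affected does not separate the six ends
  have hone : ∀ x, (∀ j, A.ends P j ≠ x) → ∀ j, ((x < A.ends P j ↔ A.partner x < A.ends P j) ↔
      (x < A.ends P 0 ↔ A.partner x < A.ends P 0)) := by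
    intro x hx
    have hx' := ends_ne_partner hx
    have hr : ∀ j : Fin 6, ((x < A.ends P j ↔ A.partner x < A.ends P j) ↔
        (x < A.ends P j.rev ↔ A.partner x < A.ends P j.rev)) := by
      intro j
      rw [A.ends_rev]
      exact A.sep (hx j) (hx' j)
    have hcons : ∀ p q, Consec p q → p ≠ x → p ≠ A.partner x → q ≠ x → q ≠ A.partner x →
        ((x < p ↔ A.partner x < p) ↔ (x < q ↔ A.partner x < q)) := by
      intro p q h h1 h2 h3 h4
      have := x.isLt
      have := (A.partner x).isLt
      simp only [Consec, Fin.lt_def, Fin.ext_iff, ne_eq] at *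
      omega
    have h01 := hcons (A.ends P 0) (A.ends P 1) hP.2.1 (hx 0) (hx' 0) (hx 1) (hx' 1)
    have h12 := hcons (A.ends P 1) (A.ends P 2) hP.2.2 (hx 1) (hx' 1) (hx 2) (hx' 2)
    have h02 := (h12.symm.trans h01.symm)
    intro j
    obtain ⟨i, hi⟩ := exists_castAdd j
    have hi0 : ((x < A.ends P (Fin.castAdd 3 i) ↔ A.partner x < A.ends P (Fin.castAdd 3 i)) ↔
      (x < A.ends P 0 ↔ A.partner x < A.ends P 0)) := by
      fin_cases i
      · exact Iff.rfl
      · exact h01.symm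
      · exact h02
    rcases hi with rfl | rfl
    · exact hi0
    · exact (hr _).symm.trans hi0
  have hsep : ∀ x y, y ≠ x → y ≠ collarFun d P A x →
      ((x < y ↔ collarFun d P A x < y) ↔
        (x < collarFun d P A y ↔ collarFun d P A x < collarFun d P A y)) := by
    intro x y h1 h2
    rcases hcov x with ⟨i, rfl⟩ | hx
    · rw [collarFun_ends hA] at h2 ⊢
      rcases hcov y with ⟨j, rfl⟩ | hy
      · rw [collarFun_ends hA]
        exact collar_sep_ends hP hA i j (fun e => h1 (by rw [e])) fun e => h2 (by rw [e])
      · rw [collarFun_of_ne hy]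
        have hy' := ends_ne_partner hy
        exact sep_swap (hy _) (hy' _) (hy _) (hy' _) ((hone y hy i).trans (hone y hy _).symm)
    · rw [collarFun_of_ne hx] at h2 ⊢
      rcases hcov y with ⟨j, rfl⟩ | hy
      · rw [collarFun_ends hA]
        exact (hone x hx j).trans (hone x hx _).symm
      · rw [collarFun_of_ne hy]
        exact A.sep h1 h2
  refine ⟨⟨collarFun d P A, hinv, hfix, ?_⟩, fun j => collarFun_ends hA j,
    fun q hq => collarFun_of_ne hq⟩
  intro x y h1 h2
  have h3 := hsep x y h1.ne' h2.ne
  have h4 : collarFun d P A y ≠ collarFun d P A x := fun e => h1.ne (by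
    rw [← hinv x, ← e, hinv])
  simp only [Fin.lt_def, Fin.ext_iff, ne_eq] at *
  omega

end ChordDiagram

/-! ### Insertion and capping off of matchings -/

theorem ChordDiagram.isMatching {n : ℕ} (Γ : ChordDiagram n) : IsMatching Γ.partner :=
  ⟨Γ.partner_partner, Γ.partner_mod_two⟩

theorem IsMatching.ne {n : ℕ} {h : Fin (2 * n) → Fin (2 * n)} (hh : IsMatching h)
    (x : Fin (2 * n)) : h x ≠ x := fun e => hh.2 x (by rw [e])

namespace Frame

variable {n : ℕ} (φ : Frame n)

theorem exists_insertMatching {h : Fin (2 * n) → Fin (2 * n)} (hh : IsMatching h) :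
    ∃ h', IsMatching h' ∧ h' φ.a = φ.b ∧ ∀ x, h' (φ.map x) = φ.map (h x) := by
  have hex : ∀ y, ∃ z, (y = φ.a → z = φ.b) ∧ (y = φ.b → z = φ.a) ∧
      ∀ x, y = φ.map x → z = φ.map (h x) := by
    intro y
    rcases φ.cover y with rfl | rfl | ⟨x, rfl⟩
    · exact ⟨φ.b, fun _ => rfl, fun e => absurd e φ.a_ne_b, fun x e => absurd e.symm (φ.map_ne_a x)⟩
    · exact ⟨φ.a, fun e => absurd e.symm φ.a_ne_b, fun _ => rfl,
        fun x e => absurd e.symm (φ.map_ne_b x)⟩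
    · exact ⟨φ.map (h x), fun e => absurd e (φ.map_ne_a x), fun e => absurd e (φ.map_ne_b x),
        fun x' e => by rw [φ.inj e]⟩
  choose h' h1 h2 h3 using hex
  have ha : h' φ.a = φ.b := h1 _ rfl
  have hb : h' φ.b = φ.a := h2 _ rfl
  have hm : ∀ x, h' (φ.map x) = φ.map (h x) := fun x => h3 _ x rfl
  refine ⟨h', ⟨fun y => ?_, fun y => ?_⟩, ha, hm⟩
  · rcases φ.cover y with rfl | rfl | ⟨x, rfl⟩
    · rw [ha, hb]
    · rw [hb, ha]
    · rw [hm, hm, hh.1]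
  · rcases φ.cover y with rfl | rfl | ⟨x, rfl⟩
    · rw [ha]; exact φ.ab_mod_two.symm
    · rw [hb]; exact φ.ab_mod_two
    · rw [hm, φ.mod_two, φ.mod_two]; exact hh.2 x

theorem exists_capMatching {h : Fin (2 * (n + 1)) → Fin (2 * (n + 1))} (hh : IsMatching h)
    (hab : h φ.a ≠ φ.b) : ∃ h₀, IsMatching h₀ ∧ CapRel φ.map φ.a φ.b h h₀ := by
  have hba : h φ.b ≠ φ.a := fun e => hab (by rw [← e, hh.1])
  have hex : ∀ x, ∃ z, h (φ.map x) = φ.map z ∨ (h (φ.map x) = φ.a ∧ h φ.b = φ.map z) ∨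
      (h (φ.map x) = φ.b ∧ h φ.a = φ.map z) := by
    intro x
    rcases φ.cover (h (φ.map x)) with e | e | ⟨z, e⟩
    · rcases φ.cover (h φ.b) with e' | e' | ⟨z, e'⟩
      · exact absurd e' hba
      · exact absurd e' (hh.ne _)
      · exact ⟨z, Or.inr (Or.inl ⟨e, e'.symm⟩)⟩
    · rcases φ.cover (h φ.a) with e' | e' | ⟨z, e'⟩
      · exact absurd e' (hh.ne _)
      · exact absurd e' hab
      · exact ⟨z, Or.inr (Or.inr ⟨e, e'.symm⟩)⟩
    · exact ⟨z, Or.inl e.symm⟩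
  choose h₀ h0 using hex
  refine ⟨h₀, ⟨fun x => ?_, fun x => ?_⟩, h0⟩
  · apply φ.inj
    rcases h0 x with e | ⟨e, e'⟩ | ⟨e, e'⟩
    · rcases h0 (h₀ x) with g | ⟨g, g'⟩ | ⟨g, g'⟩
      · rw [← g, ← e, hh.1]
      · rw [← e, hh.1] at g; exact absurd g (φ.map_ne_a _)
      · rw [← e, hh.1] at g; exact absurd g (φ.map_ne_b _)
    · rcases h0 (h₀ x) with g | ⟨g, g'⟩ | ⟨g, g'⟩
      · rw [← e', hh.1] at g; exact absurd g.symm (φ.map_ne_b _)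
      · rw [← e', hh.1] at g; exact absurd g.symm φ.a_ne_b
      · rw [← g', ← e, hh.1]
    · rcases h0 (h₀ x) with g | ⟨g, g'⟩ | ⟨g, g'⟩
      · rw [← e', hh.1] at g; exact absurd g.symm (φ.map_ne_a _)
      · rw [← g', ← e, hh.1]
      · rw [← e', hh.1] at g; exact absurd g φ.a_ne_b
  · have p1 := hh.2 (φ.map x)
    have p2 := hh.2 φ.a
    have p3 := hh.2 φ.b
    have p4 := φ.mod_two x
    have p5 := φ.mod_two (h₀ x)
    have p6 := φ.ab_mod_two
    rcases h0 x with e | ⟨e, e'⟩ | ⟨e, e'⟩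
    · rw [e] at p1; omega
    · rw [e] at p1; rw [e'] at p3; omega
    · rw [e] at p1; rw [e'] at p2; omega

theorem conn_iff (hn : 0 < n) {f h : Fin (2 * (n + 1)) → Fin (2 * (n + 1))}
    {f₀ h₀ : Fin (2 * n) → Fin (2 * n)} (hf : IsMatching f) (hh : IsMatching h)
    (hab : h φ.a = φ.b) (hφh : ∀ x, h (φ.map x) = φ.map (h₀ x))
    (hcap : CapRel φ.map φ.a φ.b f f₀) :
    Conn f h ↔ f φ.a ≠ φ.b ∧ Conn f₀ h₀ := by
  have : Nonempty (Fin (2 * n)) := ⟨⟨0, by omega⟩⟩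
  exact conn_cap φ.inj φ.map_ne_a φ.map_ne_b φ.cover hf.1 hh.1 (hf.ne _) (hf.ne _) hab hφh hcap

theorem not_conn (hn : 0 < n) {f h : Fin (2 * (n + 1)) → Fin (2 * (n + 1))} (hf : IsMatching f)
    (hh : IsMatching h) (hab : h φ.a = φ.b) (hfab : f φ.a = φ.b) : ¬ Conn f h := by
  intro H
  have := H {φ.a, φ.b} ⟨φ.a, by simp⟩ (by
    have e1 : f φ.b = φ.a := by rw [← hfab, hf.1]
    have e2 : h φ.b = φ.a := by rw [← hab, hh.1]
    rintro x (rfl | rfl)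
    · simp [hab, hfab]
    · simp [e1, e2])
  have h1 : φ.map ⟨0, by omega⟩ ∈ ({φ.a, φ.b} : Set _) := by rw [this]; trivial
  rcases h1 with h1 | h1
  · exact φ.map_ne_a _ h1
  · exact φ.map_ne_b _ h1

theorem capRel_skipAt {p : ℕ} {Γ : ChordDiagram n} {Γ' : ChordDiagram (n + 1)}
    (h : IsCap p Γ' Γ) :
    CapRel (skipAt p h.1).map (skipAt p h.1).a (skipAt p h.1).b Γ'.partner Γ.partner ∧
      Γ'.partner (skipAt p h.1).a ≠ (skipAt p h.1).b := by
  set φ := skipAt p h.1 with hφ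
  obtain ⟨h0, h1, h2, h3⟩ := h
  have hm : ∀ x, (φ.map x).val = skip p x := fun _ => rfl
  have hav : φ.a.val = p := rfl
  have hbv : φ.b.val = p + 1 := rfl
  have hab : Γ'.partner φ.a ≠ φ.b := by
    intro e
    apply h1
    rw [← hav, Γ'.val_fin, e, hbv, hav]
  have hba : Γ'.partner φ.b ≠ φ.a := fun e => hab (by rw [← e, Γ'.partner_partner])
  have hv : ∀ x y, Γ'.partner (φ.map x) = y ↔ Γ'.val (skip p x) = y.val := by
    intro x y
    rw [Fin.ext_iff, ← Γ'.val_fin, hm]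
  refine ⟨fun x => ?_, hab⟩
  rcases φ.cover (Γ'.partner (φ.map x)) with e | e | ⟨z, e⟩
  · rcases φ.cover (Γ'.partner φ.b) with e' | e' | ⟨z, e'⟩
    · exact absurd e' hba
    · exact absurd e' (Γ'.partner_ne _)
    · refine Or.inr (Or.inl ⟨e, ?_⟩)
      have h4 := h3 x x.isLt z z.isLt ((hv _ _).1 e)
        ((hv z φ.b).1 (by rw [e', Γ'.partner_partner]))
      rw [Γ.val_fin] at h4
      rw [← e', Fin.ext h4]
  · rcases φ.cover (Γ'.partner φ.a) with e' | e' | ⟨z, e'⟩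
    · exact absurd e' (Γ'.partner_ne _)
    · exact absurd e' hab
    · refine Or.inr (Or.inr ⟨e, ?_⟩)
      have h4 := h3 z z.isLt x x.isLt ((hv z φ.a).1 (by rw [e', Γ'.partner_partner]))
        ((hv _ _).1 e)
      rw [Γ.val_fin] at h4
      rw [← e', ← Fin.ext h4, Γ.partner_partner]
  · refine Or.inl ?_
    rw [hv, hm, ← Γ.val_fin]
    apply h2 x x.isLt
    · intro e1
      exact φ.map_ne_a z (by rw [e]; exact (hv _ _).2 e1)
    · intro e1
      exact φ.map_ne_b z (by rw [e]; exact (hv _ _).2 e1)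

/-- Insertion of the points `0`, `1`, the old points `0`, `1` becoming the last two points. -/
def dualMinus (hn : 0 < n) : Frame n where
  map q := ⟨if q.val < 2 then 2 * n + q else q, by have := q.isLt; split_ifs <;> omega⟩
  a := ⟨0, by omega⟩
  b := ⟨1, by omega⟩
  inj x y h := by
    have := congrArg Fin.val h
    have h1 := x.isLt
    have h2 := y.isLt
    ext
    simp only at this
    split_ifs at this <;> omega
  map_ne_a x := by simp only [ne_eq, Fin.ext_iff]; split_ifs <;> omega
  map_ne_b x := by simp only [ne_eq, Fin.ext_iff]; split_ifs <;> omega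
  a_ne_b := by simp
  cover y := by
    have := y.isLt
    simp only [Fin.ext_iff]
    by_cases h1 : y.val < 2
    · omega
    · by_cases h2 : y.val < 2 * n
      · exact Or.inr (Or.inr ⟨⟨y, h2⟩, by simp only; rw [if_neg h1]⟩)
      · exact Or.inr (Or.inr ⟨⟨y - 2 * n, by omega⟩, by simp only; rw [if_pos] <;> omega⟩)
  m x := x.val < 2
  lt_iff x y h := by
    have h1 := x.isLt
    have h2 := y.isLt
    simp only [ne_eq, Fin.ext_iff] at h
    simp only [Fin.lt_def]
    split_ifs <;> omega
  adj x y := by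
    simp only [Fin.lt_def]
    split_ifs <;> omega
  mod_two x := by simp only; split_ifs <;> omega
  ab_mod_two := by simp

/-- Insertion of the last point and the point `0`, the old last point becoming the point `1`. -/
def dualPlus (n : ℕ) : Frame n where
  map q := ⟨if q.val = 2 * n - 1 then 1 else q + 2, by have := q.isLt; split_ifs <;> omega⟩
  a := ⟨2 * n + 1, by omega⟩
  b := ⟨0, by omega⟩
  inj x y h := by
    have := congrArg Fin.val h
    have h1 := x.isLt
    have h2 := y.isLt
    ext
    simp only at this
    split_ifs at this <;> omega
  map_ne_a x := by
    have := x.isLt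
    simp only [ne_eq, Fin.ext_iff]; split_ifs <;> omega
  map_ne_b x := by simp only [ne_eq, Fin.ext_iff]; split_ifs <;> simp
  a_ne_b := by simp
  cover y := by
    have := y.isLt
    simp only [Fin.ext_iff]
    by_cases h1 : y.val = 0 ∨ y.val = 2 * n + 1
    · omega
    · by_cases h2 : y.val = 1
      · exact Or.inr (Or.inr ⟨⟨2 * n - 1, by omega⟩, by simp only [if_true]; omega⟩)
      · exact Or.inr (Or.inr ⟨⟨y - 2, by omega⟩, by simp only; rw [if_neg] <;> omega⟩)
  m x := x.val = 2 * n - 1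
  lt_iff x y h := by
    have h1 := x.isLt
    have h2 := y.isLt
    simp only [ne_eq, Fin.ext_iff] at h
    simp only [Fin.lt_def]
    split_ifs <;> omega
  adj x y := by
    have h1 := x.isLt
    have h2 := y.isLt
    simp only [Fin.lt_def]
    split_ifs <;> omega
  mod_two x := by
    have := x.isLt
    simp only; split_ifs <;> omega
  ab_mod_two := by simp only; omega

/-- Capping off `0` and `1` in `B₋ Γ` drags the chord at `1` along the outermost chord to the last
marked point. This returns `Γ`, with its points `0` and `1` relabelled as the last two points. -/
theorem capRel_dualMinus (hn : 0 < n) (Γ : ChordDiagram n) :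
    CapRel (dualMinus hn).map (dualMinus hn).a (dualMinus hn).b Γ.createMinus.partner
      Γ.partner := by
  intro x
  have hx := x.isLt
  have hy := (Γ.partner x).isLt
  have hne := Γ.partner_ne x
  have hval : ∀ z z' : Fin (2 * (n + 1)), Γ.createMinus.partner z = z' ↔
      Γ.createMinus.val z = z' := fun z z' => by rw [Fin.ext_iff, Γ.createMinus.val_fin]
  simp only [hval, dualMinus]
  have e0 : Γ.createMinus.val 0 = 2 * n + 1 := by rw [val_createMinus _ (by omega), if_pos rfl]
  have e1 : Γ.createMinus.val (2 * n + 1) = 0 := by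
    rw [val_createMinus _ (by omega), if_neg (by omega), if_pos rfl]
  have e2 : Γ.createMinus.val (2 * n) = if Γ.val 0 = 0 then 2 * n else Γ.val 0 := by
    rw [val_createMinus _ (by omega), if_neg (by omega), if_neg (by omega)]
    simp
  have e3 : ∀ z, 0 < z → z < 2 * n →
      Γ.createMinus.val z = if Γ.val z = 0 then 2 * n else Γ.val z := by
    intro z h1 h2
    rw [val_createMinus _ (by omega), if_neg (by omega), if_neg (by omega)]
    simp [show z ≠ 2 * n by omega]
  have hxv := Γ.val_fin x
  simp only [ne_eq, Fin.ext_iff] at hne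
  generalize (Γ.partner x).val = y at *
  generalize x.val = z at *
  rw [e0]
  have h01 := e3 1 (by omega) (by omega)
  rcases Nat.lt_or_ge z 2 with hz | hz
  · rw [if_pos hz]
    rcases (by omega : z = 0 ∨ z = 1) with rfl | rfl
    · simp only [Nat.add_zero, e2, hxv]
      split_ifs <;> omega
    · rw [e1, h01, hxv]
      split_ifs <;> omega
  · rw [if_neg (by omega), e3 z (by omega) hx, hxv]
    split_ifs <;> omega

theorem capRel_dualPlus (Γ : ChordDiagram n) :
    CapRel (dualPlus n).map (dualPlus n).a (dualPlus n).b Γ.createPlus.partner Γ.partner := by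
  intro x
  have hx := x.isLt
  have hy := (Γ.partner x).isLt
  have hne := Γ.partner_ne x
  have hval : ∀ z z' : Fin (2 * (n + 1)), Γ.createPlus.partner z = z' ↔
      Γ.createPlus.val z = z' := fun z z' => by rw [Fin.ext_iff, Γ.createPlus.val_fin]
  simp only [hval, dualPlus]
  have e0 : Γ.createPlus.val 0 = 1 := by rw [val_createPlus _ (by omega)]; simp
  have e1 : Γ.createPlus.val 1 = 0 := by rw [val_createPlus _ (by omega)]; simp
  have e2 : ∀ z, z < 2 * n → Γ.createPlus.val (z + 2) = Γ.val z + 2 := by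
    intro z hz
    rw [val_createPlus _ (by omega), if_neg (by omega), Nat.add_sub_cancel]
  have e3 := e2 (2 * n - 1) (by omega)
  rw [show 2 * n - 1 + 2 = 2 * n + 1 by omega] at e3
  have hxv := Γ.val_fin x
  simp only [ne_eq, Fin.ext_iff] at hne
  generalize (Γ.partner x).val = y at *
  generalize x.val = z at *
  rw [e0, e3]
  by_cases hz : z = 2 * n - 1
  · rw [if_pos hz, e1, ← hz, hxv]
    split_ifs <;> omega
  · rw [if_neg hz, e2 z hx, hxv]
    split_ifs <;> omega

end Frame

/-! ### The dual basis -/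

/-- The dual matching gets, for each symbol, a chord between the base point and the neighbour to
which the other creation map would join it. A wrong first symbol then produces a closed component;
with the right one, capping off removes the outermost chord and leaves the tail of the word. -/
theorem exists_dual {n : ℕ} (w : Word n) : ∃ h : Fin (2 * (n + 1)) → Fin (2 * (n + 1)),
    IsMatching h ∧ ∀ w' : Word n, Conn (basisDiagram w').partner h ↔ w' = w := by
  induction w using Word.consInduction with
  | nil w =>
    refine ⟨vacuum.partner, vacuum.isMatching, fun w' => ?_⟩
    refine iff_of_true ?_ (Subsingleton.elim _ _)
    rintro S ⟨y, hy⟩ hS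
    ext z
    simp only [Set.mem_univ, iff_true]
    have h1 : Fin.rev y ∈ S := (hS y hy).2
    revert h1 hy
    have hz : z = y ∨ z = Fin.rev y := by revert z y; decide
    rcases hz with rfl | rfl <;> tauto
  | @plus n u ih =>
    obtain ⟨h, hh, hd⟩ := ih
    obtain ⟨h', hh', hab, hm⟩ := (Frame.dualPlus (n + 1)).exists_insertMatching hh
    refine ⟨h', hh', fun w' => ?_⟩
    rw [← Word.cons_head_tail w']
    cases w' 0
    · rw [basisDiagram_minus]
      refine iff_of_false ?_ ?_
      · refine Frame.not_conn _ (by omega) (ChordDiagram.isMatching _) hh' hab ?_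
        simp only [Frame.dualPlus, createMinus, or_true, dite_true, Fin.ext_iff, Fin.val_rev]
        omega
      · intro e
        exact absurd (congrFun e 0) (by simp)
    · rw [basisDiagram_plus, Frame.conn_iff _ (by omega) (ChordDiagram.isMatching _) hh' hab hm
        (Frame.capRel_dualPlus _), hd]
      constructor
      · rintro ⟨-, e⟩; rw [e]
      · intro e
        refine ⟨?_, ?_⟩
        · simp [Frame.dualPlus, createPlus]
        · have := congrArg Fin.tail e
          simpa using this
  | @minus n u ih =>
    obtain ⟨h, hh, hd⟩ := ih
    obtain ⟨h', hh', hab, hm⟩ :=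
      (Frame.dualMinus (n := n + 1) (by omega)).exists_insertMatching hh
    refine ⟨h', hh', fun w' => ?_⟩
    rw [← Word.cons_head_tail w']
    cases w' 0
    · rw [basisDiagram_minus, Frame.conn_iff _ (by omega) (ChordDiagram.isMatching _) hh' hab hm
        (Frame.capRel_dualMinus _ _), hd]
      constructor
      · rintro ⟨-, e⟩; rw [e]
      · intro e
        refine ⟨?_, ?_⟩
        · simp only [Frame.dualMinus, createMinus, true_or, dite_true, Fin.ext_iff, Fin.val_rev,
            ne_eq]
          omega
        · have := congrArg Fin.tail e
          simpa using this
    · rw [basisDiagram_plus]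
      refine iff_of_false ?_ ?_
      · refine Frame.not_conn _ (by omega) (ChordDiagram.isMatching _) hh' hab ?_
        simp [Frame.dualMinus, createPlus]
      · intro e
        exact absurd (congrFun e 0) (by simp)

/-! ### The classes of the basis chord diagrams form a basis -/

namespace Frame

variable {n : ℕ} (φ : Frame n)

theorem Inserts.unique {φ : Frame n} {Γ : ChordDiagram n} {Γ₁ Γ₂ : ChordDiagram (n + 1)}
    (h1 : φ.Inserts Γ Γ₁) (h2 : φ.Inserts Γ Γ₂) : Γ₁ = Γ₂ := by
  ext1
  funext y
  rcases φ.cover y with rfl | rfl | ⟨x, rfl⟩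
  · rw [h1.1, h2.1]
  · rw [← h1.1, Γ₁.partner_partner, h1.1, ← h2.1, Γ₂.partner_partner]
  · rw [h1.2, h2.2]

theorem exists_inserts {Γ' : ChordDiagram (n + 1)} (h : Γ'.partner φ.a = φ.b) :
    ∃ Γ : ChordDiagram n, φ.Inserts Γ Γ' := by
  have hb : Γ'.partner φ.b = φ.a := by rw [← h, Γ'.partner_partner]
  have hex : ∀ x, ∃ z, φ.map z = Γ'.partner (φ.map x) := by
    intro x
    rcases φ.cover (Γ'.partner (φ.map x)) with e | e | e
    · rw [← hb] at e
      exact absurd (Γ'.partner_injective e) (φ.map_ne_b x)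
    · rw [← h] at e
      exact absurd (Γ'.partner_injective e) (φ.map_ne_a x)
    · exact e
  choose g hg using hex
  have hgg : ∀ x, g (g x) = x := fun x => φ.inj (by rw [hg, hg, Γ'.partner_partner])
  refine ⟨⟨g, hgg, fun x e => Γ'.partner_ne (φ.map x) (by rw [← hg, e]), ?_⟩, h,
    fun q => (hg q).symm⟩
  intro x y h1 h2
  have h3 : y ≠ x := h1.ne'
  have h4 : y ≠ g x := h2.ne
  have h5 : g y ≠ g x := fun e => h3 (by rw [← hgg y, e, hgg])
  have h6 : g y ≠ x := fun e => h4 (by rw [← e, hgg])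
  have h7 := Γ'.sep (x := φ.map x) (y := φ.map y) (fun e => h3 (φ.inj e))
    (fun e => h4 (φ.inj (by rw [e, hg])))
  rw [← hg, ← hg, φ.lt_iff _ _ h3.symm, φ.lt_iff _ _ h4.symm, φ.lt_iff _ _ h6.symm,
    φ.lt_iff _ _ h5.symm, iff_parity_cancel, iff_parity_cancel] at h7
  -- The marks contribute the same summand `m x ↔ m (g x)` to both sides, so they cancel.
  have h8 : (x < y ↔ g x < y) ↔ (x < g y ↔ g x < g y) := by
    generalize (x < y ↔ g x < y) = A at h7 ⊢
    generalize (x < g y ↔ g x < g y) = B at h7 ⊢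
    generalize (φ.m x ↔ φ.m (g x)) = C at h7
    tauto
  simp only [Fin.lt_def, Fin.ext_iff, ne_eq] at *
  omega

end Frame

namespace ChordDiagram

variable {n : ℕ}

theorem eq_createPlus {Γ' : ChordDiagram (n + 1)} (h : Γ'.val 0 = 1) :
    ∃ Γ : ChordDiagram n, Γ' = Γ.createPlus := by
  obtain ⟨Γ, hΓ⟩ := (Frame.skipAt (n := n) 0 (by omega)).exists_inserts (Γ' := Γ') (by
    ext
    rw [← Γ'.val_fin]
    exact h)
  exact ⟨Γ, hΓ.unique (Frame.skipAt_inserts Γ.isInsert_createPlus)⟩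

theorem eq_createMinus {Γ' : ChordDiagram (n + 1)} (h : Γ'.val 0 = 2 * n + 1) :
    ∃ Γ : ChordDiagram n, Γ' = Γ.createMinus := by
  obtain ⟨Γ, hΓ⟩ := (Frame.minus n).exists_inserts (Γ' := Γ') (by
    ext
    rw [← Γ'.val_fin]
    exact h)
  exact ⟨Γ, hΓ.unique (Frame.minus_inserts Γ)⟩

theorem eq_vacuum (Γ : ChordDiagram 1) : Γ = vacuum := by
  ext1
  funext x
  have h := Γ.partner_ne x
  have : ∀ x y : Fin (2 * 1), y ≠ x → y = Fin.rev x := by decide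
  exact this _ _ h

end ChordDiagram

theorem BypassTriple.create {n : ℕ} {Γ Γ' Γ'' : ChordDiagram n} (s : Sgn)
    (h : BypassTriple Γ Γ' Γ'') :
    BypassTriple (ChordDiagram.create s Γ) (ChordDiagram.create s Γ')
      (ChordDiagram.create s Γ'') := by
  cases s
  · exact Surgery.insert h (Frame.minus n) (Frame.minus_inserts _) (Frame.minus_inserts _)
      (Frame.minus_inserts _)
  · exact Surgery.insert h (Frame.skipAt 0 (by omega))
      (Frame.skipAt_inserts (ChordDiagram.isInsert_createPlus _))
      (Frame.skipAt_inserts (ChordDiagram.isInsert_createPlus _))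
      (Frame.skipAt_inserts (ChordDiagram.isInsert_createPlus _))

theorem BypassTriple.sum_eq_zero {n : ℕ} {Γ Γ' Γ'' : ChordDiagram n} (h : BypassTriple Γ Γ' Γ'') :
    Γ.toSFH + Γ'.toSFH + Γ''.toSFH = 0 := by
  have : Finsupp.single Γ 1 + Finsupp.single Γ' 1 + Finsupp.single Γ'' 1 ∈ bypassRelations n :=
    Submodule.subset_span ⟨Γ, Γ', Γ'', h, rfl⟩
  exact (Submodule.Quotient.mk_eq_zero _).2 this

/-- The linear map on `SFHcomb` induced by a creation map. -/
noncomputable def createSFH {n : ℕ} (s : Sgn) : SFHcomb n →ₗ[ZMod 2] SFHcomb (n + 1) :=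
  (bypassRelations n).liftQ
    (Finsupp.linearCombination (ZMod 2) fun Γ : ChordDiagram n =>
      (ChordDiagram.create s Γ).toSFH) (by
      rw [bypassRelations, Submodule.span_le]
      rintro x ⟨Γ, Γ', Γ'', H, rfl⟩
      simp only [SetLike.mem_coe, LinearMap.mem_ker, map_add, Finsupp.linearCombination_single,
        one_smul]
      exact (H.create s).sum_eq_zero)

theorem createSFH_toSFH {n : ℕ} (s : Sgn) (Γ : ChordDiagram n) :
    createSFH s Γ.toSFH = (ChordDiagram.create s Γ).toSFH := by
  rw [createSFH, ChordDiagram.toSFH]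
  erw [Submodule.liftQ_apply]
  simp

theorem SFHcomb.add_self {n : ℕ} (x : SFHcomb n) : x + x = 0 := by
  have : (2 : ZMod 2) • x = 0 := by
    rw [show (2 : ZMod 2) = 0 by decide, zero_smul]
  rwa [two_smul] at this

namespace ChordDiagram

variable {n : ℕ}

theorem ends_injective {A : ChordDiagram n} {P : Fin 3 → Fin (2 * n)} (hP : Function.Injective P)
    (h : ∀ i i', A.partner (P i) ≠ P i') : Function.Injective (A.ends P) := by
  intro j j' e
  obtain ⟨i, rfl | rfl⟩ := exists_castAdd j <;> obtain ⟨i', rfl | rfl⟩ := exists_castAdd j'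
  · rw [ends_castAdd, ends_castAdd] at e
    rw [hP e]
  · rw [ends_rev, ends_castAdd, ends_castAdd] at e
    exact absurd e.symm (h _ _)
  · rw [ends_rev, ends_castAdd, ends_castAdd] at e
    exact absurd e (h _ _)
  · rw [ends_rev, ends_rev, ends_castAdd, ends_castAdd] at e
    rw [hP (A.partner_injective e)]

theorem isCollarArc_mk (hn : 1 < n) {p q r : Fin (2 * n)} (h1 : Consec p q) (h2 : Consec q r) :
    IsCollarArc ![p, q, r] := by
  refine ⟨?_, h1, h2⟩
  have hpq : p ≠ q := fun e => h1.mod_two (by rw [e])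
  have hqr : q ≠ r := fun e => h2.mod_two (by rw [e])
  have hpr : p ≠ r := by
    rintro rfl
    simp only [Consec] at h1 h2
    omega
  intro i j h
  fin_cases i <;> fin_cases j <;> simp_all

/-- For consecutive points, the first and the third are never joined. -/
theorem IsCollarArc.ends_injective {P : Fin 3 → Fin (2 * n)} (hP : IsCollarArc P)
    {A : ChordDiagram n} (h01 : A.partner (P 0) ≠ P 1) (h12 : A.partner (P 1) ≠ P 2) :
    Function.Injective (A.ends P) := by
  apply ChordDiagram.ends_injective hP.1
  have h02 : A.partner (P 0) ≠ P 2 := by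
    intro e
    have h1 := A.partner_mod_two (P 0)
    have h2 := hP.2.1.mod_two
    have h3 := hP.2.2.mod_two
    rw [e] at h1
    omega
  have sy : ∀ {p q}, A.partner p ≠ q → A.partner q ≠ p := fun h e => h (A.partner_eq_iff.1 e)
  intro i i'
  fin_cases i <;> fin_cases i'
  · exact A.partner_ne _
  · exact h01
  · exact h02
  · exact sy h01
  · exact A.partner_ne _
  · exact h12
  · exact sy h02
  · exact sy h12
  · exact A.partner_ne _

theorem bypassTriple_of_isCollar {P : Fin 3 → Fin (2 * n)} (hP : IsCollarArc P)
    {A U D : ChordDiagram n} (hA : Function.Injective (A.ends P))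
    (hU : IsCollar Direction.up P A U) (hD : IsCollar Direction.down P A D) :
    BypassTriple A U D := by
  have := (Surgery.empty A).collar hP hA hA hU hD
  exact this.reindex (Equiv.ofUnique Unit (Option Empty))

/-- If the base point is not joined to a neighbour, surgery along the arc around it joins it to one
neighbour or to the other, depending on the direction. The bypass relation then writes `Γ` as the
sum of a diagram in the image of `B₋` and one in the image of `B₊`. -/
theorem toSFH_mem_span {n : ℕ} (Γ : ChordDiagram (n + 1)) :
    Γ.toSFH ∈ Submodule.span (ZMod 2) (Set.range fun w : Word n => (basisDiagram w).toSFH) := by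
  induction n with
  | zero =>
    rw [Γ.eq_vacuum]
    exact Submodule.subset_span ⟨fun i => i.elim0, rfl⟩
  | succ n ih =>
    have hcreate : ∀ (s : Sgn) (Y : ChordDiagram (n + 1)), (ChordDiagram.create s Y).toSFH ∈
        Submodule.span (ZMod 2) (Set.range fun w : Word (n + 1) => (basisDiagram w).toSFH) := by
      intro s Y
      rw [← createSFH_toSFH]
      have := Submodule.mem_map_of_mem (f := createSFH s) (ih Y)
      rw [Submodule.map_span] at this
      refine Submodule.span_mono ?_ this
      rintro _ ⟨_, ⟨w, rfl⟩, rfl⟩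
      refine ⟨Word.cons s w, ?_⟩
      simp only [createSFH_toSFH]
      rfl
    by_cases h1 : Γ.val 0 = 1
    · obtain ⟨Y, rfl⟩ := eq_createPlus h1
      exact hcreate Sgn.plus Y
    by_cases h2 : Γ.val 0 = 2 * (n + 1) + 1
    · obtain ⟨Y, rfl⟩ := eq_createMinus h2
      exact hcreate Sgn.minus Y
    let P : Fin 3 → Fin (2 * (n + 1 + 1)) :=
      ![⟨2 * (n + 1) + 1, by omega⟩, ⟨0, by omega⟩, ⟨1, by omega⟩]
    have hP : IsCollarArc P := isCollarArc_mk (by omega) (Or.inr ⟨by simp only; omega, rfl⟩)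
      (Or.inl rfl)
    have hgen : Function.Injective (Γ.ends P) := by
      refine hP.ends_injective (fun e => h2 ?_) (fun e => h1 ?_)
      · rw [partner_eq_iff] at e
        rw [Γ.val_of_lt (by omega)]
        exact congrArg Fin.val e
      · rw [Γ.val_of_lt (by omega)]
        exact congrArg Fin.val e
    obtain ⟨U, hU⟩ := exists_isCollar Direction.up hP hgen
    obtain ⟨D, hD⟩ := exists_isCollar Direction.down hP hgen
    have hsum := (bypassTriple_of_isCollar hP hgen hU hD).sum_eq_zero
    have hU0 : U.val 0 = 2 * (n + 1) + 1 := by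
      rw [U.val_of_lt (by omega)]
      exact congrArg Fin.val (hU.1 1)
    have hD0 : D.val 0 = 1 := by
      rw [D.val_of_lt (by omega)]
      exact congrArg Fin.val (hD.1 1)
    obtain ⟨Y, rfl⟩ := eq_createMinus hU0
    obtain ⟨Y', rfl⟩ := eq_createPlus hD0
    have : Γ.toSFH = Y.createMinus.toSFH + Y'.createPlus.toSFH := by
      rw [add_assoc Γ.toSFH] at hsum
      rw [eq_neg_of_add_eq_zero_left hsum, neg_eq_iff_add_eq_zero]
      exact SFHcomb.add_self _
    rw [this]
    exact Submodule.add_mem _ (hcreate Sgn.minus Y) (hcreate Sgn.plus Y')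

end ChordDiagram

/-! ### Basis decompositions read off from the dual matchings -/

/-- The matching giving the functional dual to the basis element of a word. -/
noncomputable def dualMatching {n : ℕ} (w : Word n) : Fin (2 * (n + 1)) → Fin (2 * (n + 1)) :=
  (exists_dual w).choose

theorem isMatching_dualMatching {n : ℕ} (w : Word n) : IsMatching (dualMatching w) :=
  (exists_dual w).choose_spec.1

theorem conn_dualMatching {n : ℕ} (w w' : Word n) :
    Conn (basisDiagram w').partner (dualMatching w) ↔ w' = w :=
  (exists_dual w).choose_spec.2 w'

theorem connVal_dualMatching {n : ℕ} (w w' : Word n) :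
    connVal (dualMatching w) (basisDiagram w').partner = if w' = w then 1 else 0 := by
  simp only [connVal, conn_dualMatching]

theorem basisDiagram_injective {n : ℕ} : Function.Injective (basisDiagram (n := n)) := by
  intro w w' h
  have := (conn_dualMatching w' w').2 rfl
  rw [← h] at this
  exact (conn_dualMatching w' w).1 this

instance : Fintype Sgn := ⟨{Sgn.minus, Sgn.plus}, by rintro (_ | _) <;> simp⟩

/-- The words in the basis decomposition of a chord diagram. -/
noncomputable def basisSupport {n : ℕ} (Γ : ChordDiagram (n + 1)) : Finset (Word n) :=
  open Classical in Finset.univ.filter fun w => Conn Γ.partner (dualMatching w)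

theorem mem_basisSupport {n : ℕ} {Γ : ChordDiagram (n + 1)} {w : Word n} :
    w ∈ basisSupport Γ ↔ Conn Γ.partner (dualMatching w) := by
  simp [basisSupport]

theorem evalSFH_sum {n : ℕ} {h : Fin (2 * (n + 1)) → Fin (2 * (n + 1))} (hh : IsMatching h)
    {Γ : ChordDiagram (n + 1)} {S : Finset (Word n)} (hS : IsBasisDecomposition Γ S) :
    connVal h Γ.partner = ∑ w ∈ S, connVal h (basisDiagram w).partner := by
  rw [← evalSFH_toSFH hh, hS, map_sum]
  exact Finset.sum_congr rfl fun w _ => evalSFH_toSFH hh _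

theorem IsBasisDecomposition.eq_basisSupport {n : ℕ} {Γ : ChordDiagram (n + 1)}
    {S : Finset (Word n)} (hS : IsBasisDecomposition Γ S) : S = basisSupport Γ := by
  ext w
  have := evalSFH_sum (isMatching_dualMatching w) hS
  simp only [connVal_dualMatching, Finset.sum_ite_eq'] at this
  rw [mem_basisSupport]
  simp only [connVal] at this
  by_cases h1 : Conn Γ.partner (dualMatching w) <;> by_cases h2 : w ∈ S <;> simp_all

/-- Spanning gives some decomposition, the coefficients being `0` or `1`; the dual functionals
identify it. -/
theorem isBasisDecomposition_basisSupport {n : ℕ} (Γ : ChordDiagram (n + 1)) :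
    IsBasisDecomposition Γ (basisSupport Γ) := by
  have h := Γ.toSFH_mem_span
  rw [Submodule.mem_span_range_iff_exists_fun] at h
  obtain ⟨c, hc⟩ := h
  have key : IsBasisDecomposition Γ (Finset.univ.filter fun w => c w = 1) := by
    rw [IsBasisDecomposition, ← hc, Finset.sum_filter]
    refine Finset.sum_congr rfl fun w _ => ?_
    have : ∀ x : ZMod 2, x = 0 ∨ x = 1 := by decide
    rcases this (c w) with h | h <;> simp [h]
  rwa [← key.eq_basisSupport]

/-- The words of a chord diagram with a given minimum and maximum. -/
def MinMax {n : ℕ} (Γ : ChordDiagram (n + 1)) (w₁ w₂ : Word n) : Prop :=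
  w₁ ∈ basisSupport Γ ∧ w₂ ∈ basisSupport Γ ∧
    ∀ w ∈ basisSupport Γ, Word.Dom w₁ w ∧ Word.Dom w w₂

theorem MinMax.hasMinMax {n : ℕ} {Γ : ChordDiagram (n + 1)} {w₁ w₂ : Word n}
    (h : MinMax Γ w₁ w₂) : HasMinMax Γ w₁ w₂ :=
  ⟨basisSupport Γ, isBasisDecomposition_basisSupport Γ, fun _ hS => hS.eq_basisSupport, h.1, h.2.1,
    fun w hw => ⟨(Word.prec_iff_dom _ _).2 (h.2.2 w hw).1, (Word.prec_iff_dom _ _).2 (h.2.2 w hw).2⟩⟩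

/-! ### Insertion of a chord and basis decompositions -/

theorem connVal_congr {α β : Type*} {f h : α → α} {f' h' : β → β} (e : Conn f h ↔ Conn f' h') :
    connVal h f = connVal h' f' := by
  by_cases h1 : Conn f h
  · rw [connVal, connVal, if_pos h1, if_pos (e.1 h1)]
  · rw [connVal, connVal, if_neg h1, if_neg fun h2 => h1 (e.2 h2)]

namespace Frame

variable {n : ℕ} (φ : Frame n)

theorem exists_insert (Γ : ChordDiagram n) : ∃ Γ', φ.Inserts Γ Γ' := by
  obtain ⟨h, hh, hab, hm⟩ := φ.exists_insertMatching Γ.isMatching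
  have hba : h φ.b = φ.a := by rw [← hab, hh.1]
  have hsep : ∀ x y, y ≠ x → y ≠ h x → ((x < y ↔ h x < y) ↔ (x < h y ↔ h x < h y)) := by
    intro x y h1 h2
    rcases φ.cover x with rfl | rfl | ⟨x, rfl⟩
    · rw [hab] at h2 ⊢
      rcases φ.cover y with rfl | rfl | ⟨y, rfl⟩
      · exact absurd rfl h1
      · exact absurd rfl h2
      · rw [hm]; exact φ.adj _ _
    · rw [hba] at h2 ⊢
      rcases φ.cover y with rfl | rfl | ⟨y, rfl⟩
      · exact absurd rfl h2
      · exact absurd rfl h1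
      · rw [hm, iff_comm (a := φ.b < _), iff_comm (a := φ.b < _)]; exact φ.adj _ _
    · rw [hm] at h2 ⊢
      rcases φ.cover y with rfl | rfl | ⟨y, rfl⟩
      · rw [hab]
        exact ChordDiagram.sep_swap (φ.map_ne_a _) (φ.map_ne_b _) (φ.map_ne_a _) (φ.map_ne_b _)
          (φ.adj _ _)
      · rw [hba]
        refine ChordDiagram.sep_swap (φ.map_ne_b _) (φ.map_ne_a _) (φ.map_ne_b _) (φ.map_ne_a _) ?_
        rw [iff_comm (a := φ.b < _), iff_comm (a := φ.b < _)]
        exact φ.adj _ _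
      · rw [hm]
        have h3 : y ≠ x := fun e => h1 (by rw [e])
        have h4 : y ≠ Γ.partner x := fun e => h2 (by rw [e])
        have h5 : Γ.partner y ≠ Γ.partner x := fun e => h3 (Γ.partner_injective e)
        have h6 : Γ.partner y ≠ x := fun e => h4 (Γ.partner_eq_iff.1 e).symm
        rw [φ.lt_iff _ _ h3.symm, φ.lt_iff _ _ h4.symm, φ.lt_iff _ _ h6.symm,
          φ.lt_iff _ _ h5.symm, iff_parity_cancel, iff_parity_cancel, Γ.sep h3 h4]
  refine ⟨⟨h, hh.1, hh.ne, ?_⟩, hab, hm⟩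
  intro x y h1 h2
  have h3 := hsep x y h1.ne' h2.ne
  have h4 : h y ≠ h x := fun e => h1.ne' (hh.1.injective e)
  simp only [Fin.lt_def, Fin.ext_iff, ne_eq] at *
  omega

theorem Inserts.unique_old {φ : Frame n} {Γ₁ Γ₂ : ChordDiagram n} {Γ' : ChordDiagram (n + 1)}
    (h1 : φ.Inserts Γ₁ Γ') (h2 : φ.Inserts Γ₂ Γ') : Γ₁ = Γ₂ := by
  ext1
  funext x
  exact φ.inj (by rw [← h1.2, h2.2])

/-- `Γ` is obtained from `Γ'` by joining the chords at two adjacent points. -/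
def Caps (φ : Frame n) (Γ' : ChordDiagram (n + 1)) (Γ : ChordDiagram n) : Prop :=
  CapRel φ.map φ.a φ.b Γ'.partner Γ.partner ∧ Γ'.partner φ.a ≠ φ.b

theorem Caps.unique {φ : Frame n} {Γ' : ChordDiagram (n + 1)} {Γ₁ Γ₂ : ChordDiagram n}
    (h1 : φ.Caps Γ' Γ₁) (h2 : φ.Caps Γ' Γ₂) : Γ₁ = Γ₂ := by
  ext1
  funext x
  apply φ.inj
  have hab := φ.a_ne_b
  rcases h1.1 x with e | e | e <;> rcases h2.1 x with g | g | g
  · rw [← e, g]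
  · rw [g.1] at e; exact absurd e.symm (φ.map_ne_a _)
  · rw [g.1] at e; exact absurd e.symm (φ.map_ne_b _)
  · rw [e.1] at g; exact absurd g.symm (φ.map_ne_a _)
  · rw [← e.2, g.2]
  · exact absurd (e.1.symm.trans g.1) hab
  · rw [e.1] at g; exact absurd g.symm (φ.map_ne_b _)
  · exact absurd (g.1.symm.trans e.1) hab
  · rw [← e.2, g.2]

/-- Matchings pull back along the insertion of a chord. -/
theorem exists_connVal_inserts (hn : 0 < n) {h : Fin (2 * (n + 1)) → Fin (2 * (n + 1))}
    (hh : IsMatching h) :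
    (∀ Γ Γ', φ.Inserts Γ Γ' → connVal h Γ'.partner = 0) ∨
    ∃ h₀, IsMatching h₀ ∧ ∀ Γ Γ', φ.Inserts Γ Γ' →
      connVal h Γ'.partner = connVal h₀ Γ.partner := by
  by_cases hab : h φ.a = φ.b
  · refine Or.inl fun Γ Γ' hΓ => ?_
    rw [connVal, if_neg (φ.not_conn hn Γ'.isMatching hh hab hΓ.1)]
  · obtain ⟨h₀, hh₀, hc⟩ := φ.exists_capMatching hh hab
    refine Or.inr ⟨h₀, hh₀, fun Γ Γ' hΓ => ?_⟩
    have := φ.conn_iff hn hh Γ'.isMatching hΓ.1 hΓ.2 hc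
    rw [conn_comm, conn_comm (f := h₀)] at this
    exact connVal_congr (this.trans (and_iff_right hab))

/-- Matchings pull back along capping off two points. -/
theorem exists_connVal_caps (hn : 0 < n) {h₀ : Fin (2 * n) → Fin (2 * n)} (hh : IsMatching h₀) :
    ∃ h, IsMatching h ∧ (∀ Γ' : ChordDiagram (n + 1), Γ'.partner φ.a = φ.b →
      connVal h Γ'.partner = 0) ∧
      ∀ Γ' Γ, φ.Caps Γ' Γ → connVal h₀ Γ.partner = connVal h Γ'.partner := by
  obtain ⟨h, hh', hab, hm⟩ := φ.exists_insertMatching hh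
  refine ⟨h, hh', fun Γ' hΓ => ?_, fun Γ' Γ hΓ => ?_⟩
  · rw [connVal, if_neg (φ.not_conn hn Γ'.isMatching hh' hab hΓ)]
  · have := φ.conn_iff hn Γ'.isMatching hh' hab hm hΓ.1
    exact (connVal_congr (this.trans (and_iff_right hΓ.2))).symm

end Frame

/-! ### Basis chord diagrams viewed from either side -/

/-- Words are left unchanged for upwards surgery, their signs are exchanged for downwards
surgery. -/
def Direction.view (d : Direction) {n : ℕ} (w : Word n) : Word n :=
  match d with
  | Direction.up => w
  | Direction.down => w.swap

namespace Direction

variable (d : Direction) {n : ℕ}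

/-- The opposite direction. -/
def flip : Direction → Direction
  | up => down
  | down => up

theorem view_view (w : Word n) : d.view (d.view w) = w := by
  cases d
  · rfl
  · simp [view]

/-- The basis chord diagram of the word seen in direction `d`. -/
noncomputable def diagram (w : Word n) : ChordDiagram (n + 1) := basisDiagram (d.view w)

/-- The matching dual to `diagram`. -/
noncomputable def dual (w : Word n) : Fin (2 * (n + 1)) → Fin (2 * (n + 1)) :=
  dualMatching (d.view w)

theorem conn_dual (w w' : Word n) : Conn (d.diagram w').partner (d.dual w) ↔ w' = w := by
  rw [diagram, dual, conn_dualMatching]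
  exact ⟨fun h => by rw [← d.view_view w', h, d.view_view], fun h => by rw [h]⟩

theorem connVal_dual (w w' : Word n) :
    connVal (d.dual w) (d.diagram w').partner = if w' = w then 1 else 0 := by
  simp only [connVal, conn_dual]

theorem isMatching_dual (w : Word n) : IsMatching (d.dual w) := isMatching_dualMatching _

theorem diagram_injective : Function.Injective (d.diagram (n := n)) := by
  intro w w' h
  have := basisDiagram_injective h
  rw [← d.view_view w, this, d.view_view]

/-- The words in the basis decomposition of a chord diagram. -/
noncomputable def support (Γ : ChordDiagram (n + 1)) : Finset (Word n) :=
  open Classical in Finset.univ.filter fun w => Conn Γ.partner (d.dual w)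

theorem mem_support {Γ : ChordDiagram (n + 1)} {w : Word n} :
    w ∈ d.support Γ ↔ Conn Γ.partner (d.dual w) := by
  simp [support]

theorem mem_support_iff {Γ : ChordDiagram (n + 1)} {w : Word n} :
    w ∈ d.support Γ ↔ connVal (d.dual w) Γ.partner = 1 := by
  rw [mem_support, connVal]
  split_ifs with h <;> simp [h]

theorem connVal_of_notMem {Γ : ChordDiagram (n + 1)} {w : Word n} (h : w ∉ d.support Γ) :
    connVal (d.dual w) Γ.partner = 0 := by
  rw [mem_support] at h
  rw [connVal, if_neg h]

theorem connVal_eq_sum {h : Fin (2 * (n + 1)) → Fin (2 * (n + 1))} (hh : IsMatching h)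
    (Γ : ChordDiagram (n + 1)) :
    connVal h Γ.partner = ∑ w ∈ d.support Γ, connVal h (d.diagram w).partner := by
  rw [evalSFH_sum hh (isBasisDecomposition_basisSupport Γ)]
  refine Finset.sum_bij' (fun w _ => d.view w) (fun w _ => d.view w) ?_ ?_ ?_ ?_ ?_
  · intro w hw
    rw [mem_support, dual, d.view_view]
    exact mem_basisSupport.1 hw
  · intro w hw
    exact mem_basisSupport.2 (d.mem_support.1 hw)
  · exact fun w _ => d.view_view w
  · exact fun w _ => d.view_view w
  · intro w _
    rw [diagram, d.view_view]

theorem support_diagram (w : Word n) : d.support (d.diagram w) = {w} := by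
  ext u
  rw [mem_support, conn_dual, Finset.mem_singleton, eq_comm]

/-- Insertion of a chord acts on basis decompositions as it acts on basis chord diagrams. -/
theorem support_insert {φ : Frame (n + 1)} {D : ChordDiagram (n + 1)} {D' : ChordDiagram (n + 2)}
    (hD : φ.Inserts D D') {g : Word n → Word (n + 1)}
    (hg : ∀ u ∈ d.support D, φ.Inserts (d.diagram u) (d.diagram (g u))) :
    (∀ u ∈ d.support D, g u ∈ d.support D') ∧
      ∀ w ∈ d.support D', ∃ u ∈ d.support D, g u = w := by
  -- Pulling `h` back to a matching of fewer points, or to zero, makes the insertion linear without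
  -- a map between the `SFHcomb` spaces.
  have key : ∀ h, IsMatching h →
      connVal h D'.partner = ∑ u ∈ d.support D, connVal h (d.diagram (g u)).partner := by
    intro h hh
    rcases φ.exists_connVal_inserts (by omega) hh with H | ⟨h₀, hh₀, H⟩
    · rw [H _ _ hD]
      exact (Finset.sum_eq_zero fun u hu => H _ _ (hg u hu)).symm
    · rw [H _ _ hD, d.connVal_eq_sum hh₀]
      exact Finset.sum_congr rfl fun u hu => (H _ _ (hg u hu)).symm
  have hinj : ∀ u ∈ d.support D, ∀ v ∈ d.support D, g u = g v → u = v := by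
    intro u hu v hv e
    have h1 := hg u hu
    have h2 := hg v hv
    rw [e] at h1
    exact d.diagram_injective (h1.unique_old h2)
  constructor
  · intro u hu
    rw [mem_support_iff, key _ (d.isMatching_dual _)]
    simp only [connVal_dual]
    rw [Finset.sum_eq_single u]
    · simp
    · intro v hv hne
      rw [if_neg fun e => hne (hinj v hv u hu e)]
    · exact fun h => absurd hu h
  · intro w hw
    rw [mem_support_iff, key _ (d.isMatching_dual _)] at hw
    simp only [connVal_dual] at hw
    by_contra hno
    rw [Finset.sum_eq_zero fun u hu => if_neg fun e => hno ⟨u, hu, e⟩] at hw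
    exact absurd hw (by decide)

end Direction

/-! ### Surgery near the boundary and basis decompositions -/

/-- There is a bypass system on `Γ` from which surgery in direction `d` gives `A`, and surgery in
the opposite direction gives `B`. -/
def SurgeryTo {n : ℕ} (d : Direction) (ι : Type) (Γ A B : ChordDiagram n) : Prop :=
  ∃ F : BypassSystem Γ ι, F.Gives d A ∧ F.Gives d.flip B

theorem surgeryTo_up {n : ℕ} {ι : Type} {Γ A B : ChordDiagram n} :
    SurgeryTo Direction.up ι Γ A B ↔ Surgery ι Γ A B := Iff.rfl

theorem surgeryTo_down {n : ℕ} {ι : Type} {Γ A B : ChordDiagram n} :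
    SurgeryTo Direction.down ι Γ A B ↔ Surgery ι Γ B A := by
  simp only [SurgeryTo, Surgery, Direction.flip, and_comm]

theorem SurgeryTo.insert {n : ℕ} {d : Direction} {ι : Type} {Γ A B : ChordDiagram n}
    {Γ' A' B' : ChordDiagram (n + 1)} (h : SurgeryTo d ι Γ A B) (φ : Frame n)
    (h1 : φ.Inserts Γ Γ') (h2 : φ.Inserts A A') (h3 : φ.Inserts B B') :
    SurgeryTo d ι Γ' A' B' := by
  cases d
  · exact Surgery.insert h φ h1 h2 h3
  · rw [surgeryTo_down] at h ⊢
    exact h.insert φ h1 h3 h2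

theorem SurgeryTo.collar {n : ℕ} {d : Direction} {ι : Type} [Finite ι]
    {Γ A B A' B' : ChordDiagram n}
    (h : SurgeryTo d ι Γ A B) {P : Fin 3 → Fin (2 * n)} (hP : IsCollarArc P)
    (hA : Function.Injective (A.ends P)) (hB : Function.Injective (B.ends P))
    (hA' : IsCollar d P A A') (hB' : IsCollar d.flip P B B') :
    SurgeryTo d (Option ι) Γ A' B' := by
  cases d
  · exact Surgery.collar h hP hA hB hA' hB'
  · rw [surgeryTo_down] at h ⊢
    exact h.collar hP hB hA hB' hA'

namespace Direction

variable (d : Direction) {n : ℕ} {P : Fin 3 → Fin (2 * n)}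

/-- The end of the arc near the boundary at the side of the chord that surgery inserts. -/
def src (P : Fin 3 → Fin (2 * n)) : Fin (2 * n) :=
  match d with
  | up => P 0
  | down => P 2

/-- The other end of the arc near the boundary. -/
def tgt (P : Fin 3 → Fin (2 * n)) : Fin (2 * n) :=
  match d with
  | up => P 2
  | down => P 0

end Direction

theorem ChordDiagram.IsCollar.partner {d : Direction} {n : ℕ} {P : Fin 3 → Fin (2 * n)}
    {A A' : ChordDiagram n} (h : IsCollar d P A A') :
    A'.partner (d.src P) = P 1 ∧ A'.partner (d.tgt P) = A.partner (d.src P) ∧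
      A'.partner (A.partner (P 1)) = A.partner (d.tgt P) ∧
      ∀ q, q ≠ d.src P → q ≠ P 1 → q ≠ d.tgt P → A.partner q ≠ d.src P → A.partner q ≠ P 1 →
        A.partner q ≠ d.tgt P → A'.partner q = A.partner q := by
  have hother : ∀ q, q ≠ P 0 → q ≠ P 1 → q ≠ P 2 → A.partner q ≠ P 0 → A.partner q ≠ P 1 →
        A.partner q ≠ P 2 → A'.partner q = A.partner q := by
    intro q h0 h1 h2 h3 h4 h5
    apply h.2
    intro j e
    have e' : A.partner q = A.ends P j.rev := by rw [A.ends_rev, e]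
    fin_cases j
    · exact h0 e.symm
    · exact h1 e.symm
    · exact h2 e.symm
    · exact h5 e'
    · exact h4 e'
    · exact h3 e'
  cases d
  · exact ⟨h.1 0, h.1 2, h.1 4, hother⟩
  · exact ⟨h.1 2, h.1 0, h.1 4, fun q h0 h1 h2 h3 h4 h5 => hother q h2 h1 h0 h5 h4 h3⟩

/-- Surgery near the boundary is the composition of capping off, in the frame `φc`, and insertion,
in the frame `φi`. -/
structure CollarFrames {n : ℕ} (d : Direction) (P : Fin 3 → Fin (2 * (n + 1)))
    (φi φc : Frame n) : Prop where
  arc : IsCollarArc P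
  ins : (φi.a = d.src P ∧ φi.b = P 1) ∨ (φi.a = P 1 ∧ φi.b = d.src P)
  cap : (φc.a = d.tgt P ∧ φc.b = P 1) ∨ (φc.a = P 1 ∧ φc.b = d.tgt P)
  map_src : ∀ x, φc.map x = d.src P → φi.map x = d.tgt P
  map_of_ne : ∀ x, φc.map x ≠ d.src P → φi.map x = φc.map x

namespace CollarFrames

variable {n : ℕ} {d : Direction} {P : Fin 3 → Fin (2 * (n + 1))} {φi φc : Frame n}

theorem capRel_symm {α β : Type*} {φ : β → α} {a b : α} {f : α → α} {f₀ : β → β}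
    (h : CapRel φ a b f f₀) : CapRel φ b a f f₀ := fun x => by
  rcases h x with h | h | h
  · exact Or.inl h
  · exact Or.inr (Or.inr h)
  · exact Or.inr (Or.inl h)

theorem map_c_ne (hF : CollarFrames d P φi φc) (x : Fin (2 * n)) :
    φc.map x ≠ P 1 ∧ φc.map x ≠ d.tgt P := by
  have h1 := φc.map_ne_a x
  have h2 := φc.map_ne_b x
  rcases hF.cap with ⟨e1, e2⟩ | ⟨e1, e2⟩
  · rw [e1] at h1; rw [e2] at h2; exact ⟨h2, h1⟩
  · rw [e1] at h1; rw [e2] at h2; exact ⟨h1, h2⟩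

theorem caps_of (hF : CollarFrames d P φi φc) {A : ChordDiagram (n + 1)} {A₀ : ChordDiagram n}
    (h1 : CapRel φc.map (P 1) (d.tgt P) A.partner A₀.partner) (h2 : A.partner (P 1) ≠ d.tgt P) :
    φc.Caps A A₀ := by
  rcases hF.cap with ⟨e1, e2⟩ | ⟨e1, e2⟩
  · refine ⟨?_, ?_⟩
    · rw [e1, e2]; exact capRel_symm h1
    · rw [e1, e2]; exact fun e => h2 (A.partner_eq_iff.1 e)
  · refine ⟨?_, ?_⟩
    · rw [e1, e2]; exact h1
    · rw [e1, e2]; exact h2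

theorem partner_ne_of_caps (hF : CollarFrames d P φi φc) {A : ChordDiagram (n + 1)}
    {A₀ : ChordDiagram n} (h : φc.Caps A A₀) :
    A.partner (P 1) ≠ d.tgt P := by
  rcases hF.cap with ⟨e1, e2⟩ | ⟨e1, e2⟩
  · have := h.2
    rw [e1, e2] at this
    exact fun e => this (A.partner_eq_iff.1 e)
  · have := h.2
    rwa [e1, e2] at this

theorem exists_inserts (hF : CollarFrames d P φi φc) {A : ChordDiagram (n + 1)}
    (h : A.partner (d.src P) = P 1) :
    ∃ A₀, φi.Inserts A₀ A := by
  apply φi.exists_inserts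
  rcases hF.ins with ⟨e1, e2⟩ | ⟨e1, e2⟩
  · rw [e1, e2, h]
  · rw [e1, e2]; exact A.partner_eq_iff.1 h

theorem map_c_of_map_i (hF : CollarFrames d P φi φc) {x : Fin (2 * n)}
    {z : Fin (2 * (n + 1))} (hz : z = φi.map x)
    (hz' : z ≠ d.tgt P) : z = φc.map x := by
  by_cases h : φc.map x = d.src P
  · exact absurd (hz.trans (hF.map_src x h)) hz'
  · rw [hz, hF.map_of_ne x h]

theorem map_c_of_map_i_tgt (hF : CollarFrames d P φi φc) {x : Fin (2 * n)}
    (hz : φi.map x = d.tgt P) : φc.map x = d.src P := by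
  by_contra h
  rw [hF.map_of_ne x h] at hz
  exact (hF.map_c_ne x).2 hz

theorem src_ne (hF : CollarFrames d P φi φc) :
    d.src P ≠ P 1 ∧ d.tgt P ≠ P 1 ∧ d.src P ≠ d.tgt P := by
  have := hF.arc.1
  cases d <;> refine ⟨?_, ?_, ?_⟩ <;> exact this.ne (by decide)

/-- Surgery joins `d.src P` to `P 1` by an outermost chord, hands the old chord of `d.src P` over to
`d.tgt P`, and joins the former partners of `P 1` and `d.tgt P`. The last is what capping off at
these points does; the first two are the insertion and its relabelling of `d.src P` as `d.tgt P`. -/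
theorem caps_of_isCollar (hF : CollarFrames d P φi φc) {A A' : ChordDiagram (n + 1)}
    {A₀ : ChordDiagram n}
    (hA : A.partner (d.src P) ≠ P 1 ∧ A.partner (P 1) ≠ d.tgt P ∧
      A.partner (d.src P) ≠ d.tgt P)
    (h : IsCollar d P A A') (hA₀ : φi.Inserts A₀ A') : φc.Caps A A₀ := by
  obtain ⟨g1, g2, g3⟩ := hA
  obtain ⟨c1, c2, c3, c4⟩ := h.partner
  have c3' : A'.partner (A.partner (d.tgt P)) = A.partner (P 1) := by
    rw [← c3, A'.partner_partner]
  have c2' : A'.partner (A.partner (d.src P)) = d.tgt P := by rw [← c2, A'.partner_partner]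
  refine hF.caps_of (fun x => ?_) g2
  have hx := hF.map_c_ne x
  have hins := hA₀.2 x
  by_cases hs : φc.map x = d.src P
  · left
    rw [hF.map_src x hs, c2] at hins
    rw [hs]
    exact hF.map_c_of_map_i hins g3
  · rw [hF.map_of_ne x hs] at hins
    by_cases h1 : A.partner (φc.map x) = P 1
    · refine Or.inr (Or.inl ⟨h1, ?_⟩)
      rw [← A.partner_eq_iff.1 h1, c3] at hins
      exact hF.map_c_of_map_i hins (A.partner_ne _)
    by_cases h2 : A.partner (φc.map x) = d.tgt P
    · refine Or.inr (Or.inr ⟨h2, ?_⟩)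
      rw [← A.partner_eq_iff.1 h2, c3'] at hins
      exact hF.map_c_of_map_i hins g2
    left
    by_cases h3 : A.partner (φc.map x) = d.src P
    · rw [← A.partner_eq_iff.1 h3, c2'] at hins
      rw [h3]
      exact (hF.map_c_of_map_i_tgt hins.symm).symm
    · rw [c4 _ hs hx.1 hx.2 h3 h1 h2] at hins
      exact hF.map_c_of_map_i hins h2

/-- Capping off is inverse to insertion. -/
theorem caps_of_inserts (hF : CollarFrames d P φi φc) {A : ChordDiagram (n + 1)}
    {A₀ : ChordDiagram n}
    (h : A.partner (d.src P) = P 1) (hA₀ : φi.Inserts A₀ A) : φc.Caps A A₀ := by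
  have hne := hF.src_ne
  have h' : A.partner (P 1) = d.src P := A.partner_eq_iff.1 h
  refine hF.caps_of (fun x => ?_) (by rw [h']; exact hne.2.2)
  have hx := hF.map_c_ne x
  have hins := hA₀.2 x
  by_cases hs : φc.map x = d.src P
  · refine Or.inr (Or.inl ⟨by rw [hs, h], ?_⟩)
    rw [hF.map_src x hs] at hins
    exact hF.map_c_of_map_i hins (A.partner_ne _)
  · rw [hF.map_of_ne x hs] at hins
    by_cases h2 : A.partner (φc.map x) = d.tgt P
    · refine Or.inr (Or.inr ⟨h2, ?_⟩)
      rw [h2] at hins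
      rw [h', hF.map_c_of_map_i_tgt hins.symm]
    · exact Or.inl (hF.map_c_of_map_i hins h2)

end CollarFrames

/-! ### The inductive step -/

/-- Surgery near the boundary acts on basis decompositions as it acts on basis chord diagrams. -/
theorem connVal_eq_sum_of_caps {n : ℕ} (d : Direction) {φi φc : Frame (n + 1)}
    {D' A' : ChordDiagram (n + 2)} {A₀ : ChordDiagram (n + 1)}
    {c : Word (n + 1) → Word n} {f : Word (n + 1) → Word (n + 1)}
    (hc : ∀ u ∈ d.support D', φc.Caps (d.diagram u) (d.diagram (c u)))
    (hf : ∀ u ∈ d.support D', φi.Inserts (d.diagram (c u)) (d.diagram (f u)))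
    (h1 : φc.Caps D' A₀) (h2 : φi.Inserts A₀ A')
    {h : Fin (2 * (n + 2)) → Fin (2 * (n + 2))} (hh : IsMatching h) :
    connVal h A'.partner = ∑ u ∈ d.support D', connVal h (d.diagram (f u)).partner := by
  rcases φi.exists_connVal_inserts (by omega) hh with H | ⟨h₀, hh₀, H⟩
  · rw [H _ _ h2]
    exact (Finset.sum_eq_zero fun u hu => H _ _ (hf u hu)).symm
  · obtain ⟨g, hg, -, G⟩ := φc.exists_connVal_caps (by omega) hh₀
    rw [H _ _ h2, G _ _ h1, d.connVal_eq_sum hg]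
    refine Finset.sum_congr rfl fun u hu => ?_
    rw [H _ _ (hf u hu), G _ _ (hc u hu)]

/-- If the points to be capped off are joined by a chord, the images of the basis decomposition
cancel. -/
theorem sum_connVal_eq_zero_of_partner {n : ℕ} (d : Direction) {φi φc : Frame (n + 1)}
    {D' : ChordDiagram (n + 2)}
    {c : Word (n + 1) → Word n} {f : Word (n + 1) → Word (n + 1)}
    (hc : ∀ u ∈ d.support D', φc.Caps (d.diagram u) (d.diagram (c u)))
    (hf : ∀ u ∈ d.support D', φi.Inserts (d.diagram (c u)) (d.diagram (f u)))
    (h1 : D'.partner φc.a = φc.b)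
    {h : Fin (2 * (n + 2)) → Fin (2 * (n + 2))} (hh : IsMatching h) :
    ∑ u ∈ d.support D', connVal h (d.diagram (f u)).partner = 0 := by
  rcases φi.exists_connVal_inserts (by omega) hh with H | ⟨h₀, hh₀, H⟩
  · exact Finset.sum_eq_zero fun u hu => H _ _ (hf u hu)
  · obtain ⟨g, hg, G0, G⟩ := φc.exists_connVal_caps (by omega) hh₀
    rw [← G0 _ h1, d.connVal_eq_sum hg]
    refine Finset.sum_congr rfl fun u hu => ?_
    rw [H _ _ (hf u hu), G _ _ (hc u hu)]

theorem Direction.add_connVal {n : ℕ} (d : Direction) {P : Fin 3 → Fin (2 * n)}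
    (hP : IsCollarArc P) {A U D : ChordDiagram n} (hA : Function.Injective (A.ends P))
    (hU : IsCollar d P A U) (hD : IsCollar d.flip P A D) {h : Fin (2 * n) → Fin (2 * n)}
    (hh : IsMatching h) :
    connVal h D.partner = connVal h A.partner + connVal h U.partner := by
  have key : ∀ x y z : ZMod 2, x + y + z = 0 → z = x + y ∧ y = x + z := by decide
  cases d
  · exact (key _ _ _ (connVal_bypassTriple hh (bypassTriple_of_isCollar hP hA hU hD))).1
  · exact (key _ _ _ (connVal_bypassTriple hh (bypassTriple_of_isCollar hP hA hD hU))).2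

namespace CollarFrames

theorem ends_injective {n : ℕ} {d : Direction} {P : Fin 3 → Fin (2 * (n + 1))} {φi φc : Frame n}
    (hF : CollarFrames d P φi φc) {A : ChordDiagram (n + 1)} (h1 : A.partner (d.src P) ≠ P 1)
    (h2 : A.partner (P 1) ≠ d.tgt P) :
    Function.Injective (A.ends P) ∧ A.partner (d.src P) ≠ d.tgt P := by
  have hinj : Function.Injective (A.ends P) := by
    cases d
    · exact hF.arc.ends_injective h1 h2
    · exact hF.arc.ends_injective (fun e => h2 (A.partner_eq_iff.1 e))
        (fun e => h1 (A.partner_eq_iff.1 e))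
  refine ⟨hinj, ?_⟩
  cases d
  · exact fun e => absurd (hinj (a₁ := 5) (a₂ := 2) e) (by decide)
  · exact fun e => absurd (hinj (a₁ := 3) (a₂ := 0) e) (by decide)

/-- One more arc near the boundary changes `b'` to `b = f b'` in direction `d`. In the other
direction it changes `D'` to `D = D' + f(D')`, by the bypass triple on `D'`. No `f u` equals `a`, so
`a` remains; `b` is absent from `D'` and hit only by `b'`, so it appears. -/
theorem exists_surgeryTo {n : ℕ} {d : Direction} {P : Fin 3 → Fin (2 * (n + 2))}
    {φi φc : Frame (n + 1)} (hF : CollarFrames d P φi φc) {ι : Type} [Finite ι]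
    {Γ D' : ChordDiagram (n + 2)} {a b b' : Word (n + 1)}
    (hΓ : SurgeryTo d ι Γ (d.diagram b') D')
    {c : Word (n + 1) → Word n} {f : Word (n + 1) → Word (n + 1)}
    (hc : ∀ u ∈ d.support D', φc.Caps (d.diagram u) (d.diagram (c u)))
    (hf : ∀ u ∈ d.support D', φi.Inserts (d.diagram (c u)) (d.diagram (f u)))
    (ha : a ∈ d.support D') (hb' : b' ∈ d.support D') (hb : b ∉ d.support D')
    (hfb : f b' = b) (hfa : ∀ u ∈ d.support D', f u ≠ a)
    (huniq : ∀ u ∈ d.support D', f u = b → u = b') :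
    ∃ D, SurgeryTo d (Option ι) Γ (d.diagram b) D ∧ a ∈ d.support D ∧ b ∈ d.support D ∧
      ∀ w ∈ d.support D, w ∈ d.support D' ∨ ∃ u ∈ d.support D', w = f u := by
  have hne : b ≠ b' := fun e => hb (e ▸ hb')
  have hsum_a : ∑ u ∈ d.support D', connVal (d.dual a) (d.diagram (f u)).partner = 0 :=
    Finset.sum_eq_zero fun u hu => by rw [d.connVal_dual, if_neg (hfa u hu)]
  have hsum_b : ∑ u ∈ d.support D', connVal (d.dual b) (d.diagram (f u)).partner = 1 := by
    rw [Finset.sum_eq_single b']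
    · rw [d.connVal_dual, if_pos hfb]
    · intro u hu hub
      rw [d.connVal_dual, if_neg fun e => hub (huniq u hu e)]
    · exact fun h => absurd hb' h
  -- the new arc meets three different chords of `D'`
  have hD1 : D'.partner (P 1) ≠ d.tgt P := by
    intro e
    have e' : D'.partner φc.a = φc.b := by
      rcases hF.cap with ⟨e1, e2⟩ | ⟨e1, e2⟩
      · rw [e1, e2]; exact D'.partner_eq_iff.1 e
      · rw [e1, e2]; exact e
    -- Capping off would close a loop, so the words `f u` would cancel; but `b` occurs among them
    -- exactly once.
    rw [sum_connVal_eq_zero_of_partner d hc hf e' (d.isMatching_dual b)] at hsum_b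
    exact absurd hsum_b (by decide)
  have hD2 : D'.partner (d.src P) ≠ P 1 := by
    intro e
    obtain ⟨A₀, hA₀⟩ := hF.exists_inserts e
    -- With this chord present, capping off and inserting returns `D'`, so `D' = f(D')`; but `a`
    -- occurs in `D'` and not among the `f u`.
    have := connVal_eq_sum_of_caps d hc hf (hF.caps_of_inserts e hA₀) hA₀ (d.isMatching_dual a)
    rw [hsum_a, d.mem_support_iff.1 ha] at this
    exact absurd this (by decide)
  obtain ⟨hDinj, hD3⟩ := hF.ends_injective hD2 hD1
  -- the new arc meets three different chords of `d.diagram b'`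
  have hB1 := hF.partner_ne_of_caps (hc b' hb')
  have hB2 : (d.diagram b').partner (d.src P) ≠ P 1 := by
    intro e
    obtain ⟨A₀, hA₀⟩ := hF.exists_inserts e
    -- As for `D'`, the diagram of `b'` would be returned unchanged, contradicting `f b' = b ≠ b'`.
    have h0 := (hF.caps_of_inserts e hA₀).unique (hc b' hb')
    rw [h0] at hA₀
    have := (hf b' hb').unique hA₀
    rw [hfb] at this
    exact hne (d.diagram_injective this)
  obtain ⟨hBinj, hB3⟩ := hF.ends_injective hB2 hB1
  obtain ⟨B, hB⟩ := exists_isCollar d hF.arc hBinj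
  have hBb : B = d.diagram b := by
    obtain ⟨A₀, hA₀⟩ := hF.exists_inserts hB.partner.1
    have h0 := (hF.caps_of_isCollar ⟨hB2, hB1, hB3⟩ hB hA₀).unique (hc b' hb')
    rw [h0] at hA₀
    rw [← hfb]
    exact hA₀.unique (hf b' hb')
  subst hBb
  obtain ⟨V, hV⟩ := exists_isCollar d hF.arc hDinj
  obtain ⟨D, hD⟩ := exists_isCollar d.flip hF.arc hDinj
  have hval : ∀ h, IsMatching h → connVal h D.partner =
      connVal h D'.partner + ∑ u ∈ d.support D', connVal h (d.diagram (f u)).partner := by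
    intro h hh
    obtain ⟨A₀, hA₀⟩ := hF.exists_inserts hV.partner.1
    rw [d.add_connVal hF.arc hDinj hV hD hh,
      connVal_eq_sum_of_caps d hc hf (hF.caps_of_isCollar ⟨hD2, hD1, hD3⟩ hV hA₀) hA₀ hh]
  refine ⟨D, hΓ.collar hF.arc hBinj hDinj hB hD, ?_, ?_, ?_⟩
  · rw [d.mem_support_iff, hval _ (d.isMatching_dual a), hsum_a, d.mem_support_iff.1 ha, add_zero]
  · rw [d.mem_support_iff, hval _ (d.isMatching_dual b), hsum_b, d.connVal_of_notMem hb, zero_add]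
  · intro w hw
    by_contra! hno
    rw [d.mem_support_iff, hval _ (d.isMatching_dual w), d.connVal_of_notMem hno.1, zero_add,
      Finset.sum_eq_zero] at hw
    · exact absurd hw (by decide)
    · intro u hu
      rw [d.connVal_dual, if_neg fun e => hno.2 u hu e.symm]

end CollarFrames

/-! ### Moves of words as surgery near the boundary -/

namespace CollarFrames

variable {n : ℕ}

theorem up {p : ℕ} (hn : 0 < n) (hp : p + 1 ≤ 2 * n) :
    CollarFrames Direction.up
      ![⟨p, by omega⟩, ⟨p + 1, by omega⟩, (⟨p + 2, by omega⟩ : Fin (2 * (n + 1)))]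
      (Frame.skipAt p (by omega)) (Frame.skipAt (p + 1) hp) where
  arc := isCollarArc_mk (by omega) (Or.inl rfl) (Or.inl rfl)
  ins := Or.inl ⟨rfl, rfl⟩
  cap := Or.inr ⟨rfl, rfl⟩
  map_src x h := by
    have h' := congrArg Fin.val h
    ext
    simp only [Frame.skipAt, skip, Direction.src, Direction.tgt, Matrix.cons_val] at h' ⊢
    split_ifs at h' ⊢ <;> omega
  map_of_ne x h := by
    have h' : ¬ _ = _ := fun e => h (Fin.ext e)
    ext
    simp only [Frame.skipAt, skip, Direction.src, Matrix.cons_val] at h' ⊢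
    split_ifs at h' ⊢ <;> omega

theorem down {p : ℕ} (hn : 0 < n) (hp : p + 1 ≤ 2 * n) :
    CollarFrames Direction.down
      ![⟨p, by omega⟩, ⟨p + 1, by omega⟩, (⟨p + 2, by omega⟩ : Fin (2 * (n + 1)))]
      (Frame.skipAt (p + 1) hp) (Frame.skipAt p (by omega)) where
  arc := isCollarArc_mk (by omega) (Or.inl rfl) (Or.inl rfl)
  ins := Or.inr ⟨rfl, rfl⟩
  cap := Or.inl ⟨rfl, rfl⟩
  map_src x h := by
    have h' := congrArg Fin.val h
    ext
    simp only [Frame.skipAt, skip, Direction.src, Direction.tgt, Matrix.cons_val] at h' ⊢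
    split_ifs at h' ⊢ <;> omega
  map_of_ne x h := by
    have h' : ¬ _ = _ := fun e => h (Fin.ext e)
    ext
    simp only [Frame.skipAt, skip, Direction.src, Matrix.cons_val] at h' ⊢
    split_ifs at h' ⊢ <;> omega

/-- The arc reaches across the base point. The chord is inserted at the base point itself, which
changes labels as `minusNew` does. -/
theorem down_base (hn : 0 < n) :
    CollarFrames Direction.down
      ![⟨2 * n, by omega⟩, ⟨2 * n + 1, by omega⟩, (⟨0, by omega⟩ : Fin (2 * (n + 1)))]
      (Frame.minus n) (Frame.skipAt (2 * n) le_rfl) where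
  arc := isCollarArc_mk (by omega) (Or.inl rfl) (Or.inr ⟨by simp only; omega, rfl⟩)
  ins := Or.inl ⟨rfl, rfl⟩
  cap := Or.inl ⟨rfl, rfl⟩
  map_src x h := by
    have hx := x.isLt
    have h' := congrArg Fin.val h
    ext
    simp only [Frame.skipAt, Frame.minus, minusNew, skip, Direction.src, Direction.tgt,
      Matrix.cons_val] at h' ⊢
    split_ifs at h' ⊢ <;> omega
  map_of_ne x h := by
    have hx := x.isLt
    have h' : ¬ _ = _ := fun e => h (Fin.ext e)
    ext
    simp only [Frame.skipAt, Frame.minus, minusNew, skip, Direction.src, Matrix.cons_val] at h' ⊢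
    split_ifs at h' ⊢ <;> omega

end CollarFrames

theorem ChordDiagram.IsCap.caps {n p : ℕ} {Γ' : ChordDiagram (n + 1)} {Γ : ChordDiagram n}
    (h : IsCap p Γ' Γ) : (Frame.skipAt p h.1).Caps Γ' Γ := Frame.capRel_skipAt h

namespace Word

theorem swap_insertPlus {n : ℕ} (w : Word n) (j : ℕ) :
    (w.insertPlus j).swap = w.swap.insertMinus j := by simp [insertMinus]

theorem swap_removePlus {n : ℕ} (w : Word (n + 1)) (j : ℕ) :
    (w.removePlus j).swap = w.swap.removeMinus j := by simp [removeMinus]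

theorem swap_insertMinus {n : ℕ} (w : Word n) (j : ℕ) :
    (w.insertMinus j).swap = w.swap.insertPlus j := by simp [insertMinus]

theorem swap_removeMinus {n : ℕ} (w : Word (n + 1)) (j : ℕ) :
    (w.removeMinus j).swap = w.swap.removePlus j := by simp [removeMinus]

end Word

namespace Direction

variable (d : Direction) (n : ℕ)

theorem exists_frame_cons (s : Sgn) :
    ∃ φ : Frame (n + 1), ∀ u : Word n, φ.Inserts (d.diagram u) (d.diagram (Word.cons s u)) := by
  have hp : ∃ φ : Frame (n + 1), ∀ u : Word n,
      φ.Inserts (basisDiagram u) (basisDiagram (Word.cons Sgn.plus u)) :=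
    ⟨Frame.skipAt 0 (by omega), fun u => by
      rw [basisDiagram_plus]; exact Frame.skipAt_inserts (isInsert_createPlus _)⟩
  have hm : ∃ φ : Frame (n + 1), ∀ u : Word n,
      φ.Inserts (basisDiagram u) (basisDiagram (Word.cons Sgn.minus u)) :=
    ⟨Frame.minus (n + 1), fun u => by rw [basisDiagram_minus]; exact Frame.minus_inserts _⟩
  cases d <;> cases s
  · exact hm
  · exact hp
  · obtain ⟨φ, h⟩ := hp
    exact ⟨φ, fun u => by simpa [diagram, view] using h u.swap⟩
  · obtain ⟨φ, h⟩ := hm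
    exact ⟨φ, fun u => by simpa [diagram, view] using h u.swap⟩

theorem exists_frame_insertPlus {j : ℕ} (hj : 1 ≤ j) (hjn : j ≤ n) :
    ∃ φ : Frame (n + 1), ∀ u : Word n, j ≤ u.numPlus →
      φ.Inserts (d.diagram u) (d.diagram (u.insertPlus j)) := by
  cases d
  · exact ⟨Frame.skipAt (2 * j) (by omega), fun u hu =>
      Frame.skipAt_inserts (isInsert_insertPlus u j hu)⟩
  · obtain ⟨i, rfl⟩ := Nat.exists_eq_add_of_le' hj
    refine ⟨Frame.skipAt (2 * n + 1 - 2 * i) (by omega), fun u hu => ?_⟩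
    rw [diagram, diagram, view, view, Word.swap_insertPlus]
    exact Frame.skipAt_inserts (isInsert_insertMinus _ i (by rw [Word.numMinus_swap]; omega))

theorem exists_frame_insertMinus :
    ∃ φ : Frame (n + 1), ∀ u : Word n, 1 ≤ u.numMinus →
      φ.Inserts (d.diagram u) (d.diagram (u.insertMinus 1)) := by
  cases d
  · exact ⟨Frame.skipAt (2 * n + 1 - 2 * 0) (by omega), fun u hu =>
      Frame.skipAt_inserts (isInsert_insertMinus u 0 hu)⟩
  · refine ⟨Frame.skipAt (2 * 1) (by omega), fun u hu => ?_⟩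
    rw [diagram, diagram, view, view, Word.swap_insertMinus]
    exact Frame.skipAt_inserts (isInsert_insertPlus _ 1 (by rw [Word.numPlus_swap]; exact hu))

theorem exists_frames_movePlus {j : ℕ} (hjn : j ≤ n) :
    ∃ (P : Fin 3 → Fin (2 * (n + 2))) (φi φc : Frame (n + 1)), CollarFrames d P φi φc ∧
      ∀ u : Word (n + 1), j < u.numPlus →
        φc.Caps (d.diagram u) (d.diagram (u.removePlus j)) ∧
        φi.Inserts (d.diagram (u.removePlus j)) (d.diagram ((u.removePlus j).insertPlus j)) := by
  cases d
  · refine ⟨_, _, _, CollarFrames.up (p := 2 * j) (by omega) (by omega), fun u hu => ?_⟩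
    have hr := Word.numPlus_removePlus u j hu
    exact ⟨(isCap_removePlus u j hu).caps,
      Frame.skipAt_inserts (isInsert_insertPlus _ j (show j ≤ (u.removePlus j).numPlus by omega))⟩
  · have hcap : ∀ u : Word (n + 1), j < u.numPlus → IsCap (2 * (n + 1) - 2 * j)
        (down.diagram u) (down.diagram (u.removePlus j)) := fun u hu => by
      rw [diagram, diagram, view, view, Word.swap_removePlus]
      exact isCap_removeMinus _ _ (by rwa [Word.numMinus_swap])
    rcases Nat.eq_zero_or_pos j with rfl | hj
    -- With exchanged signs, moving a sign to the front is an application of `B₋`, hence the arc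
    -- across the base point.
    · refine ⟨_, _, _, CollarFrames.down_base (by omega), fun u hu => ⟨(hcap u hu).caps, ?_⟩⟩
      rw [Word.insertPlus_zero, diagram, diagram, view, view, Word.swap_plus, basisDiagram_minus]
      exact Frame.minus_inserts _
    · obtain ⟨i, rfl⟩ := Nat.exists_eq_add_of_le' hj
      refine ⟨_, _, _, CollarFrames.down (p := 2 * (n + 1) - 2 * (i + 1)) (by omega) (by omega),
        fun u hu => ⟨(hcap u hu).caps, ?_⟩⟩
      have hr := Word.numPlus_removePlus u (i + 1) hu
      apply Frame.skipAt_inserts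
      have := isInsert_insertMinus (u.removePlus (i + 1)).swap i
        (by rw [Word.numMinus_swap]; omega)
      rw [← Word.swap_insertPlus] at this
      rwa [show 2 * n + 1 - 2 * i = 2 * (n + 1) - 2 * (i + 1) + 1 by omega] at this

theorem exists_frames_moveMinus :
    ∃ (P : Fin 3 → Fin (2 * (n + 2))) (φi φc : Frame (n + 1)), CollarFrames d P φi φc ∧
      ∀ u : Word (n + 1), 1 < u.numMinus →
        φc.Caps (d.diagram u) (d.diagram (u.removeMinus 0)) ∧
        φi.Inserts (d.diagram (u.removeMinus 0)) (d.diagram ((u.removeMinus 0).insertMinus 1)) := by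
  cases d
  · refine ⟨_, _, _, CollarFrames.up (p := 2 * n + 1) (by omega) (by omega), fun u hu => ?_⟩
    have hr := Word.numMinus_removeMinus u 0 (by omega)
    exact ⟨(isCap_removeMinus u 0 (by omega)).caps,
      Frame.skipAt_inserts (isInsert_insertMinus _ 0 (show 0 < (u.removeMinus 0).numMinus by omega))⟩
  · refine ⟨_, _, _, CollarFrames.down (p := 1) (by omega) (by omega), fun u hu => ?_⟩
    have hr := Word.numMinus_removeMinus u 0 (by omega)
    constructor
    · rw [diagram, diagram, view, view, Word.swap_removeMinus]
      exact (isCap_removePlus _ 0 (by rw [Word.numPlus_swap]; omega)).caps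
    · rw [diagram, diagram, view, view, Word.swap_insertMinus]
      exact Frame.skipAt_inserts
        (isInsert_insertPlus _ 1 (by rw [Word.numPlus_swap]; omega))

end Direction

/-! ### The main theorem -/

/-- Some bypass system on the basis chord diagram of `w₁` yields that of `w₂` in direction `d`, and
in the opposite direction a chord diagram whose basis decomposition has minimum `w₁` and maximum
`w₂`. -/
def HasSurgery (d : Direction) {n : ℕ} (w₁ w₂ : Word n) : Prop :=
  ∃ (ι : Type) (_ : Finite ι) (D : ChordDiagram (n + 1)),
    SurgeryTo d ι (d.diagram w₁) (d.diagram w₂) D ∧ w₁ ∈ d.support D ∧ w₂ ∈ d.support D ∧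
      ∀ w ∈ d.support D, Word.Dom w₁ w ∧ Word.Dom w w₂

namespace HasSurgery

variable {d : Direction} {n : ℕ}

theorem insert {w₁ w₂ : Word n} (h : HasSurgery d w₁ w₂) {φ : Frame (n + 1)}
    {g : Word n → Word (n + 1)} (hmono : ∀ u v, Word.Dom u v → Word.Dom (g u) (g v))
    (hg : ∀ u, Word.Dom w₁ u → φ.Inserts (d.diagram u) (d.diagram (g u))) :
    HasSurgery d (g w₁) (g w₂) := by
  obtain ⟨ι, hι, D, hS, h1, h2, h3⟩ := h
  obtain ⟨D', hD'⟩ := φ.exists_insert D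
  obtain ⟨k1, k2⟩ := d.support_insert hD' fun u hu => hg u (h3 u hu).1
  refine ⟨ι, hι, D', hS.insert φ (hg _ (h3 _ h1).1) (hg _ (h3 _ h2).1) hD', k1 _ h1, k1 _ h2,
    fun w hw => ?_⟩
  obtain ⟨u, hu, rfl⟩ := k2 w hw
  exact ⟨hmono _ _ (h3 u hu).1, hmono _ _ (h3 u hu).2⟩

/-- The map `u ↦ g (c u)` is increasing and monotone: new words stay above `w₁` and below the image
`w₂` of the old maximum. Also `w₂` is strictly above `w₂'`, so it does not occur in the old
decomposition. -/
theorem move {w₁ w₂' w₂ : Word (n + 1)} (h : HasSurgery d w₁ w₂') {P : Fin 3 → Fin (2 * (n + 2))}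
    {φi φc : Frame (n + 1)} (hF : CollarFrames d P φi φc) {c : Word (n + 1) → Word n}
    {g : Word n → Word (n + 1)}
    (hcap : ∀ u, Word.Dom w₁ u → φc.Caps (d.diagram u) (d.diagram (c u)))
    (hins : ∀ u, Word.Dom w₁ u → φi.Inserts (d.diagram (c u)) (d.diagram (g (c u))))
    (hmono : ∀ u v, Word.Dom w₁ u → Word.Dom u v → Word.Dom (g (c u)) (g (c v)))
    (hle : ∀ u, Word.Dom w₁ u → Word.Dom u (g (c u)))
    (hw : g (c w₂') = w₂) (hne : w₂ ≠ w₂') (hfix : ∀ u, Word.Dom w₁ u → g (c u) ≠ w₁)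
    (huniq : ∀ u, Word.Dom w₁ u → Word.Dom u w₂' → g (c u) = w₂ → u = w₂') :
    HasSurgery d w₁ w₂ := by
  obtain ⟨ι, hι, D', hS, h1, h2, h3⟩ := h
  have hle' : Word.Dom w₂' w₂ := hw ▸ hle _ (h3 _ h2).1
  obtain ⟨D, hD, k1, k2, k3⟩ := hF.exists_surgeryTo hS (fun u hu => hcap u (h3 u hu).1)
    (f := fun u => g (c u)) (fun u hu => hins u (h3 u hu).1) h1 h2
    (fun hb => hne ((h3 _ hb).2.antisymm hle')) hw (fun u hu => hfix u (h3 u hu).1)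
    (fun u hu => huniq u (h3 u hu).1 (h3 u hu).2)
  refine ⟨Option ι, inferInstance, D, hD, k1, k2, fun w hw' => ?_⟩
  rcases k3 w hw' with hu | ⟨u, hu, rfl⟩
  · exact ⟨(h3 w hu).1, (h3 w hu).2.trans hle'⟩
  · exact ⟨(h3 u hu).1.trans (hle u (h3 u hu).1), hw ▸ hmono _ _ (h3 u hu).1 (h3 u hu).2⟩

theorem of_related (d : Direction) {w₁ w₂ : Word n} (h : Word.Related w₁ w₂) :
    HasSurgery d w₁ w₂ := by
  induction h with
  | nil w₁ w₂ =>
    obtain rfl : w₁ = w₂ := Subsingleton.elim _ _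
    refine ⟨Empty, inferInstance, d.diagram w₁, ?_, ?_⟩
    · cases d
      · exact Surgery.empty _
      · exact surgeryTo_down.2 (Surgery.empty _)
    · simp only [d.support_diagram, Finset.mem_singleton, true_and, forall_eq]
      exact ⟨Word.Dom.refl _, Word.Dom.refl _⟩
  | @cons n s _ _ _ ih =>
    obtain ⟨φ, hφ⟩ := d.exists_frame_cons n s
    exact ih.insert (fun u v => (Word.dom_cons_iff s u v).2) fun u _ => hφ u
  | @insertPlus n j u₁ _ _ _ hj hju ih =>
    have := u₁.numMinus_add_numPlus
    obtain ⟨φ, hφ⟩ := d.exists_frame_insertPlus n hj (by omega)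
    exact ih.insert (fun u v h => h.insertPlus j) fun u hu => hφ u (hu.numPlus_eq ▸ hju)
  | @insertMinus n _ _ _ _ hu₁ ih =>
    obtain ⟨φ, hφ⟩ := d.exists_frame_insertMinus n
    exact ih.insert (fun u v h => h.insertMinus 1) fun u hu => hφ u (hu.1 ▸ hu₁)
  | @movePlus n j w₁ _ _ _ _ hj hw hne hfix huniq ih =>
    have := w₁.numMinus_add_numPlus
    obtain ⟨P, φi, φc, hF, hφ⟩ := d.exists_frames_movePlus n (j := j) (by omega)
    have hj' : ∀ u, Word.Dom w₁ u → j < u.numPlus := fun u hu => hu.numPlus_eq ▸ hj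
    exact ih.move hF (c := fun u => u.removePlus j) (g := fun u => u.insertPlus j)
      (fun u hu => (hφ u (hj' u hu)).1) (fun u hu => (hφ u (hj' u hu)).2)
      (fun u v hu huv => (huv.removePlus (hj' u hu)).insertPlus j)
      (fun u hu => Word.dom_removePlus_insertPlus u (hj' u hu)) hw hne
      (fun u hu => hfix u (hj' u hu)) huniq
  | @moveMinus n w₁ _ _ _ _ hj hw hne hfix huniq ih =>
    obtain ⟨P, φi, φc, hF, hφ⟩ := d.exists_frames_moveMinus n
    have hj' : ∀ u, Word.Dom w₁ u → 1 < u.numMinus := fun u hu => hu.1 ▸ hj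
    exact ih.move hF (c := fun u => u.removeMinus 0) (g := fun u => u.insertMinus 1)
      (fun u hu => (hφ u (hj' u hu)).1) (fun u hu => (hφ u (hj' u hu)).2)
      (fun u v hu huv => (huv.removeMinus (Nat.lt_of_succ_lt (hj' u hu))).insertMinus 1)
      (fun u hu => Word.dom_removeMinus_insertMinus u (hj' u hu)) hw hne
      (fun u hu => hfix u (hj' u hu)) huniq

end HasSurgery

theorem mainTheorem5 (n : ℕ) (w₁ w₂ : Word n) (h : w₁.Prec w₂) :
    (∃ (m : ℕ) (FBS : BypassSystem (basisDiagram w₁) (Fin m)),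
      FBS.Gives Direction.up (basisDiagram w₂) ∧
      ∃ Γ : ChordDiagram (n + 1), FBS.Gives Direction.down Γ ∧ HasMinMax Γ w₁ w₂) ∧
    (∃ (m : ℕ) (BBS : BypassSystem (basisDiagram w₂) (Fin m)),
      BBS.Gives Direction.down (basisDiagram w₁) ∧
      ∃ Γ : ChordDiagram (n + 1), BBS.Gives Direction.up Γ ∧ HasMinMax Γ w₁ w₂) := by
  have hdom := (Word.prec_iff_dom w₁ w₂).1 h
  constructor
  · obtain ⟨ι, hι, D, hS, h1, h2, h3⟩ :=
      HasSurgery.of_related Direction.up (Word.related_of_dom _ _ hdom)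
    obtain ⟨F, hU, hD⟩ := (surgeryTo_up.1 hS).reindex (Finite.equivFin ι).symm
    have hmem : ∀ w, w ∈ Direction.up.support D ↔ w ∈ basisSupport D := fun w => by
      rw [Direction.mem_support, mem_basisSupport]; rfl
    exact ⟨_, F, hU, D, hD, MinMax.hasMinMax
      ⟨(hmem _).1 h1, (hmem _).1 h2, fun w hw => h3 w ((hmem w).2 hw)⟩⟩
  · obtain ⟨ι, hι, D, hS, h1, h2, h3⟩ :=
      -- Exchanging signs reverses the order, so the construction now starts at `w₂` and ends at
      -- `w₁`, with downwards surgery in the leading role.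
      HasSurgery.of_related Direction.down (Word.related_of_dom _ _ (Word.dom_swap hdom))
    have hS' : Surgery ι (basisDiagram w₂) D (basisDiagram w₁) := by
      simpa [Direction.diagram, Direction.view] using surgeryTo_down.1 hS
    obtain ⟨F, hU, hD⟩ := hS'.reindex (Finite.equivFin ι).symm
    have hmem : ∀ w, w.swap ∈ Direction.down.support D ↔ w ∈ basisSupport D := fun w => by
      rw [Direction.mem_support, mem_basisSupport, Direction.dual, Direction.view, Word.swap_swap]
    refine ⟨_, F, hD, D, hU, MinMax.hasMinMax
      ⟨(hmem _).1 h2, (hmem _).1 h1, fun w hw => ?_⟩⟩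
    have := h3 w.swap ((hmem w).2 hw)
    exact ⟨by simpa using this.2.swap_left, by simpa using this.1.swap_left⟩
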